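/- **Setting.** Let $\pi:M\to B$ be a smooth surjective submersion from a 5-manifold $M$ with volume form $\Omega$ onto a 2-manifold $B$ with area form $\omega$. Let $\mathbb V=\ker d\pi$. For a multivector field $Q$ and a form $\eta$, $\mathbf i_Q\eta$ is the interior product with $\mathbf i_{X\wedge Y}=\mathbf i_X\circ\mathbf i_Y$; likewise $\mathbf i_{\alpha\wedge\beta}=\mathbf i_\alpha\circ\mathbf i_\beta$ for forms contracted with multivectors, with $\mathbf i_\alpha Q=Q(\alpha,\cdot,\dots)$ for a 1-form $\alpha$. Let $\psi$ be the bivector field on $B$ with $\mathbf i_\psi\omega=-1$, and $\Omega^{\mathrm H}=\pi^*\omega$. An Ehresmann connection is a smooth vector-valued 1-form $\gamma:TM\to\mathbb V$ with $\gamma|_{\mathbb V}=\mathrm{id}$; put $\mathbb H=\ker\gamma$. It induces the bigrading of tensors (horizontal degree, vertical degree) and the splitting $d=d_{1,0}+d_{2,-1}+d_{0,1}$, and $\mathrm{hor}^\gamma$ denotes the horizontal lift. Let $\Omega^{\mathrm V}$ be the form of bidegree $(0,3)$ with $\Omega=\Omega^{\mathrm H}\wedge\Omega^{\mathrm V}$,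 let $\mathrm Q_{\mathrm H}\in\Gamma\wedge^2\mathbb H$ and $\mathrm Q_{\mathrm V}\in\Gamma\wedge^3\mathbb V$ satisfy $\mathbf i_{\mathrm Q_{\mathrm H}}\Omega^{\mathrm H}=1$ and $\mathbf i_{\mathrm Q_{\mathrm V}}\Omega^{\mathrm V}=1$, and put $\theta=-\mathbf i_{\mathrm Q_{\mathrm V}}d_{1,0}\Omega^{\mathrm V}$, $\varrho=\mathbf i_{\mathrm Q_{\mathrm H}}d_{2,-1}\Omega^{\mathrm V}$. ($\mathrm Q_{\mathrm V}$ does not depend on $\gamma$.) A *Poisson triple* $(\gamma,\kappa,\beta)$ on an open set consists of an Ehresmann connection $\gamma$, a smooth function $\kappa$ and a smooth 1-form $\beta$ vanishing on $\mathbb H$, such that $$d_{0,1}\beta\wedge\beta=0,\qquad \kappa\,(d_{1,0}\beta-\theta\wedge\beta)=0,\qquad d_{0,1}\kappa\wedge\beta-\kappa^2\varrho=0 .$$ Its associated bivector field is $\Pi=\kappa\,\mathrm{hor}^\gamma\psi-\mathbf i_\beta\mathrm Q_{\mathrm V}$. Let $\{f,g\}_\beta=-\mathrm Q_{\mathrm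 V}(\beta,df,dg)$. For horizontal 1-forms $\alpha_1,\alpha_2$ (i.e. vanishing on $\mathbb V$), $\{\alpha_1\wedge\alpha_2\}_\beta$ is the horizontal 2-form given on $\pi$-projectable vector fields by $\{\alpha_1\wedge\alpha_2\}_\beta(Y_1,Y_2)=\{\alpha_1(Y_1),\alpha_2(Y_2)\}_\beta-\{\alpha_1(Y_2),\alpha_2(Y_1)\}_\beta$. Fix a smooth horizontal 1-form $\mu$ and a smooth function $c$ on $M$ with $d_{0,1}c\wedge\beta=0$. For $\varepsilon\in\mathbb R$ put $$\varkappa_{\mu,\varepsilon}=\frac{d_{1,0}^{\gamma}\mu+\tfrac{\varepsilon}{2}\{\mu\wedge\mu\}_\beta}{\pi^*\omega},\qquad \gamma_\varepsilon(X)=\gamma(X)+\varepsilon\,\mathbf i_{d_{0,1}\mu\wedge\beta}(\mathrm Q_{\mathrm V}\wedge X).$$ Let $\mathcal T_{\mu,c}(\gamma,\kappa,\beta)=\big(\gamma_1,\ \kappa/(1-\kappa(\varkappa_{\mu,1}-c)),\ \beta\big)$ and $\rho_\varepsilon(\gamma,\kappa,\beta)=(\gamma,\varepsilon\kappa,\varepsilon\beta)$.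 **Proposition.** Let $(\gamma,\kappa,\beta)$ be a Poisson triple on $M$ with associated bivector field $\Pi$, and let $(\mu,c)$ be as above. For $\varepsilon\in\mathbb R$ let $$\Pi_\varepsilon=\frac{\kappa}{1-\varepsilon\kappa\,(\varkappa_{\mu,\varepsilon}-c)}\,\mathrm{hor}^{\gamma_\varepsilon}\psi-\mathbf i_\beta\mathrm Q_{\mathrm V},\qquad \mathrm{Dom}(\Pi_\varepsilon)=\{p\in M: 1-\varepsilon\kappa(\varkappa_{\mu,\varepsilon}-c)\neq0\text{ at }p\}.$$ Then: 1. For every $\varepsilon\ne0$, $\ \rho_{1/\varepsilon}\circ\mathcal T_{\mu,c}\circ\rho_\varepsilon\,(\gamma,\kappa,\beta)=\big(\gamma_\varepsilon,\ \kappa/(1-\varepsilon\kappa(\varkappa_{\mu,\varepsilon}-c)),\ \beta\big)$. 2. The set $\{(\varepsilon,p): p\in\mathrm{Dom}(\Pi_\varepsilon)\}$ is open in $\mathbb R\times M$, and $\Pi_\varepsilon(p)$ depends smoothly on $(\varepsilon,p)$ there. 3. For every $\varepsilon\in\mathbb R$, $\gamma_\varepsilon$ is an Ehresmann connection on $M$,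 and $\big(\gamma_\varepsilon,\kappa/(1-\varepsilon\kappa(\varkappa_{\mu,\varepsilon}-c)),\beta\big)$ is a Poisson triple on $\mathrm{Dom}(\Pi_\varepsilon)$ whose associated bivector field is $\Pi_\varepsilon$. On $\mathrm{Dom}(\Pi_\varepsilon)$, $\Pi_\varepsilon$ is a Poisson tensor (its bracket satisfies the Jacobi identity) and is almost coupling via $\gamma_\varepsilon$, i.e. $\Pi_\varepsilon(a,b)=0$ whenever $a$ annihilates $\mathbb V$ and $b$ annihilates $\ker\gamma_\varepsilon$. 4. $\mathrm{Dom}(\Pi_0)=M$ and $\Pi_0=\Pi$. -/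

import Mathlib

open scoped Manifold ContDiff

noncomputable section

namespace FiberedPoisson

/-! ### Multilinear algebra of one tangent space -/

/-- The model space of an `n`-dimensional manifold.  In Mathlib the tangent space at `p` of a manifold
modelled on `E n` is, by definition, `E n` (read in the preferred chart at `p`), so fields of
tensors on tangent spaces are written with values in tensors on `E n`. -/
abbrev E (n : ℕ) : Type := EuclideanSpace ℝ (Fin n)

/-- Covectors. -/
abbrev Cov (n : ℕ) : Type := E n →L[ℝ] ℝ

/-- Exterior forms of degree `k`: alternating maps on vectors. -/
abbrev Alt (n k : ℕ) : Type := E n [⋀^Fin k]→L[ℝ] ℝ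

/-- Multivectors of degree `k`: alternating maps on covectors. -/
abbrev MV (n k : ℕ) : Type := Cov n [⋀^Fin k]→L[ℝ] ℝ

section Algebra

theorem update_castAdd {V : Type*} {k l : ℕ} (v : Fin (k + l) → V) (i : Fin k) (x : V) :
    (fun j : Fin k => Function.update v (Fin.castAdd l i) x (Fin.castAdd l j)) =
        Function.update (fun j => v (Fin.castAdd l j)) i x ∧
      (fun j : Fin l => Function.update v (Fin.castAdd l i) x (Fin.natAdd k j)) =
        fun j => v (Fin.natAdd k j) := by
  constructor
  · funext j
    by_cases h : j = i
    · subst h; simp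
    · rw [Function.update_of_ne h, Function.update_of_ne]
      exact fun h' => h (Fin.castAdd_injective k l h')
  · funext j
    rw [Function.update_of_ne]
    intro h'
    have := congrArg Fin.val h'
    simp at this
    omega

theorem update_natAdd {V : Type*} {k l : ℕ} (v : Fin (k + l) → V) (i : Fin l) (x : V) :
    (fun j : Fin l => Function.update v (Fin.natAdd k i) x (Fin.natAdd k j)) =
        Function.update (fun j => v (Fin.natAdd k j)) i x ∧
      (fun j : Fin k => Function.update v (Fin.natAdd k i) x (Fin.castAdd l j)) =
        fun j => v (Fin.castAdd l j) := by
  constructor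
  · funext j
    by_cases h : j = i
    · subst h; simp
    · rw [Function.update_of_ne h, Function.update_of_ne]
      exact fun h' => h (Fin.natAdd_injective l k h')
  · funext j
    rw [Function.update_of_ne]
    intro h'
    have := congrArg Fin.val h'
    simp at this
    omega

variable {V : Type*} [AddCommGroup V] [Module ℝ V] [TopologicalSpace V]

/-- The tensor product `α ⊗ β`. -/
def tensor {k l : ℕ} (α : V [⋀^Fin k]→L[ℝ] ℝ) (β : V [⋀^Fin l]→L[ℝ] ℝ) :
    ContinuousMultilinearMap ℝ (fun _ : Fin (k + l) => V) ℝ where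
  toFun v := α (fun i => v (Fin.castAdd l i)) * β (fun i => v (Fin.natAdd k i))
  map_update_add' := by
    intro inst v i x y
    obtain rfl : inst = instDecidableEqFin (k + l) := Subsingleton.elim _ _
    refine Fin.addCases (fun i => ?_) (fun i => ?_) i
    · have h := update_castAdd v i
      rw [(h _).1, (h _).2, (h x).1, (h x).2, (h y).1, (h y).2, α.map_update_add, add_mul]
    · have h := update_natAdd v i
      rw [(h _).1, (h _).2, (h x).1, (h x).2, (h y).1, (h y).2, β.map_update_add, mul_add]
  map_update_smul' := by
    intro inst v i r x
    obtain rfl : inst = instDecidableEqFin (k + l) := Subsingleton.elim _ _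
    refine Fin.addCases (fun i => ?_) (fun i => ?_) i
    · have h := update_castAdd v i
      rw [(h _).1, (h _).2, (h x).1, (h x).2, α.map_update_smul, smul_mul_assoc]
    · have h := update_natAdd v i
      rw [(h _).1, (h _).2, (h x).1, (h x).2, β.map_update_smul, mul_smul_comm]
  cont := by
    refine Continuous.mul (α.cont.comp ?_) (β.cont.comp ?_)
    · exact continuous_pi fun i => continuous_apply _
    · exact continuous_pi fun i => continuous_apply _

/-- The exterior product, normalised by `(a ∧ b)(v, w) = a(v) b(w) - a(w) b(v)`. -/
def wedge {k l : ℕ} (α : V [⋀^Fin k]→L[ℝ] ℝ) (β : V [⋀^Fin l]→L[ℝ] ℝ) :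
    V [⋀^Fin (k + l)]→L[ℝ] ℝ :=
  ((k.factorial : ℝ) * (l.factorial : ℝ))⁻¹ • ContinuousMultilinearMap.alternatization (tensor α β)

theorem tensor_apply {k l : ℕ} (α : V [⋀^Fin k]→L[ℝ] ℝ) (β : V [⋀^Fin l]→L[ℝ] ℝ)
    (v : Fin (k + l) → V) :
    tensor α β v = α (fun i => v (Fin.castAdd l i)) * β (fun i => v (Fin.natAdd k i)) := rfl

theorem wedge_apply {k l : ℕ} (α : V [⋀^Fin k]→L[ℝ] ℝ) (β : V [⋀^Fin l]→L[ℝ] ℝ)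
    (v : Fin (k + l) → V) :
    wedge α β v = ((k.factorial : ℝ) * (l.factorial : ℝ))⁻¹ *
      ∑ σ : Equiv.Perm (Fin (k + l)), ((Equiv.Perm.sign σ : ℤ) : ℝ) *
        (α (fun i => v (σ (Fin.castAdd l i))) * β (fun i => v (σ (Fin.natAdd k i)))) := by
  simp [wedge, ContinuousMultilinearMap.alternatization_apply_apply, tensor_apply, Units.smul_def]

theorem wedge_add_right {k l : ℕ} (α : V [⋀^Fin k]→L[ℝ] ℝ) (β β' : V [⋀^Fin l]→L[ℝ] ℝ) :
    wedge α (β + β') = wedge α β + wedge α β' := by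
  ext v
  simp only [wedge_apply, ContinuousAlternatingMap.add_apply, mul_add, Finset.sum_add_distrib]

theorem wedge_smul_right {k l : ℕ} (α : V [⋀^Fin k]→L[ℝ] ℝ) (r : ℝ) (β : V [⋀^Fin l]→L[ℝ] ℝ) :
    wedge α (r • β) = r • wedge α β := by
  ext v
  simp only [wedge_apply, ContinuousAlternatingMap.smul_apply, smul_eq_mul, Finset.mul_sum]
  refine Finset.sum_congr rfl fun σ _ => ?_
  ring

end Algebra

section Interior

variable {V W : Type*} [NormedAddCommGroup V] [NormedSpace ℝ V] [NormedAddCommGroup W]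
  [NormedSpace ℝ W]

/-- `insertAll x η = i_{x 0} (i_{x 1} (⋯ i_{x (k-1)} η))`, where `i_x η = η(x, ·, …, ·)`. -/
def insertAll {l : ℕ} : {k : ℕ} → (Fin k → V) → V [⋀^Fin (l + k)]→L[ℝ] ℝ → V [⋀^Fin l]→L[ℝ] ℝ
  | 0, _, η => η
  | _ + 1, x, η => insertAll (Fin.init x) (η.curryLeft (x (Fin.last _)))

theorem insertAll_add {l : ℕ} : ∀ {k : ℕ} (x : Fin k → V) (η η' : V [⋀^Fin (l + k)]→L[ℝ] ℝ),
    insertAll x (η + η') = insertAll x η + insertAll x η'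
  | 0, _, _, _ => rfl
  | _ + 1, x, η, η' => by
      rw [insertAll, insertAll, insertAll, ← insertAll_add]
      rfl

theorem insertAll_smul {l : ℕ} : ∀ {k : ℕ} (x : Fin k → V) (r : ℝ) (η : V [⋀^Fin (l + k)]→L[ℝ] ℝ),
    insertAll x (r • η) = r • insertAll x η
  | 0, _, _, _ => rfl
  | _ + 1, x, r, η => by
      rw [insertAll, insertAll, ← insertAll_smul]
      rfl

/-- The linear extension of `e (f 0) ∧ ⋯ ∧ e (f (k-1)) ↦ insertAll (e ∘ f)`, for a basis `e` of `V`
with dual basis `e'`: the interior product `i_Q η`. -/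
def interiorProd {ι : Type*} [Fintype ι] (e : ι → V) (e' : ι → W) {k l : ℕ}
    (Q : W [⋀^Fin k]→L[ℝ] ℝ) (η : V [⋀^Fin (l + k)]→L[ℝ] ℝ) : V [⋀^Fin l]→L[ℝ] ℝ :=
  ((k.factorial : ℝ))⁻¹ • ∑ f : Fin k → ι, Q (fun i => e' (f i)) • insertAll (fun i => e (f i)) η

theorem interiorProd_add {ι : Type*} [Fintype ι] (e : ι → V) (e' : ι → W) {k l : ℕ}
    (Q : W [⋀^Fin k]→L[ℝ] ℝ) (η η' : V [⋀^Fin (l + k)]→L[ℝ] ℝ) :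
    interiorProd e e' Q (η + η') = interiorProd e e' Q η + interiorProd e e' Q η' := by
  simp only [interiorProd, insertAll_add, smul_add, Finset.sum_add_distrib]

theorem interiorProd_smul {ι : Type*} [Fintype ι] (e : ι → V) (e' : ι → W) {k l : ℕ}
    (Q : W [⋀^Fin k]→L[ℝ] ℝ) (r : ℝ) (η : V [⋀^Fin (l + k)]→L[ℝ] ℝ) :
    interiorProd e e' Q (r • η) = r • interiorProd e e' Q η := by
  simp only [interiorProd, insertAll_smul, Finset.smul_sum, smul_comm r]

end Interior

/-- The standard basis vectors. -/
def basisVec {n : ℕ} (i : Fin n) : E n := EuclideanSpace.single i 1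

/-- The dual basis covectors. -/
def basisCov {n : ℕ} (i : Fin n) : Cov n := EuclideanSpace.proj i

/-- The interior product `i_Q η` of a form by a multivector, with `i_{X ∧ Y} = i_X ∘ i_Y`. -/
def iotaMV {n k l : ℕ} (Q : MV n k) (η : Alt n (l + k)) : Alt n l :=
  interiorProd basisVec basisCov Q η

/-- The interior product `i_α Q` of a multivector by a form, with `i_{α ∧ β} = i_α ∘ i_β` and
`i_α Q = Q(α, ·, …, ·)` for a covector `α`. -/
def iotaForm {n k l : ℕ} (α : Alt n k) (Q : MV n (l + k)) : MV n l :=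
  interiorProd basisCov basisVec α Q

/-- A form of degree one as a covector. -/
def toCov {n : ℕ} (α : Alt n 1) : Cov n :=
  (ContinuousAlternatingMap.ofSubsingleton ℝ (E n) ℝ (0 : Fin 1)).symm α

/-- A covector as a form of degree one. -/
def ofCov {n : ℕ} (a : Cov n) : Alt n 1 :=
  ContinuousAlternatingMap.ofSubsingleton ℝ (E n) ℝ (0 : Fin 1) a

/-- A vector as a multivector of degree one. -/
def ofVec {n : ℕ} (X : E n) : MV n 1 :=
  ContinuousAlternatingMap.ofSubsingleton ℝ (Cov n) ℝ (0 : Fin 1)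
    (ContinuousLinearMap.apply ℝ ℝ X)

/-- A multivector of degree one as a vector. -/
def toVec {n : ℕ} (Z : MV n 1) : E n := ∑ i, Z (fun _ => basisCov i) • basisVec i

/-- The value `∑_S α(w_1, …, w_k)` over the subsets `S` of size `p` of the slots, where `w_i` is the
horizontal part `v_i - γ v_i` if `i ∈ S` and the vertical part `γ v_i` otherwise. -/
def bidegFun {n k : ℕ} (γ : E n →L[ℝ] E n) (p : ℕ) (α : Alt n k) (v : Fin k → E n) : ℝ :=
  ∑ S ∈ Finset.powersetCard p (Finset.univ : Finset (Fin k)),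
    α (fun i => (if i ∈ S then ContinuousLinearMap.id ℝ (E n) - γ else γ) (v i))

theorem bidegFun_eq_zero {n k : ℕ} (γ : E n →L[ℝ] E n) (p : ℕ) (α : Alt n k) (v : Fin k → E n)
    (i j : Fin k) (hv : v i = v j) (hij : i ≠ j) : bidegFun γ p α v = 0 := by
  classical
  set τ : Equiv.Perm (Fin k) := Equiv.swap i j with hτ
  have hvτ : ∀ m, v (τ m) = v m := by
    intro m
    by_cases h1 : m = i
    · subst h1; simp [hτ, hv]
    · by_cases h2 : m = j
      · subst h2; simp [hτ, hv]
      · rw [hτ, Equiv.swap_apply_of_ne_of_ne h1 h2]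
  have key : bidegFun γ p α v = - bidegFun γ p α v := by
    conv_rhs => rw [bidegFun, ← Finset.sum_neg_distrib]
    rw [bidegFun]
    refine Finset.sum_bij' (fun S _ => S.map τ.toEmbedding) (fun S _ => S.map τ.symm.toEmbedding)
      ?_ ?_ ?_ ?_ ?_
    · intro S hS; simpa using hS
    · intro S hS; simpa using hS
    · intro S _; ext x; simp
    · intro S _; ext x; simp
    · intro S _
      refine Eq.trans ?_ (α.toAlternatingMap.map_swap _ hij)
      change α _ = α _
      rw [← hτ]
      congr 1
      funext m
      have : (τ m ∈ S.map τ.toEmbedding) ↔ m ∈ S := by simp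
      simp only [Function.comp, this, hvτ]
  linarith

/-- The component of bidegree `(p, k - p)` of a form of degree `k` (zero if `p > k`), with respect to
the splitting of the tangent space into `ker γ` and the image of the projector `γ`. -/
def bideg {n k : ℕ} (γ : E n →L[ℝ] E n) (p : ℕ) (α : Alt n k) : Alt n k where
  toContinuousMultilinearMap :=
    ∑ S ∈ Finset.powersetCard p (Finset.univ : Finset (Fin k)),
      α.toContinuousMultilinearMap.compContinuousLinearMap
        (fun i => if i ∈ S then ContinuousLinearMap.id ℝ (E n) - γ else γ)
  map_eq_zero_of_eq' := by
    intro v i j hv hij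
    have := bidegFun_eq_zero γ p α v i j hv hij
    simpa [bidegFun] using this

theorem bideg_apply {n k : ℕ} (γ : E n →L[ℝ] E n) (p : ℕ) (α : Alt n k) (v : Fin k → E n) :
    bideg γ p α v = bidegFun γ p α v := by
  change (∑ S ∈ Finset.powersetCard p (Finset.univ : Finset (Fin k)),
      α.toContinuousMultilinearMap.compContinuousLinearMap
        (fun i => if i ∈ S then ContinuousLinearMap.id ℝ (E n) - γ else γ)) v = _
  simp [bidegFun]

/-! ### Tensor fields on a manifold -/

section Fields

variable {n : ℕ} {N : Type*} [TopologicalSpace N] [ChartedSpace (E n) N]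

/-- The local representation of a differential form in the preferred chart at `p₀`. -/
def formInChart {k : ℕ} (p₀ : N) (α : N → Alt n k) (y : E n) : Alt n k :=
  (α ((extChartAt 𝓘(ℝ, E n) p₀).symm y)).compContinuousLinearMap
    (mfderiv 𝓘(ℝ, E n) 𝓘(ℝ, E n) (extChartAt 𝓘(ℝ, E n) p₀).symm y : E n →L[ℝ] E n)

/-- The local representation of a multivector field in the preferred chart at `p₀`. -/
def mvInChart {k : ℕ} (p₀ : N) (Q : N → MV n k) (y : E n) : MV n k :=
  (Q ((extChartAt 𝓘(ℝ, E n) p₀).symm y)).compContinuousLinearMap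
    ((ContinuousLinearMap.compL ℝ (E n) (E n) ℝ).flip
      (mfderiv 𝓘(ℝ, E n) 𝓘(ℝ, E n) (extChartAt 𝓘(ℝ, E n) p₀)
        ((extChartAt 𝓘(ℝ, E n) p₀).symm y) : E n →L[ℝ] E n))

/-- The local representation of a vector-valued `1`-form in the preferred chart at `p₀`. -/
def endoInChart (p₀ : N) (γ : N → E n →L[ℝ] E n) (y : E n) : E n →L[ℝ] E n :=
  (mfderiv 𝓘(ℝ, E n) 𝓘(ℝ, E n) (extChartAt 𝓘(ℝ, E n) p₀)
      ((extChartAt 𝓘(ℝ, E n) p₀).symm y) : E n →L[ℝ] E n) ∘L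
    γ ((extChartAt 𝓘(ℝ, E n) p₀).symm y) ∘L
    (mfderiv 𝓘(ℝ, E n) 𝓘(ℝ, E n) (extChartAt 𝓘(ℝ, E n) p₀).symm y : E n →L[ℝ] E n)

/-- The image in the preferred chart at `p₀` of the part of `U` that lies in the chart's domain. -/
def chartSet (p₀ : N) (U : Set N) : Set (E n) :=
  (extChartAt 𝓘(ℝ, E n) p₀).target ∩ (extChartAt 𝓘(ℝ, E n) p₀).symm ⁻¹' U

/-- Smoothness of a differential form on an open set `U`. -/
def IsSmoothFormOn {k : ℕ} (U : Set N) (α : N → Alt n k) : Prop :=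
  ∀ p₀ : N, ContDiffOn ℝ ∞ (formInChart p₀ α) (chartSet p₀ U)

/-- Smoothness of a multivector field on an open set `U`. -/
def IsSmoothMVOn {k : ℕ} (U : Set N) (Q : N → MV n k) : Prop :=
  ∀ p₀ : N, ContDiffOn ℝ ∞ (mvInChart p₀ Q) (chartSet p₀ U)

/-- Smoothness of a vector-valued `1`-form on an open set `U`. -/
def IsSmoothEndoOn (U : Set N) (γ : N → E n →L[ℝ] E n) : Prop :=
  ∀ p₀ : N, ContDiffOn ℝ ∞ (endoInChart p₀ γ) (chartSet p₀ U)

/-- Joint smoothness, on an open set `W` of pairs (parameter, point), of a family of multivector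
fields. -/
def IsSmoothMVFamilyOn {k : ℕ} (W : Set (ℝ × N)) (Q : ℝ → N → MV n k) : Prop :=
  ∀ p₀ : N, ContDiffOn ℝ ∞ (fun z : ℝ × E n => mvInChart p₀ (Q z.1) z.2)
    {z | z.2 ∈ (extChartAt 𝓘(ℝ, E n) p₀).target ∧ (z.1, (extChartAt 𝓘(ℝ, E n) p₀).symm z.2) ∈ W}

/-- The exterior differential, computed at `p` in the preferred chart at `p`. -/
def extD {k : ℕ} (α : N → Alt n k) (p : N) : Alt n (k + 1) :=
  (extDeriv (formInChart p α) (extChartAt 𝓘(ℝ, E n) p p)).compContinuousLinearMap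
    (mfderiv 𝓘(ℝ, E n) 𝓘(ℝ, E n) (extChartAt 𝓘(ℝ, E n) p) p : E n →L[ℝ] E n)

/-- A function as a form of degree zero. -/
def ofFun (f : N → ℝ) (p : N) : Alt n 0 :=
  ContinuousAlternatingMap.constOfIsEmpty ℝ (E n) (Fin 0) (f p)

/-- The differential of a function at a point, as a covector. -/
def dFun (f : N → ℝ) (p : N) : Cov n := (mfderiv 𝓘(ℝ, E n) 𝓘(ℝ, ℝ) f p : E n →L[ℝ] ℝ)

/-- The part of the exterior differential that raises the horizontal degree by `r`; on forms of
bidegree `(p, q)` it has values of bidegree `(p + r, q + 1 - r)`. -/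
def dPart {k : ℕ} (γ : N → E n →L[ℝ] E n) (r : ℕ) (α : N → Alt n k) (p : N) : Alt n (k + 1) :=
  ∑ s ∈ Finset.range (k + 1), bideg (γ p) (s + r) (extD (fun q => bideg (γ q) s (α q)) p)

/-- `d_{0,1}`. -/
def d01 {k : ℕ} (γ : N → E n →L[ℝ] E n) (α : N → Alt n k) : N → Alt n (k + 1) := dPart γ 0 α

/-- `d_{1,0}`. -/
def d10 {k : ℕ} (γ : N → E n →L[ℝ] E n) (α : N → Alt n k) : N → Alt n (k + 1) := dPart γ 1 α

/-- `d_{2,-1}`. -/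
def d2m1 {k : ℕ} (γ : N → E n →L[ℝ] E n) (α : N → Alt n k) : N → Alt n (k + 1) := dPart γ 2 α

/-- The bracket `{f, g} = P(df, dg)` of a bivector field. -/
def bracket (P : N → MV n 2) (f g : N → ℝ) (p : N) : ℝ := P p ![dFun f p, dFun g p]

/-- `P` is a Poisson tensor on the open set `U`: it is smooth there and its bracket satisfies the
Jacobi identity on the smooth functions on `U`. -/
def IsPoissonOn (U : Set N) (P : N → MV n 2) : Prop :=
  IsSmoothMVOn U P ∧
    ∀ f g h : N → ℝ, ContMDiffOn 𝓘(ℝ, E n) 𝓘(ℝ, ℝ) ∞ f U → ContMDiffOn 𝓘(ℝ, E n) 𝓘(ℝ, ℝ) ∞ g U →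
      ContMDiffOn 𝓘(ℝ, E n) 𝓘(ℝ, ℝ) ∞ h U → ∀ p ∈ U,
        bracket P f (bracket P g h) p + bracket P g (bracket P h f) p +
          bracket P h (bracket P f g) p = 0

/-- The quotient `η / θ` of two forms: the function `r` with `η = r θ`, for `η` proportional to the
nowhere vanishing form `θ`. -/
def ratio {k : ℕ} (η θ : N → Alt n k) (p : N) : ℝ := Classical.epsilon fun r : ℝ => η p = r • θ p

end Fields

/-! ### Fibered manifolds with `2`-dimensional base and `5`-dimensional total space -/

section Fibered

variable {M B : Type*} [TopologicalSpace M] [ChartedSpace (E 5) M] [TopologicalSpace B]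
  [ChartedSpace (E 2) B]

/-- The differential of the projection. -/
def dProj (π : M → B) (p : M) : E 5 →L[ℝ] E 2 :=
  (mfderiv 𝓘(ℝ, E 5) 𝓘(ℝ, E 2) π p : E 5 →L[ℝ] E 2)

/-- `γ` is the connection form of an Ehresmann connection over the open set `U`: a smooth projector
onto the vertical subbundle `ker dπ`. -/
def IsConnectionOn (π : M → B) (U : Set M) (γ : M → E 5 →L[ℝ] E 5) : Prop :=
  IsSmoothEndoOn U γ ∧ ∀ p ∈ U, (∀ v, dProj π p (γ p v) = 0) ∧ ∀ v, dProj π p v = 0 → γ p v = v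

/-- The horizontal lift of tangent vectors: the unique linear map `T_{π p} B → T_p M` with values in
`ker γ` that is a right inverse of `dπ`. -/
def horLift (π : M → B) (γ : M → E 5 →L[ℝ] E 5) (p : M) : E 2 →L[ℝ] E 5 :=
  Classical.epsilon fun L : E 2 →L[ℝ] E 5 =>
    dProj π p ∘L L = ContinuousLinearMap.id ℝ (E 2) ∧ γ p ∘L L = 0

/-- The horizontal lift of a bivector field `ψ` on the base. -/
def horMV (π : M → B) (γ : M → E 5 →L[ℝ] E 5) (ψ : B → MV 2 2) (p : M) : MV 5 2 :=
  (ψ (π p)).compContinuousLinearMap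
    ((ContinuousLinearMap.compL ℝ (E 2) (E 5) ℝ).flip (horLift π γ p))

/-- The Poisson tensor `ψ` of the symplectic surface `(B, ω₀)`: `i_ψ ω₀ = -1`. -/
def baseTensor (ω₀ : B → Alt 2 2) (b : B) : MV 2 2 :=
  Classical.epsilon fun Q : MV 2 2 => (iotaMV (l := 0) Q (ω₀ b)) ![] = -1

/-- The pull-back `Ω^H = π^* ω₀`. -/
def omegaH (π : M → B) (ω₀ : B → Alt 2 2) (p : M) : Alt 5 2 :=
  (ω₀ (π p)).compContinuousLinearMap (dProj π p)

/-- `Ω^V`: the unique `3`-form of bidegree `(0, 3)` with `Ω = Ω^H ∧ Ω^V`. -/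
def omegaV (π : M → B) (Ω : M → Alt 5 5) (ω₀ : B → Alt 2 2) (γ : M → E 5 →L[ℝ] E 5) (p : M) :
    Alt 5 3 :=
  Classical.epsilon fun η : Alt 5 3 => bideg (γ p) 0 η = η ∧ Ω p = wedge (omegaH π ω₀ p) η

/-- `Q_H`: the unique horizontal bivector field with `i_{Q_H} Ω^H = 1`. -/
def QH (π : M → B) (ω₀ : B → Alt 2 2) (γ : M → E 5 →L[ℝ] E 5) (p : M) : MV 5 2 :=
  Classical.epsilon fun Q : MV 5 2 =>
    (∀ a : Fin 2 → Cov 5, (∃ i, ∀ v, γ p v = 0 → a i v = 0) → Q a = 0) ∧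
      (iotaMV (l := 0) Q (omegaH π ω₀ p)) ![] = 1

/-- `Q_V`: the unique vertical trivector field with `i_{Q_V} Ω^V = 1`. -/
def QV (π : M → B) (Ω : M → Alt 5 5) (ω₀ : B → Alt 2 2) (γ : M → E 5 →L[ℝ] E 5) (p : M) : MV 5 3 :=
  Classical.epsilon fun Q : MV 5 3 =>
    (∀ a : Fin 3 → Cov 5, (∃ i, ∀ v, dProj π p v = 0 → a i v = 0) → Q a = 0) ∧
      (iotaMV (l := 0) Q (omegaV π Ω ω₀ γ p)) ![] = 1

/-- `θ = - i_{Q_V} d_{1,0} Ω^V`. -/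
def theta (π : M → B) (Ω : M → Alt 5 5) (ω₀ : B → Alt 2 2) (γ : M → E 5 →L[ℝ] E 5) (p : M) :
    Alt 5 1 :=
  -iotaMV (l := 1) (QV π Ω ω₀ γ p) (d10 γ (omegaV π Ω ω₀ γ) p)

/-- `ϱ = i_{Q_H} d_{2,-1} Ω^V`. -/
def rhoForm (π : M → B) (Ω : M → Alt 5 5) (ω₀ : B → Alt 2 2) (γ : M → E 5 →L[ℝ] E 5) (p : M) :
    Alt 5 2 :=
  iotaMV (l := 2) (QH π ω₀ γ p) (d2m1 γ (omegaV π Ω ω₀ γ) p)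

/-- The data `(γ, κ, β)`: a vector-valued `1`-form, a function and a `1`-form. -/
@[ext]
structure Triple (M : Type*) where
  γ : M → E 5 →L[ℝ] E 5
  κ : M → ℝ
  β : M → Alt 5 1

/-- `(γ, κ, β)` is a Poisson triple on the open set `U`, relative to `(Ω, ω₀)`. -/
structure IsPoissonTripleOn (π : M → B) (Ω : M → Alt 5 5) (ω₀ : B → Alt 2 2) (U : Set M)
    (t : Triple M) : Prop where
  connection : IsConnectionOn π U t.γ
  smooth_κ : ContMDiffOn 𝓘(ℝ, E 5) 𝓘(ℝ, ℝ) ∞ t.κ U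
  smooth_β : IsSmoothFormOn U t.β
  vertical_β : ∀ p ∈ U, ∀ v, t.γ p v = 0 → toCov (t.β p) v = 0
  eq1 : ∀ p ∈ U, wedge (d01 t.γ t.β p) (t.β p) = 0
  eq2 : ∀ p ∈ U, t.κ p • (d10 t.γ t.β p - wedge (theta π Ω ω₀ t.γ p) (t.β p)) = 0
  eq3 : ∀ p ∈ U,
    wedge (d01 t.γ (ofFun t.κ) p) (t.β p) - (t.κ p) ^ 2 • rhoForm π Ω ω₀ t.γ p = 0

/-- The bivector field `κ hor^γ ψ - i_β Q_V` of a triple. -/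
def tripleTensor (π : M → B) (Ω : M → Alt 5 5) (ω₀ : B → Alt 2 2) (t : Triple M) (p : M) : MV 5 2 :=
  t.κ p • horMV π t.γ (baseTensor ω₀) p - iotaForm (l := 2) (t.β p) (QV π Ω ω₀ t.γ p)

/-- On `U` the mixed component of `P` with respect to the connection `γ` vanishes: `P(a, b) = 0` if
`a` annihilates the vertical and `b` the horizontal vectors. -/
def IsAlmostCouplingOn (π : M → B) (U : Set M) (γ : M → E 5 →L[ℝ] E 5) (P : M → MV 5 2) : Prop :=
  ∀ p ∈ U, ∀ a b : Cov 5, (∀ v, dProj π p v = 0 → a v = 0) → (∀ v, γ p v = 0 → b v = 0) →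
    P p ![a, b] = 0

/-- The bracket `{f, g}_β = - Q_V(β, df, dg)`. -/
def betaBracket (π : M → B) (Ω : M → Alt 5 5) (ω₀ : B → Alt 2 2) (t : Triple M) (f g : M → ℝ)
    (p : M) : ℝ :=
  -QV π Ω ω₀ t.γ p ![toCov (t.β p), dFun f p, dFun g p]

/-- The coordinate vector field `∂ / ∂ x^i` of the preferred chart at `b₀`. -/
def coordField (b₀ : B) (i : Fin 2) (b : B) : E 2 :=
  (mfderiv 𝓘(ℝ, E 2) 𝓘(ℝ, E 2) (extChartAt 𝓘(ℝ, E 2) b₀).symm (extChartAt 𝓘(ℝ, E 2) b₀ b) :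
    E 2 →L[ℝ] E 2) (basisVec i)

/-- The pull-back to `M`, at the point `p`, of the coordinate form `dx^i` of the preferred chart at
`π p`. -/
def coordForm (π : M → B) (p : M) (i : Fin 2) : Alt 5 1 :=
  ofCov (basisCov i ∘L
    (mfderiv 𝓘(ℝ, E 2) 𝓘(ℝ, E 2) (extChartAt 𝓘(ℝ, E 2) (π p)) (π p) : E 2 →L[ℝ] E 2) ∘L dProj π p)

/-- The horizontal `2`-form `{α₁ ∧ α₂}_β` of two horizontal `1`-forms: if `Y_i` is the horizontal lift
of the coordinate field `∂ / ∂ x^i` of a chart of the base, then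
`{α₁ ∧ α₂}_β (Y_i, Y_j) = {α₁(Y_i), α₂(Y_j)}_β - {α₁(Y_j), α₂(Y_i)}_β`. -/
def braceForm (π : M → B) (Ω : M → Alt 5 5) (ω₀ : B → Alt 2 2) (t : Triple M)
    (α₁ α₂ : M → Alt 5 1) (p : M) : Alt 5 2 :=
  ∑ i : Fin 2, ∑ j : Fin 2,
    betaBracket π Ω ω₀ t
      (fun q => toCov (α₁ q) (horLift π t.γ q (coordField (π p) i (π q))))
      (fun q => toCov (α₂ q) (horLift π t.γ q (coordField (π p) j (π q)))) p •
        wedge (coordForm π p i) (coordForm π p j)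

/-- `ϰ_{μ,ε} = (d_{1,0} μ + (ε / 2) {μ ∧ μ}_β) / π^* ω₀`. -/
def varkappa (π : M → B) (Ω : M → Alt 5 5) (ω₀ : B → Alt 2 2) (μ : M → Alt 5 1) (ε : ℝ)
    (t : Triple M) : M → ℝ :=
  ratio (fun p => d10 t.γ μ p + (ε / 2) • braceForm π Ω ω₀ t μ μ p) (omegaH π ω₀)

/-- The vector-valued `1`-form `X ↦ i_{d_{0,1} μ ∧ β} (Q_V ∧ X)`. -/
def connShift (π : M → B) (Ω : M → Alt 5 5) (ω₀ : B → Alt 2 2) (μ : M → Alt 5 1) (t : Triple M)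
    (p : M) : E 5 →L[ℝ] E 5 :=
  LinearMap.toContinuousLinearMap
    { toFun := fun X => toVec (iotaForm (l := 1) (wedge (d01 t.γ μ p) (t.β p))
        (wedge (QV π Ω ω₀ t.γ p) (ofVec X) : MV 5 (3 + 1)))
      map_add' := by
        intro X Y
        have h : ofVec (X + Y) = ofVec X + ofVec Y := by ext a; simp [ofVec]
        rw [h, wedge_add_right, iotaForm, interiorProd_add]
        simp [toVec, iotaForm, add_smul, Finset.sum_add_distrib]
      map_smul' := by
        intro r X
        have h : ofVec (r • X) = r • ofVec X := by ext a; simp [ofVec]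
        rw [h, wedge_smul_right, iotaForm, interiorProd_smul]
        simp [toVec, iotaForm, mul_smul, Finset.smul_sum] }

/-- The transformation `T_{μ,c}`. -/
def gaugeTransf (π : M → B) (Ω : M → Alt 5 5) (ω₀ : B → Alt 2 2) (μ : M → Alt 5 1) (c : M → ℝ)
    (t : Triple M) : Triple M where
  γ p := t.γ p + connShift π Ω ω₀ μ t p
  κ p := t.κ p / (1 - t.κ p * (varkappa π Ω ω₀ μ 1 t p - c p))
  β := t.β

/-- The rescaling `ρ_ε`. -/
def rescale (ε : ℝ) (t : Triple M) : Triple M where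
  γ := t.γ
  κ p := ε * t.κ p
  β p := ε • t.β p

/-- `1 - ε κ (ϰ_{μ,ε} - c)`. -/
def famDenom (π : M → B) (Ω : M → Alt 5 5) (ω₀ : B → Alt 2 2) (μ : M → Alt 5 1) (c : M → ℝ)
    (t : Triple M) (ε : ℝ) (p : M) : ℝ :=
  1 - ε * t.κ p * (varkappa π Ω ω₀ μ ε t p - c p)

/-- The domain of definition of the `ε`-th member of the family. -/
def famDom (π : M → B) (Ω : M → Alt 5 5) (ω₀ : B → Alt 2 2) (μ : M → Alt 5 1) (c : M → ℝ)
    (t : Triple M) (ε : ℝ) : Set M :=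
  {p | famDenom π Ω ω₀ μ c t ε p ≠ 0}

/-- The connection form `γ_ε = γ + ε i_{d_{0,1} μ ∧ β} (Q_V ∧ ·)`. -/
def famConn (π : M → B) (Ω : M → Alt 5 5) (ω₀ : B → Alt 2 2) (μ : M → Alt 5 1) (t : Triple M)
    (ε : ℝ) (p : M) : E 5 →L[ℝ] E 5 :=
  t.γ p + ε • connShift π Ω ω₀ μ t p

/-- The triple `(γ_ε, κ / (1 - ε κ (ϰ_{μ,ε} - c)), β)`. -/
def famTriple (π : M → B) (Ω : M → Alt 5 5) (ω₀ : B → Alt 2 2) (μ : M → Alt 5 1) (c : M → ℝ)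
    (t : Triple M) (ε : ℝ) : Triple M where
  γ := famConn π Ω ω₀ μ t ε
  κ p := t.κ p / famDenom π Ω ω₀ μ c t ε p
  β := t.β

/-- The bivector field `Π_ε = κ / (1 - ε κ (ϰ_{μ,ε} - c)) hor^{γ_ε} ψ - i_β Q_V`. -/
def famTensor (π : M → B) (Ω : M → Alt 5 5) (ω₀ : B → Alt 2 2) (μ : M → Alt 5 1) (c : M → ℝ)
    (t : Triple M) (ε : ℝ) (p : M) : MV 5 2 :=
  (t.κ p / famDenom π Ω ω₀ μ c t ε p) • horMV π (famConn π Ω ω₀ μ t ε) (baseTensor ω₀) p -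
    iotaForm (l := 2) (t.β p) (QV π Ω ω₀ t.γ p)

end Fibered

end FiberedPoisson

end

open FiberedPoisson

/-! The statement is local. In coordinates (x^0, x^1, y^0, y^1, y^2) adapted to the submersion it
concerns two horizontal fields and a bracket along the fibres. Let h_i be the horizontal lift of
∂/∂x^i, w the coefficient of ω, u the reciprocal of the coefficient of Ω^V, and b the components of
β. The bivector -i_β Q_V has the bracket {f, g} = u det(b, df, dg), with fibrewise differentials and
Hamiltonian fields X_f, and Π = (κ/w) h_0 ∧ h_1 - i_β Q_V. The equations of a Poisson triple then
say: b is integrable along the fibres, so that {·,·} satisfies the Jacobi identity; where κ ≠ 0, the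
h_i are derivations of {·,·}; and, with α = κ/w, α² [h_0, h_1] = X_α. From these three facts the
Jacobi identity of Π follows by expansion (`LocalTriple.jacobi`).

The endomorphism i_{d_{0,1}μ ∧ β}(Q_V ∧ ·) kills vertical vectors and sends h_i to -X_{m_i}, where
m_i = μ(h_i). Hence the lifts for γ_ε are h_i + ε X_{m_i}. The form β is unchanged, so the first
equation persists. Hamiltonian fields are derivations of the bracket, so the second persists
(`parCoeff_gaugeG`). Expanding the commutator gives, where κ ≠ 0, [h_0, h_1] + ε X_F with F = h_0
m_1 - h_1 m_0 + ε {m_0, m_1} (`curv_gaugeG`), and F is w ϰ_{μ,ε} (`GaugeData.varkappa_eq`). Where κ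
≠ 0 the third equation reads [h_0, h_1] = -w X_{1/κ}; since w is constant along the fibres and X_c =
0, it survives exactly when 1/κ is replaced by 1/κ - ε (ϰ - c). This is the stated formula for the
new κ; `LocalTriple.gauge` verifies it without dividing by κ.

The passage between tensors and coordinates rests on the submersion theorem
(`exists_adapted_chart`), on the evaluation of every tensor of the statement in an adapted frame
(`AdaptedFrame`), and on `IsAdaptedChart.localTriple_iff`, which is used forwards for the given
triple and backwards for the transformed one. The conjugation by rescalings is mere homogeneity in
β; it does not reach ε = 0, so all other claims are proved directly for every ε. Joint smoothness
holds because the coordinate expressions are polynomial in ε up to the reciprocal of the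
denominator. -/

noncomputable section

namespace FiberedPoisson

open Filter Topology

/-! ### Exterior products of covectors and contraction by decomposable multivectors -/

section CovWedge

variable {V W : Type*} [NormedAddCommGroup V] [NormedSpace ℝ V] [NormedAddCommGroup W]
  [NormedSpace ℝ W]

/-- The exterior product `a 0 ∧ ⋯ ∧ a (k-1)` of linear functionals. -/
def covWedge {k : ℕ} (a : Fin k → V →L[ℝ] ℝ) : V [⋀^Fin k]→L[ℝ] ℝ :=
  ContinuousMultilinearMap.alternatization
    ((ContinuousMultilinearMap.mkPiAlgebra ℝ (Fin k) ℝ).compContinuousLinearMap a)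

theorem covWedge_apply_sum {k : ℕ} (a : Fin k → V →L[ℝ] ℝ) (v : Fin k → V) :
    covWedge a v = ∑ σ : Equiv.Perm (Fin k), ((Equiv.Perm.sign σ : ℤ) : ℝ) *
      ∏ i, a i (v (σ i)) := by
  simp [covWedge, ContinuousMultilinearMap.alternatization_apply_apply, Units.smul_def]

theorem covWedge_apply {k : ℕ} (a : Fin k → V →L[ℝ] ℝ) (v : Fin k → V) :
    covWedge a v = Matrix.det (Matrix.of fun i j => a i (v j)) := by
  rw [← Matrix.det_transpose, Matrix.det_apply', covWedge_apply_sum]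
  simp

theorem covWedge_one (a : V →L[ℝ] ℝ) (v : Fin 1 → V) : covWedge ![a] v = a (v 0) := by
  simp [covWedge_apply]

theorem covWedge_two (a : Fin 2 → V →L[ℝ] ℝ) (v : Fin 2 → V) :
    covWedge a v = a 0 (v 0) * a 1 (v 1) - a 0 (v 1) * a 1 (v 0) := by
  simp [covWedge_apply, Matrix.det_fin_two]

theorem covWedge_three (a : Fin 3 → V →L[ℝ] ℝ) (v : Fin 3 → V) :
    covWedge a v = a 0 (v 0) * (a 1 (v 1) * a 2 (v 2) - a 1 (v 2) * a 2 (v 1)) -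
      a 0 (v 1) * (a 1 (v 0) * a 2 (v 2) - a 1 (v 2) * a 2 (v 0)) +
      a 0 (v 2) * (a 1 (v 0) * a 2 (v 1) - a 1 (v 1) * a 2 (v 0)) := by
  simp [covWedge_apply, Matrix.det_fin_three]; ring

/-- Each product of two smaller determinants is a sum over block permutations (ρ, τ). Right
translation by a block permutation is a bijection of the full symmetric group, so every pair (ρ, τ)
contributes the whole determinant, and the k! l! copies cancel the normalisation. -/
theorem wedge_covWedge {k l : ℕ} (a : Fin k → V →L[ℝ] ℝ) (b : Fin l → V →L[ℝ] ℝ) :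
    wedge (covWedge a) (covWedge b) = covWedge (Fin.append a b) := by
  ext v
  rw [wedge_apply, covWedge_apply_sum]
  set F : Equiv.Perm (Fin (k + l)) → ℝ := fun σ => ((Equiv.Perm.sign σ : ℤ) : ℝ) *
      ∏ i, Fin.append a b i (v (σ i)) with hF
  set π : Equiv.Perm (Fin k) → Equiv.Perm (Fin l) → Equiv.Perm (Fin (k + l)) := fun ρ τ =>
    (finSumFinEquiv.symm.trans (Equiv.Perm.sumCongr ρ τ)).trans finSumFinEquiv with hπ
  have hsign : ∀ ρ τ, Equiv.Perm.sign (π ρ τ) = Equiv.Perm.sign ρ * Equiv.Perm.sign τ := by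
    intro ρ τ
    rw [← Equiv.Perm.sign_sumCongr, ← Equiv.Perm.sign_permCongr finSumFinEquiv
      (Equiv.Perm.sumCongr ρ τ)]
    rfl
  have key : ∀ σ : Equiv.Perm (Fin (k + l)), ((Equiv.Perm.sign σ : ℤ) : ℝ) *
      (covWedge a (fun i => v (σ (Fin.castAdd l i))) *
        covWedge b (fun i => v (σ (Fin.natAdd k i)))) = ∑ ρ, ∑ τ, F (σ * π ρ τ) := by
    intro σ
    rw [covWedge_apply_sum, covWedge_apply_sum, Finset.sum_mul_sum, Finset.mul_sum]
    refine Finset.sum_congr rfl fun ρ _ => ?_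
    rw [Finset.mul_sum]
    refine Finset.sum_congr rfl fun τ _ => ?_
    simp only [hF, Fin.prod_univ_add, Equiv.Perm.sign_mul, hsign]
    simp only [Equiv.Perm.mul_apply,
      Fin.append_left, Fin.append_right, hπ, Equiv.trans_apply, finSumFinEquiv_symm_apply_castAdd,
      finSumFinEquiv_symm_apply_natAdd, Equiv.Perm.sumCongr_apply, Sum.map_inl, Sum.map_inr,
      finSumFinEquiv_apply_left, finSumFinEquiv_apply_right]
    push_cast
    ring
  rw [Finset.sum_congr rfl fun σ _ => key σ, Finset.sum_comm]
  have h2 : ∀ ρ τ, ∑ σ, F (σ * π ρ τ) = ∑ σ, F σ := fun ρ τ =>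
    Equiv.sum_comp (Equiv.mulRight (π ρ τ)) F
  have h3 : ∀ ρ : Equiv.Perm (Fin k), ∑ σ, ∑ τ, F (σ * π ρ τ) = (l.factorial : ℝ) * ∑ σ, F σ := by
    intro ρ
    rw [Finset.sum_comm]
    simp only [h2]
    simp [Fintype.card_perm]
  simp only [h3]
  rw [Finset.sum_const, Finset.card_univ, Fintype.card_perm, Fintype.card_fin, nsmul_eq_mul]
  have : (k.factorial : ℝ) ≠ 0 := by positivity
  have : (l.factorial : ℝ) ≠ 0 := by positivity
  field_simp

theorem wedge_smul_left {k l : ℕ} (r : ℝ) (α : V [⋀^Fin k]→L[ℝ] ℝ) (β : V [⋀^Fin l]→L[ℝ] ℝ) :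
    wedge (r • α) β = r • wedge α β := by
  ext v
  simp only [wedge_apply, ContinuousAlternatingMap.smul_apply, smul_eq_mul, Finset.mul_sum]
  refine Finset.sum_congr rfl fun σ _ => ?_
  ring

theorem wedge_add_left {k l : ℕ} (α α' : V [⋀^Fin k]→L[ℝ] ℝ) (β : V [⋀^Fin l]→L[ℝ] ℝ) :
    wedge (α + α') β = wedge α β + wedge α' β := by
  ext v
  simp only [wedge_apply, ContinuousAlternatingMap.add_apply, add_mul, mul_add,
    Finset.sum_add_distrib]

/-- An alternating form that factors through the span of `x` along the functionals `a` is a multiple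
of their exterior product. -/
theorem eq_smul_covWedge {k : ℕ} (q : V [⋀^Fin k]→L[ℝ] ℝ) (x : Fin k → V) (a : Fin k → V →L[ℝ] ℝ)
    (h : ∀ v, q v = q fun j => ∑ i, a i (v j) • x i) : q = q x • covWedge a := by
  ext v
  -- Pulled back along `L`, the form has top degree on ℝ^k and is therefore a multiple of the
  -- determinant.
  let L : (Fin k → ℝ) →ₗ[ℝ] V := Fintype.linearCombination ℝ x
  have h1 := AlternatingMap.eq_smul_basis_det (Pi.basisFun ℝ (Fin k))
    (q.toAlternatingMap.compLinearMap L)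
  have h2 := congrArg (fun f => f fun j i => a i (v j)) h1
  rw [h v]
  have h3 : (q fun j => ∑ i, a i (v j) • x i) =
      (q.toAlternatingMap.compLinearMap L) fun j i => a i (v j) := by
    simp [AlternatingMap.compLinearMap_apply, L, Fintype.linearCombination_apply]
  have h4 : (q.toAlternatingMap.compLinearMap L) (Pi.basisFun ℝ (Fin k)) = q x := by
    simp only [AlternatingMap.compLinearMap_apply]
    change q _ = q _
    congr 1
    funext j
    simp [L, Fintype.linearCombination_apply, Pi.single_apply]
  rw [h3, h2]
  simp only [AlternatingMap.smul_apply, h4, ContinuousAlternatingMap.smul_apply, covWedge_apply,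
    Module.Basis.det_apply]
  congr 2

theorem insertFun_aux {l k : ℕ} (i : Fin (l + k)) (h : ¬ i.val < k) : i.val - k < l := by omega

/-- The arguments `x (k-1), …, x 0, v 0, …, v (l-1)`. -/
def insertFun {l k : ℕ} (x : Fin k → V) (v : Fin l → V) (i : Fin (l + k)) : V :=
  if h : i.val < k then x ⟨k - 1 - i.val, by omega⟩ else v ⟨i.val - k, insertFun_aux i h⟩

/-- The innermost contraction fills the first slot, so the inserted vectors appear in reversed
order. This reversal produces the signs in the formulas for ψ, Q_H and Q_V. -/
theorem insertAll_apply {l : ℕ} : ∀ {k : ℕ} (x : Fin k → V) (η : V [⋀^Fin (l + k)]→L[ℝ] ℝ)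
    (v : Fin l → V), insertAll x η v = η (insertFun x v)
  | 0, x, η, v => by
      rw [insertAll]
      congr 1
  | k + 1, x, η, v => by
      rw [insertAll, insertAll_apply]
      change η (Matrix.vecCons _ _) = _
      congr 1
      funext i
      refine Fin.cases ?_ (fun j => ?_) i
      · simp [insertFun, Fin.last]
      · simp only [Matrix.cons_val_succ, insertFun, Fin.val_succ, Fin.init]
        by_cases h : j.val < k
        · have h' : j.val + 1 < k + 1 := by omega
          simp only [h, h', dif_pos]
          congr 1
          ext
          simp
          omega
        · have h' : ¬ j.val + 1 < k + 1 := by omega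
          simp only [h, h', dif_neg, not_false_eq_true]
          congr 1
          ext
          simp

theorem insertFun_update {l k : ℕ} (x : Fin k → V) (v : Fin l → V) (j : Fin k) (y : V) :
    insertFun (Function.update x j y) v =
      Function.update (insertFun x v) ⟨k - 1 - j.val, by omega⟩ y := by
  funext i
  by_cases hi : i = ⟨k - 1 - j.val, by omega⟩
  · subst hi
    have h1 : k - 1 - j.val < k := by omega
    have h2 : (⟨k - 1 - (k - 1 - j.val), by omega⟩ : Fin k) = j := by ext; simp; omega
    simp [insertFun, h1, h2]
  · rw [Function.update_of_ne hi]
    unfold insertFun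
    split_ifs with h
    · rw [Function.update_of_ne]
      intro h'
      apply hi
      ext
      have := congrArg Fin.val h'
      simp at this ⊢
      omega
    · rfl

/-- `insertAll x η v` as an alternating function of `x`. -/
def insertAlt {l : ℕ} (k : ℕ) (η : V [⋀^Fin (l + k)]→L[ℝ] ℝ) (v : Fin l → V) :
    V [⋀^Fin k]→ₗ[ℝ] ℝ where
  toFun x := insertAll x η v
  map_update_add' := by
    intro inst x i y z
    obtain rfl : inst = instDecidableEqFin k := Subsingleton.elim _ _
    simp only [insertAll_apply, insertFun_update, η.map_update_add]
  map_update_smul' := by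
    intro inst x i y z
    obtain rfl : inst = instDecidableEqFin k := Subsingleton.elim _ _
    simp only [insertAll_apply, insertFun_update, η.map_update_smul]
  map_eq_zero_of_eq' := by
    intro x i j hx hij
    simp only [insertAll_apply]
    refine η.map_eq_zero_of_eq _ (i := ⟨k - 1 - i.val, by omega⟩) (j := ⟨k - 1 - j.val, by omega⟩)
      ?_ ?_
    · have h1 : k - 1 - i.val < k := by omega
      have h1' : k - 1 - j.val < k := by omega
      have h2 : (⟨k - 1 - (k - 1 - i.val), by omega⟩ : Fin k) = i := by ext; simp; omega
      have h3 : (⟨k - 1 - (k - 1 - j.val), by omega⟩ : Fin k) = j := by ext; simp; omega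
      simp [insertFun, h1, h1', h2, h3, hx]
    · intro h
      apply hij
      ext
      have := congrArg Fin.val h
      simp at this
      omega

/-- Expand A(x) in the basis. For each permutation in the determinant, reindexing f moves the
permutation into the arguments of A, where alternation returns the same sign; hence k! equal
contributions. -/
theorem sum_covWedge_mul {ι : Type*} [Fintype ι] (e : ι → V) (e' : ι → W) {k : ℕ}
    (φ : Fin k → W →L[ℝ] ℝ) (x : Fin k → V) (hx : ∀ j, x j = ∑ i, φ j (e' i) • e i)
    (A : V [⋀^Fin k]→ₗ[ℝ] ℝ) :
    ∑ f : Fin k → ι, covWedge φ (fun i => e' (f i)) * A (fun i => e (f i)) =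
      (k.factorial : ℝ) * A x := by
  classical
  have h1 : A x = ∑ f : Fin k → ι, (∏ i, φ i (e' (f i))) * A (fun i => e (f i)) := by
    have : x = fun j => ∑ i, φ j (e' i) • e i := funext hx
    rw [this]
    have := MultilinearMap.map_sum A.toMultilinearMap (fun j i => φ j (e' i) • e i)
    refine this.trans (Finset.sum_congr rfl fun f _ => ?_)
    exact MultilinearMap.map_smul_univ A.toMultilinearMap _ _
  simp only [covWedge_apply_sum, Finset.sum_mul]
  rw [Finset.sum_comm]
  have h2 : ∀ σ : Equiv.Perm (Fin k), ∑ f : Fin k → ι, ((Equiv.Perm.sign σ : ℤ) : ℝ) *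
      (∏ i, φ i (e' (f (σ i)))) * A (fun i => e (f i)) = A x := by
    intro σ
    rw [h1, ← (Equiv.arrowCongr σ (Equiv.refl ι)).sum_comp]
    refine Finset.sum_congr rfl fun f _ => ?_
    have h3 : (fun i => e ((Equiv.arrowCongr σ (Equiv.refl ι)) f i)) =
      (fun i => e (f i)) ∘ (σ⁻¹ : Equiv.Perm (Fin k)) := by
      funext i; simp [Equiv.arrowCongr]
    rw [h3, AlternatingMap.map_perm]
    simp [Equiv.arrowCongr, Units.smul_def]
    rcases Int.units_eq_one_or (Equiv.Perm.sign σ) with h | h <;> simp [h]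
  rw [Finset.sum_congr rfl fun σ _ => h2 σ]
  simp [Fintype.card_perm]

/-- The factor 1/k! in the definition cancels the k! copies, which confirms that `interiorProd` is
iterated insertion on decomposables. All contractions by bivectors and trivectors are evaluated
through this. -/
theorem interiorProd_covWedge {ι : Type*} [Fintype ι] (e : ι → V) (e' : ι → W) {k l : ℕ}
    (φ : Fin k → W →L[ℝ] ℝ) (x : Fin k → V) (hx : ∀ j, x j = ∑ i, φ j (e' i) • e i)
    (η : V [⋀^Fin (l + k)]→L[ℝ] ℝ) :
    interiorProd e e' (covWedge φ) η = insertAll x η := by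
  ext v
  have h := sum_covWedge_mul e e' φ x hx (insertAlt k η v)
  have hk : (k.factorial : ℝ) ≠ 0 := by positivity
  simp only [interiorProd, ContinuousAlternatingMap.smul_apply, ContinuousAlternatingMap.sum_apply,
    smul_eq_mul]
  rw [inv_mul_eq_iff_eq_mul₀ hk]
  exact h

theorem interiorProd_smul_left {ι : Type*} [Fintype ι] (e : ι → V) (e' : ι → W) {k l : ℕ}
    (r : ℝ) (Q : W [⋀^Fin k]→L[ℝ] ℝ) (η : V [⋀^Fin (l + k)]→L[ℝ] ℝ) :
    interiorProd e e' (r • Q) η = r • interiorProd e e' Q η := by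
  simp only [interiorProd, ContinuousAlternatingMap.smul_apply, smul_assoc, Finset.smul_sum,
    smul_comm r]

theorem interiorProd_add_left {ι : Type*} [Fintype ι] (e : ι → V) (e' : ι → W) {k l : ℕ}
    (Q Q' : W [⋀^Fin k]→L[ℝ] ℝ) (η : V [⋀^Fin (l + k)]→L[ℝ] ℝ) :
    interiorProd e e' (Q + Q') η = interiorProd e e' Q η + interiorProd e e' Q' η := by
  simp only [interiorProd, ContinuousAlternatingMap.add_apply, add_smul, smul_add,
    Finset.sum_add_distrib]

/-- A multilinear map does not change when arguments are changed by vectors it annihilates. -/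
theorem map_congr_of_sub {k : ℕ} (Q : V [⋀^Fin k]→L[ℝ] ℝ) (K : V → Prop)
    (hQ : ∀ a : Fin k → V, (∃ i, K (a i)) → Q a = 0) (v w : Fin k → V)
    (h : ∀ i, K (v i - w i)) : Q v = Q w := by
  classical
  -- The slots are switched one at a time; each switch changes the value by an evaluation with an
  -- annihilated argument.
  have step : ∀ (s : Finset (Fin k)), Q (s.piecewise w v) = Q v := by
    intro s
    induction s using Finset.induction_on with
    | empty => simp
    | insert i s hi ih =>
      rw [← ih, Finset.piecewise_insert, ← sub_eq_zero]
      have h1 : s.piecewise w v = Function.update (s.piecewise w v) i (v i) := by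
        rw [eq_comm, Function.update_eq_self_iff]
        simp [hi]
      conv_lhs => rw [h1]
      -- `K` is given for v i - w i but not for its negative, so the sign is first extracted as a
      -- scalar.
      rw [Function.update_idem, ← Q.map_update_sub, ← neg_sub, ← neg_one_smul ℝ,
        Q.map_update_smul, hQ _ ⟨i, by simpa using h i⟩, smul_zero]
  rw [← step Finset.univ, Finset.piecewise_univ]

/-- Evaluation at a vector. -/
def evalAt (x : V) : (V →L[ℝ] ℝ) →L[ℝ] ℝ := ContinuousLinearMap.apply ℝ ℝ x

@[simp]
theorem evalAt_apply (x : V) (a : V →L[ℝ] ℝ) : evalAt x a = a x := rfl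

end CovWedge

/-! ### Explicit formulas in low degree -/

section WedgeFormulas

variable {V : Type*} [NormedAddCommGroup V] [NormedSpace ℝ V]

theorem ofCov_eq_covWedge {n : ℕ} (a : Cov n) : ofCov a = covWedge ![a] := by
  ext v
  rw [covWedge_one]
  rfl

theorem ofVec_eq_covWedge {n : ℕ} (X : E n) : ofVec X = covWedge ![evalAt X] := by
  ext v
  rw [covWedge_one]
  rfl

theorem toCov_apply {n : ℕ} (α : Alt n 1) (x : E n) : toCov α x = α ![x] := by
  have : (![x] : Fin 1 → E n) = fun _ => x := by
    funext i
    simp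
  rw [this]
  rfl

theorem ofCov_toCov {n : ℕ} (α : Alt n 1) : ofCov (toCov α) = α := by
  simp [ofCov, toCov]

theorem wedge_one_one {n : ℕ} (α β : Alt n 1) (v : Fin 2 → E n) :
    wedge α β v = toCov α (v 0) * toCov β (v 1) - toCov α (v 1) * toCov β (v 0) := by
  rw [← ofCov_toCov α, ← ofCov_toCov β, ofCov_eq_covWedge, ofCov_eq_covWedge, wedge_covWedge,
    covWedge_two]
  simp [Fin.append, Fin.addCases, ← ofCov_eq_covWedge, ofCov, toCov]

/-- Here α need not be presented as decomposable, so the six permutations of three letters are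
summed by hand; they pair off by the antisymmetry of α. -/
theorem wedge_two_one {n : ℕ} (α : Alt n 2) (β : Alt n 1) (v : Fin 3 → E n) :
    wedge α β v = α ![v 0, v 1] * toCov β (v 2) - α ![v 0, v 2] * toCov β (v 1) +
      α ![v 1, v 2] * toCov β (v 0) := by
  have huniv : (Finset.univ : Finset (Equiv.Perm (Fin (2 + 1)))) =
      {1, Equiv.swap 0 1, Equiv.swap 0 2, Equiv.swap 1 2, Equiv.swap 0 1 * Equiv.swap 1 2,
        Equiv.swap 1 2 * Equiv.swap 0 1} := by decide
  have hα : ∀ x y, α ![y, x] = - α ![x, y] := by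
    intro x y
    have := α.toAlternatingMap.map_swap ![x, y] (i := 0) (j := 1) (by decide)
    have h2 : (![x, y] ∘ (Equiv.swap (0 : Fin 2) 1)) = ![y, x] := by
      funext i
      fin_cases i <;> rfl
    rw [h2] at this
    exact this
  have h1 : ∀ σ : Equiv.Perm (Fin (2 + 1)), (fun i : Fin 2 => v (σ (Fin.castAdd 1 i))) =
      ![v (σ 0), v (σ 1)] := by
    intro σ
    funext i
    fin_cases i <;> rfl
  have h2 : ∀ σ : Equiv.Perm (Fin (2 + 1)), (fun i : Fin 1 => v (σ (Fin.natAdd 2 i))) =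
      ![v (σ 2)] := by
    intro σ
    funext i
    fin_cases i
    rfl
  rw [wedge_apply, huniv]
  simp only [h1, h2, ← toCov_apply]
  rw [Finset.sum_insert (by decide), Finset.sum_insert (by decide), Finset.sum_insert (by decide),
    Finset.sum_insert (by decide), Finset.sum_insert (by decide), Finset.sum_singleton]
  have e1 : (Equiv.swap 0 1 * Equiv.swap 1 2 : Equiv.Perm (Fin (2 + 1))) 0 = 1 := by decide
  have e2 : (Equiv.swap 0 1 * Equiv.swap 1 2 : Equiv.Perm (Fin (2 + 1))) 1 = 2 := by decide
  have e3 : (Equiv.swap 0 1 * Equiv.swap 1 2 : Equiv.Perm (Fin (2 + 1))) 2 = 0 := by decide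
  have e4 : (Equiv.swap 1 2 * Equiv.swap 0 1 : Equiv.Perm (Fin (2 + 1))) 0 = 2 := by decide
  have e5 : (Equiv.swap 1 2 * Equiv.swap 0 1 : Equiv.Perm (Fin (2 + 1))) 1 = 0 := by decide
  have e6 : (Equiv.swap 1 2 * Equiv.swap 0 1 : Equiv.Perm (Fin (2 + 1))) 2 = 1 := by decide
  have e7 : (Equiv.swap (0 : Fin (2 + 1)) 1) 2 = 2 := by decide
  have e8 : (Equiv.swap (1 : Fin (2 + 1)) 2) 0 = 0 := by decide
  have e9 : (Equiv.swap (0 : Fin (2 + 1)) 2) 1 = 1 := by decide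
  have s1 : Equiv.Perm.sign (Equiv.swap (0 : Fin (2 + 1)) 1) = -1 := by decide
  have s2 : Equiv.Perm.sign (Equiv.swap (0 : Fin (2 + 1)) 2) = -1 := by decide
  have s3 : Equiv.Perm.sign (Equiv.swap (1 : Fin (2 + 1)) 2) = -1 := by decide
  rw [e1, e2, e3, e4, e5, e6, e7, e8, e9, Equiv.swap_apply_left, Equiv.swap_apply_right,
    Equiv.swap_apply_left, Equiv.swap_apply_right, Equiv.swap_apply_left, Equiv.swap_apply_right,
    Equiv.Perm.sign_mul, Equiv.Perm.sign_mul, s1, s2, s3]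
  simp only [Equiv.Perm.one_apply, Equiv.Perm.sign_one, Nat.factorial]
  rw [hα (v 0) (v 1), hα (v 0) (v 2), hα (v 1) (v 2)]
  push_cast
  ring

theorem insertAll_one {W : Type*} [NormedAddCommGroup W] [NormedSpace ℝ W] {l : ℕ} (x : Fin 1 → W)
    (η : W [⋀^Fin (l + 1)]→L[ℝ] ℝ) (v : Fin l → W) :
    insertAll x η v = η (Matrix.vecCons (x 0) v) := by
  rw [insertAll, insertAll]
  rfl

theorem insertAll_two {l : ℕ} (x : Fin 2 → V) (η : V [⋀^Fin (l + 2)]→L[ℝ] ℝ) (v : Fin l → V) :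
    insertAll x η v = η (Matrix.vecCons (x 1) (Matrix.vecCons (x 0) v)) := by
  rw [insertAll, insertAll, insertAll]
  rfl

theorem insertAll_three {l : ℕ} (x : Fin 3 → V) (η : V [⋀^Fin (l + 3)]→L[ℝ] ℝ) (v : Fin l → V) :
    insertAll x η v =
      η (Matrix.vecCons (x 2) (Matrix.vecCons (x 1) (Matrix.vecCons (x 0) v))) := by
  rw [insertAll, insertAll, insertAll, insertAll]
  rfl

theorem vec_eq_sum {n : ℕ} (x : E n) : x = ∑ i, basisCov i x • basisVec i := by
  ext j
  simp [basisCov, basisVec, Finset.sum_apply, Pi.single_apply]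

theorem cov_eq_sum {n : ℕ} (a : Cov n) : a = ∑ i, a (basisVec i) • basisCov i := by
  ext x
  conv_lhs => rw [vec_eq_sum x]
  simp [mul_comm]

theorem iotaMV_covWedge {n k l : ℕ} (x : Fin k → E n) (η : Alt n (l + k)) :
    iotaMV (covWedge fun j => evalAt (x j)) η = insertAll x η :=
  interiorProd_covWedge _ _ _ _ (fun j => vec_eq_sum (x j)) η

theorem iotaForm_covWedge {n k l : ℕ} (a : Fin k → Cov n) (Q : MV n (l + k)) :
    iotaForm (covWedge a) Q = insertAll a Q :=
  interiorProd_covWedge _ _ _ _ (fun j => cov_eq_sum (a j)) Q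

theorem iotaMV_smul_left {n k l : ℕ} (r : ℝ) (Q : MV n k) (η : Alt n (l + k)) :
    iotaMV (r • Q) η = r • iotaMV Q η := interiorProd_smul_left _ _ _ _ _

theorem iotaForm_smul_right {n k l : ℕ} (r : ℝ) (α : Alt n k) (Q : MV n (l + k)) :
    iotaForm α (r • Q) = r • iotaForm α Q := interiorProd_smul _ _ _ _ _

theorem iotaForm_smul_left {n k l : ℕ} (r : ℝ) (α : Alt n k) (Q : MV n (l + k)) :
    iotaForm (r • α) Q = r • iotaForm α Q := interiorProd_smul_left _ _ _ _ _

theorem iotaForm_add_left {n k l : ℕ} (α α' : Alt n k) (Q : MV n (l + k)) :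
    iotaForm (α + α') Q = iotaForm α Q + iotaForm α' Q := interiorProd_add_left _ _ _ _ _

theorem apply_toVec {n : ℕ} (a : Cov n) (Z : MV n 1) : a (toVec Z) = Z ![a] := by
  have hZ : ∀ b : Cov n, Z ![b] =
      (ContinuousAlternatingMap.ofSubsingleton ℝ (Cov n) ℝ (0 : Fin 1)).symm Z b := by
    intro b
    have : (![b] : Fin 1 → Cov n) = fun _ => b := by
      funext i
      simp
    rw [this]
    rfl
  have hZ' : ∀ b : Cov n, Z (fun _ => b) =
      (ContinuousAlternatingMap.ofSubsingleton ℝ (Cov n) ℝ (0 : Fin 1)).symm Z b := fun _ => rfl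
  rw [hZ]
  conv_rhs => rw [cov_eq_sum a]
  simp only [toVec, hZ', map_sum, map_smul, smul_eq_mul]
  exact Finset.sum_congr rfl fun i _ => mul_comm _ _

end WedgeFormulas

/-! ### Bidegree components and the parts of the exterior differential -/

section Bidegree

/-- When every argument is horizontal (index in S) or vertical, id - γ kills the vertical arguments
and γ the horizontal ones. Any subset other than S therefore puts a zero into some slot. -/
theorem bideg_apply_of_split {n k : ℕ} (γ : E n →L[ℝ] E n) (p : ℕ) (α : Alt n k) (v : Fin k → E n)
    (S : Finset (Fin k)) (hS : ∀ i ∈ S, γ (v i) = 0) (hS' : ∀ i ∉ S, γ (v i) = v i) :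
    bideg γ p α v = if S.card = p then α v else 0 := by
  rw [bideg_apply, bidegFun]
  have h0 : ∀ T : Finset (Fin k), T ≠ S →
      α (fun i => (if i ∈ T then ContinuousLinearMap.id ℝ (E n) - γ else γ) (v i)) = 0 := by
    intro T hT
    by_contra hne
    apply hT
    ext i
    by_contra hi
    apply hne
    refine α.toAlternatingMap.map_coord_zero i ?_
    by_cases h1 : i ∈ T
    · have h2 : i ∉ S := fun h => hi ⟨fun _ => h, fun _ => h1⟩
      simp [h1, hS' i h2]
    · have h2 : i ∈ S := by
        by_contra h
        exact hi ⟨fun h' => absurd h' h1, fun h' => absurd h' h⟩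
      simp [h1, hS i h2]
  have h1 : α (fun i => (if i ∈ S then ContinuousLinearMap.id ℝ (E n) - γ else γ) (v i)) = α v := by
    congr 1
    funext i
    by_cases h : i ∈ S
    · simp [h, hS i h]
    · simp [h, hS' i h]
  split_ifs with h
  · rw [Finset.sum_eq_single S (fun T _ hT => h0 T hT)
      (fun hn => absurd (Finset.mem_powersetCard.2 ⟨Finset.subset_univ _, h⟩) hn), h1]
  · refine Finset.sum_eq_zero fun T hT => h0 T ?_
    rintro rfl
    exact h (Finset.mem_powersetCard.1 hT).2

/-- Idempotence of γ makes id - γ take values in ker γ, so every summand with a nonempty set of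
horizontal slots vanishes. -/
theorem bideg_of_vertical {n k : ℕ} (γ : E n →L[ℝ] E n) (hγ : ∀ x, γ (γ x) = γ x) (α : Alt n k)
    (hα : ∀ v : Fin k → E n, (∃ i, γ (v i) = 0) → α v = 0) (s : ℕ) :
    bideg γ s α = if s = 0 then α else 0 := by
  ext v
  rw [bideg_apply, bidegFun]
  split_ifs with h
  · subst h
    simp only [Finset.powersetCard_zero, Finset.sum_singleton, Finset.notMem_empty, if_false]
    refine map_congr_of_sub α (fun x => γ x = 0) hα _ _ fun i => ?_
    simp [hγ]
  · refine Finset.sum_eq_zero fun S hS => hα _ ?_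
    have hc := (Finset.mem_powersetCard.1 hS).2
    obtain ⟨i, hi⟩ : S.Nonempty := by
      rw [← Finset.card_pos]
      omega
    exact ⟨i, by simp [hi, hγ]⟩

theorem bideg_one_form_of_horizontal {n : ℕ} (γ : E n →L[ℝ] E n) (α : Alt n 1)
    (hα : ∀ x, toCov α (γ x) = 0) (s : ℕ) (hs : s < 2) :
    bideg γ s α = if s = 1 then α else 0 := by
  ext v
  have hv : v = ![v 0] := by
    funext i
    fin_cases i
    rfl
  rw [bideg_apply, bidegFun]
  interval_cases s
  · simp only [Finset.powersetCard_zero, Finset.sum_singleton, Finset.notMem_empty, if_false]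
    have := hα (v 0)
    rw [toCov_apply] at this
    refine Eq.trans ?_ this
    congr 1
    funext i
    fin_cases i
    rfl
  · have : Finset.powersetCard 1 (Finset.univ : Finset (Fin 1)) = {Finset.univ} := by decide
    rw [this]
    simp only [Finset.sum_singleton, Finset.mem_univ, if_true]
    have h1 : (fun i => (ContinuousLinearMap.id ℝ (E n) - γ) (v i)) = ![v 0 - γ (v 0)] := by
      funext i
      fin_cases i
      simp
    rw [h1, ← toCov_apply, map_sub, hα, sub_zero, toCov_apply, ← hv]

theorem extD_congr {n : ℕ} {N : Type*} [TopologicalSpace N] [ChartedSpace (E n) N] {k : ℕ}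
    {α β : N → Alt n k} (h : ∀ q, α q = β q) (p : N) : extD α p = extD β p := by
  have : α = β := funext h
  rw [this]

theorem extD_zero {n : ℕ} {N : Type*} [TopologicalSpace N] [ChartedSpace (E n) N] {k : ℕ}
    (p : N) : extD (fun _ : N => (0 : Alt n k)) p = 0 := by
  have h1 : formInChart p (fun _ : N => (0 : Alt n k)) = fun _ => 0 := by
    funext y
    rfl
  have h2 : extDeriv (fun _ : E n => (0 : Alt n k)) (extChartAt 𝓘(ℝ, E n) p p) = 0 := by
    ext v
    simp [extDeriv, ContinuousAlternatingMap.alternatizeUncurryFin_apply]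
  rw [extD, h1, h2]
  rfl

theorem bideg_zero_form {n k : ℕ} (γ : E n →L[ℝ] E n) (s : ℕ) :
    bideg γ s (0 : Alt n k) = 0 := by
  ext v
  simp [bideg_apply, bidegFun]

/-- For a form of pure bidegree the sum over components collapses to one term. Purity is required at
every point, not just at p, because the differential sees the neighbouring values. It applies to β
and Ω^V with horizontal degree 0, and to μ with horizontal degree 1. -/
theorem dPart_of_pure {n : ℕ} {N : Type*} [TopologicalSpace N] [ChartedSpace (E n) N] {k : ℕ}
    (γ : N → E n →L[ℝ] E n) (r s₀ : ℕ) (α : N → Alt n k) (p : N) (hs : s₀ ≤ k)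
    (h : ∀ q, ∀ s ≤ k, bideg (γ q) s (α q) = if s = s₀ then α q else 0) :
    dPart γ r α p = bideg (γ p) (s₀ + r) (extD α p) := by
  rw [dPart, Finset.sum_eq_single s₀]
  · congr 1
    exact extD_congr (fun q => by rw [h q s₀ hs, if_pos rfl]) p
  · intro s hs' hne
    rw [Finset.mem_range] at hs'
    have : extD (fun q => bideg (γ q) s (α q)) p = 0 := by
      rw [← extD_zero p]
      exact extD_congr (fun q => by rw [h q s (by omega), if_neg hne]) p
    rw [this, bideg_zero_form]
  · intro h'
    exact absurd (Finset.mem_range.2 (by omega)) h'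

end Bidegree

/-! ### Linear algebra of adapted frames -/

/-- A basis of a tangent space adapted to the splitting into `ker g` and `ker P = im g`, with its dual
basis and the basis of the tangent space of the base onto which the horizontal vectors project. -/
structure AdaptedFrame (P : E 5 →L[ℝ] E 2) (g : E 5 →L[ℝ] E 5) where
  H : Fin 2 → E 5
  V : Fin 3 → E 5
  h : Fin 2 → Cov 5
  η : Fin 3 → Cov 5
  C : Fin 2 → E 2
  cc : Fin 2 → Cov 2
  h_H : ∀ i j, h i (H j) = if i = j then 1 else 0
  h_V : ∀ i a, h i (V a) = 0
  η_H : ∀ a i, η a (H i) = 0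
  η_V : ∀ a b, η a (V b) = if a = b then 1 else 0
  decomp : ∀ x, x = ∑ i, h i x • H i + ∑ a, η a x • V a
  P_H : ∀ i, P (H i) = C i
  P_V : ∀ a, P (V a) = 0
  g_H : ∀ i, g (H i) = 0
  g_V : ∀ a, g (V a) = V a
  cc_C : ∀ i j, cc i (C j) = if i = j then 1 else 0
  decompB : ∀ y, y = ∑ i, cc i y • C i

namespace AdaptedFrame

variable {P : E 5 →L[ℝ] E 2} {g : E 5 →L[ℝ] E 5} (F : AdaptedFrame P g)

include F

theorem cc_P (i : Fin 2) (x : E 5) : F.cc i (P x) = F.h i x := by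
  conv_lhs => rw [F.decomp x]
  fin_cases i <;> simp [F.P_H, F.P_V, F.cc_C, Fin.sum_univ_two]

theorem h_eq_zero_of_P {x : E 5} (hx : P x = 0) (i : Fin 2) : F.h i x = 0 := by
  rw [← F.cc_P, hx, map_zero]

theorem g_apply (x : E 5) : g x = ∑ a, F.η a x • F.V a := by
  conv_lhs => rw [F.decomp x]
  simp [F.g_H, F.g_V]

theorem eq_sum_of_g {x : E 5} (hx : g x = 0) : x = ∑ i, F.h i x • F.H i := by
  have h1 := F.decomp x
  rwa [← F.g_apply, hx, add_zero] at h1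

theorem η_eq_zero_of_g {x : E 5} (hx : g x = 0) (a : Fin 3) : F.η a x = 0 := by
  rw [F.eq_sum_of_g hx]
  simp [F.η_H]

theorem g_g (x : E 5) : g (g x) = g x := by
  simp [F.g_apply x, F.g_V]

/-- The vectors of the frame, horizontal ones first. -/
def all : Fin 5 → E 5 := Fin.append (m := 2) (n := 3) F.H F.V

/-- The dual basis of `all`. -/
def allCov : Fin 5 → Cov 5 := Fin.append (m := 2) (n := 3) F.h F.η

theorem covWedge_all : covWedge F.allCov F.all = 1 := by
  rw [covWedge_apply, ← Matrix.det_one (n := Fin 5) (R := ℝ)]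
  congr 1
  ext i j
  refine Fin.addCases (m := 2) (n := 3) (fun i => ?_) (fun i => ?_) i <;>
  refine Fin.addCases (m := 2) (n := 3) (fun j => ?_) (fun j => ?_) j
  · simp [all, allCov, F.h_H, Matrix.one_apply, Fin.ext_iff]
  · simp [all, allCov, F.h_V, Matrix.one_apply, Fin.ext_iff]
    omega
  · simp [all, allCov, F.η_H, Matrix.one_apply, Fin.ext_iff]
    omega
  · simp [all, allCov, F.η_V, Matrix.one_apply, Fin.ext_iff]

/-- The members of the frame. -/
def vec : Fin 2 ⊕ Fin 3 → E 5 := Sum.elim F.H F.V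

theorem form_ext {k : ℕ} {α β : Alt 5 k}
    (h : ∀ f : Fin k → Fin 2 ⊕ Fin 3, α (fun i => F.vec (f i)) = β (fun i => F.vec (f i))) :
    α = β := by
  classical
  ext v
  have hv : v = fun j => ∑ s : Fin 2 ⊕ Fin 3, (Sum.elim F.h F.η s) (v j) • F.vec s := by
    funext j
    rw [Fintype.sum_sum_type]
    exact F.decomp (v j)
  rw [hv]
  have key : ∀ ξ : Alt 5 k, ξ (fun j => ∑ s : Fin 2 ⊕ Fin 3, (Sum.elim F.h F.η s) (v j) • F.vec s) =
      ∑ f : Fin k → Fin 2 ⊕ Fin 3, (∏ j, (Sum.elim F.h F.η (f j)) (v j)) *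
        ξ (fun i => F.vec (f i)) := by
    intro ξ
    refine (MultilinearMap.map_sum ξ.toMultilinearMap
      (fun j s => (Sum.elim F.h F.η s) (v j) • F.vec s)).trans ?_
    exact Finset.sum_congr rfl fun f _ => MultilinearMap.map_smul_univ ξ.toMultilinearMap _ _
  rw [key, key]
  exact Finset.sum_congr rfl fun f _ => by rw [h f]

theorem two_form_ext {α β : Alt 5 2} (hHH : ∀ i j, α ![F.H i, F.H j] = β ![F.H i, F.H j])
    (hHV : ∀ i a, α ![F.H i, F.V a] = β ![F.H i, F.V a])
    (hVV : ∀ a b, α ![F.V a, F.V b] = β ![F.V a, F.V b]) : α = β := by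
  have sw : ∀ (ξ : Alt 5 2) x y, ξ ![y, x] = - ξ ![x, y] := by
    intro ξ x y
    have := ξ.toAlternatingMap.map_swap ![x, y] (i := 0) (j := 1) (by decide)
    have h2 : (![x, y] ∘ (Equiv.swap (0 : Fin 2) 1)) = ![y, x] := by
      funext i
      fin_cases i <;> rfl
    rw [h2] at this
    exact this
  refine F.form_ext fun f => ?_
  have hf : (fun i => F.vec (f i)) = ![F.vec (f 0), F.vec (f 1)] := by
    funext i
    fin_cases i <;> rfl
  rw [hf]
  rcases f 0 with i | a <;> rcases f 1 with j | b
  · exact hHH i j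
  · exact hHV i b
  · rw [sw α, sw β]
    exact congrArg Neg.neg (hHV j a)
  · exact hVV a b

theorem vertical_form_eq {α : Alt 5 3} (hα : ∀ v : Fin 3 → E 5, (∃ i, g (v i) = 0) → α v = 0) :
    α = α F.V • covWedge F.η := by
  refine eq_smul_covWedge α F.V F.η fun v => ?_
  have : (fun j => ∑ i, F.η i (v j) • F.V i) = fun j => g (v j) := by
    funext j
    rw [F.g_apply]
  rw [this]
  exact map_congr_of_sub α (fun x => g x = 0) hα _ _ fun i => by simp [F.g_g]

theorem covWedge_h_H : covWedge F.h F.H = 1 := by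
  simp [covWedge_two, F.h_H]

theorem covWedge_η_eq_zero (v : Fin 3 → E 5) (hv : ∃ i, g (v i) = 0) : covWedge F.η v = 0 := by
  obtain ⟨i, hi⟩ := hv
  rw [covWedge_apply]
  refine Matrix.det_eq_zero_of_column_eq_zero i fun a => ?_
  simp [F.η_eq_zero_of_g hi]

/-- A covector and its expansion along the η have the same values on vertical vectors; their
difference annihilates ker P and does not affect Q. -/
theorem vertical_cov_congr (Q : MV 5 3)
    (hQ : ∀ a : Fin 3 → Cov 5, (∃ i, ∀ v, P v = 0 → a i v = 0) → Q a = 0) :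
    Q = Q F.η • covWedge fun a => evalAt (F.V a) := by
  refine eq_smul_covWedge Q F.η _ fun v => ?_
  refine map_congr_of_sub Q (fun a => ∀ v, P v = 0 → a v = 0) hQ _ _ fun i x hx => ?_
  have h1 := F.decomp x
  simp only [F.h_eq_zero_of_P hx, zero_smul, Finset.sum_const_zero, zero_add] at h1
  conv_lhs => rw [h1]
  simp [F.η_V, mul_comm]

theorem horizontal_cov_congr (Q : MV 5 2)
    (hQ : ∀ a : Fin 2 → Cov 5, (∃ i, ∀ v, g v = 0 → a i v = 0) → Q a = 0) :
    Q = Q F.h • covWedge fun i => evalAt (F.H i) := by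
  refine eq_smul_covWedge Q F.h _ fun v => ?_
  refine map_congr_of_sub Q (fun a => ∀ v, g v = 0 → a v = 0) hQ _ _ fun i x hx => ?_
  rw [F.eq_sum_of_g hx]
  simp [F.h_H, mul_comm]

end AdaptedFrame

/-! ### The tensors of the statement in an adapted frame -/

section Tensors

variable {M B : Type*} [TopologicalSpace M] [ChartedSpace (E 5) M] [TopologicalSpace B]
  [ChartedSpace (E 2) B] {π : M → B} {Ω : M → Alt 5 5} {ω₀ : B → Alt 2 2} {γ : M → E 5 →L[ℝ] E 5}
  {p : M} (F : AdaptedFrame (dProj π p) (γ p))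

namespace AdaptedFrame

/-- A value chosen by `Classical.epsilon` has its defining property only once existence is known.
The frame supplies a witness, and the two properties then force the value. The other chosen tensors
are identified in the same way. -/
theorem horLift_apply (y : E 2) : horLift π γ p y = ∑ i, F.cc i y • F.H i := by
  have hex : ∃ L : E 2 →L[ℝ] E 5,
      dProj π p ∘L L = ContinuousLinearMap.id ℝ (E 2) ∧ γ p ∘L L = 0 := by
    refine ⟨∑ i, (F.cc i).smulRight (F.H i), ?_, ?_⟩
    · ext1 y
      conv_rhs => rw [F.decompB (ContinuousLinearMap.id ℝ (E 2) y)]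
      simp [F.P_H]
    · ext1 y
      simp [F.g_H]
  obtain ⟨h1, h2⟩ := Classical.epsilon_spec hex
  have h1' : dProj π p (horLift π γ p y) = y := by
    have := congrArg (fun L : E 2 →L[ℝ] E 2 => L y) h1
    exact this
  have h2' : γ p (horLift π γ p y) = 0 := by
    have := congrArg (fun L : E 2 →L[ℝ] E 5 => L y) h2
    exact this
  rw [F.eq_sum_of_g h2']
  simp only [← F.cc_P, h1']

theorem horLift_C (i : Fin 2) : horLift π γ p (F.C i) = F.H i := by
  rw [F.horLift_apply]
  fin_cases i <;> simp [F.cc_C]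

theorem base_eq : ω₀ (π p) = ω₀ (π p) F.C • covWedge F.cc := by
  refine eq_smul_covWedge _ F.C F.cc fun v => ?_
  congr 1
  funext j
  exact F.decompB (v j)

theorem base_ne_zero (hω : ω₀ (π p) ≠ 0) : ω₀ (π p) F.C ≠ 0 := by
  intro h
  apply hω
  rw [F.base_eq (ω₀ := ω₀), h, zero_smul]

theorem omegaH_eq : omegaH π ω₀ p = ω₀ (π p) F.C • covWedge F.h := by
  ext v
  rw [omegaH, F.base_eq (ω₀ := ω₀)]
  simp [covWedge_two, F.cc_P, F.cc_C]

theorem total_eq : Ω p = Ω p F.all • covWedge F.allCov := by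
  refine eq_smul_covWedge _ F.all _ fun v => ?_
  congr 1
  funext j
  conv_lhs => rw [F.decomp (v j)]
  refine Eq.symm ((Fin.sum_univ_add (a := 2) (b := 3) _).trans ?_)
  simp [all, allCov]

theorem total_ne_zero (hΩ : Ω p ≠ 0) : Ω p F.all ≠ 0 := by
  intro h
  apply hΩ
  rw [F.total_eq (Ω := Ω), h, zero_smul]

set_option maxRecDepth 20000 in
-- A form of bidegree (0, 3) is a multiple of η^0 ∧ η^1 ∧ η^2, and the multiple is recovered from Ω
-- = Ω^H ∧ Ω^V by evaluation on the full frame.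
theorem omegaV_eq (hω : ω₀ (π p) ≠ 0) :
    omegaV π Ω ω₀ γ p = (Ω p F.all / ω₀ (π p) F.C) • covWedge F.η := by
  have hw := F.base_ne_zero hω
  have hex : ∃ η : Alt 5 3, bideg (γ p) 0 η = η ∧ Ω p = wedge (omegaH π ω₀ p) η := by
    refine ⟨(Ω p F.all / ω₀ (π p) F.C) • covWedge F.η, ?_, ?_⟩
    · rw [bideg_of_vertical _ F.g_g _ _ 0, if_pos rfl]
      intro v hv
      rw [ContinuousAlternatingMap.smul_apply, F.covWedge_η_eq_zero v hv, smul_zero]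
    · rw [wedge_smul_right, F.omegaH_eq, wedge_smul_left, wedge_covWedge, smul_smul,
        div_mul_cancel₀ _ hw]
      exact F.total_eq (Ω := Ω)
  obtain ⟨h1, h2⟩ := Classical.epsilon_spec hex
  change bideg (γ p) 0 (omegaV π Ω ω₀ γ p) = omegaV π Ω ω₀ γ p at h1
  change Ω p = wedge (omegaH π ω₀ p) (omegaV π Ω ω₀ γ p) at h2
  set ξ := omegaV π Ω ω₀ γ p with hξ
  have h3 : ξ = ξ F.V • covWedge F.η := by
    refine F.vertical_form_eq fun v hv => ?_
    obtain ⟨i, hi⟩ := hv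
    rw [← h1, bideg_apply, bidegFun]
    simp only [Finset.powersetCard_zero, Finset.sum_singleton, Finset.notMem_empty, if_false]
    exact ξ.toAlternatingMap.map_coord_zero i hi
  rw [h3, wedge_smul_right, F.omegaH_eq, wedge_smul_left, wedge_covWedge, smul_smul] at h2
  have h6 : Ω p F.all = ξ F.V * ω₀ (π p) F.C := by
    have h4 : Ω p = (ξ F.V * ω₀ (π p) F.C) • covWedge F.allCov := h2
    have h5 := congrArg (fun f : Alt 5 5 => f F.all) h4
    rw [ContinuousAlternatingMap.smul_apply, F.covWedge_all, smul_eq_mul, mul_one] at h5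
    exact h5
  rw [h3, h6, mul_div_cancel_right₀ _ hw]

/-- The value of `Ω^V` on the vertical frame. -/
def vol (Ω : M → Alt 5 5) (ω₀ : B → Alt 2 2) : ℝ := Ω p F.all / ω₀ (π p) F.C

end AdaptedFrame

end Tensors

section Tensors

variable {M B : Type*} [TopologicalSpace M] [ChartedSpace (E 5) M] [TopologicalSpace B]
  [ChartedSpace (E 2) B] {π : M → B} {Ω : M → Alt 5 5} {ω₀ : B → Alt 2 2} {γ : M → E 5 →L[ℝ] E 5}
  {p : M} (F : AdaptedFrame (dProj π p) (γ p))

namespace AdaptedFrame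

theorem vol_ne_zero (hω : ω₀ (π p) ≠ 0) (hΩ : Ω p ≠ 0) : F.vol Ω ω₀ ≠ 0 :=
  div_ne_zero (F.total_ne_zero hΩ) (F.base_ne_zero hω)

theorem alt_two_swap {n : ℕ} (α : Alt n 2) (x y : E n) : α ![y, x] = - α ![x, y] := by
  have := α.toAlternatingMap.map_swap ![x, y] (i := 0) (j := 1) (by decide)
  have h2 : (![x, y] ∘ (Equiv.swap (0 : Fin 2) 1)) = ![y, x] := by
    funext i
    fin_cases i <;> rfl
  rw [h2] at this
  exact this

theorem vec_two {X : Type*} (f : Fin 2 → X) : f = ![f 0, f 1] := by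
  funext i
  fin_cases i <;> rfl

/-- Since i_{X ∧ Y} ω = ω(Y, X), the condition i_ψ ω = -1 gives a positive multiple of 1/ω(C_0,
C_1). No further condition is needed: bivectors on a plane form a line. -/
theorem baseTensor_eq (hω : ω₀ (π p) ≠ 0) :
    baseTensor ω₀ (π p) = (ω₀ (π p) F.C)⁻¹ • covWedge fun i => evalAt (F.C i) := by
  have hw := F.base_ne_zero hω
  have hval : ∀ r : ℝ, (iotaMV (l := 0) (r • covWedge fun i => evalAt (F.C i)) (ω₀ (π p))) ![] =
      -(r * ω₀ (π p) F.C) := by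
    intro r
    rw [iotaMV_smul_left, iotaMV_covWedge, ContinuousAlternatingMap.smul_apply, insertAll_two,
      vec_two F.C, smul_eq_mul, ← mul_neg, ← alt_two_swap]
    rfl
  have hex : ∃ Q : MV 2 2, (iotaMV (l := 0) Q (ω₀ (π p))) ![] = -1 :=
    ⟨(ω₀ (π p) F.C)⁻¹ • covWedge fun i => evalAt (F.C i), by rw [hval, inv_mul_cancel₀ hw]⟩
  have h1 := Classical.epsilon_spec hex
  change (iotaMV (l := 0) (baseTensor ω₀ (π p)) (ω₀ (π p))) ![] = -1 at h1
  set Q := baseTensor ω₀ (π p)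
  have h2 : Q = Q F.cc • covWedge fun i => evalAt (F.C i) := by
    refine eq_smul_covWedge Q F.cc _ fun v => ?_
    congr 1
    funext j
    ext1 y
    conv_lhs => rw [F.decompB y]
    simp [mul_comm]
  rw [h2, hval] at h1
  rw [h2, eq_inv_of_mul_eq_one_left (neg_injective h1)]

theorem horMV_apply (hω : ω₀ (π p) ≠ 0) (a b : Cov 5) :
    horMV π γ (baseTensor ω₀) p ![a, b] =
      (ω₀ (π p) F.C)⁻¹ * (a (F.H 0) * b (F.H 1) - a (F.H 1) * b (F.H 0)) := by
  rw [horMV, F.baseTensor_eq hω]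
  simp [covWedge_two, F.horLift_C, mul_comm (b (F.H 0))]

set_option maxRecDepth 20000 in
-- Three insertions reverse the order of the frame, which is an odd permutation; hence the minus
-- sign. The same happens with two insertions in `QH_eq`.
theorem QV_eq (hω : ω₀ (π p) ≠ 0) (hΩ : Ω p ≠ 0) :
    QV π Ω ω₀ γ p = (-(F.vol Ω ω₀)⁻¹) • covWedge fun a => evalAt (F.V a) := by
  have hv : F.vol Ω ω₀ ≠ 0 := F.vol_ne_zero hω hΩ
  have hval : ∀ r : ℝ, (iotaMV (l := 0) (r • covWedge fun a => evalAt (F.V a))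
      (omegaV π Ω ω₀ γ p)) ![] = -(r * F.vol Ω ω₀) := by
    intro r
    rw [iotaMV_smul_left, iotaMV_covWedge, ContinuousAlternatingMap.smul_apply, insertAll_three,
      F.omegaV_eq hω, ContinuousAlternatingMap.smul_apply, covWedge_three]
    simp [F.η_V, vol]
  have hex : ∃ Q : MV 5 3,
      (∀ a : Fin 3 → Cov 5, (∃ i, ∀ v, dProj π p v = 0 → a i v = 0) → Q a = 0) ∧
        (iotaMV (l := 0) Q (omegaV π Ω ω₀ γ p)) ![] = 1 := by
    refine ⟨(-(F.vol Ω ω₀)⁻¹) • covWedge fun a => evalAt (F.V a), ?_, ?_⟩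
    · rintro a ⟨i, hi⟩
      rw [ContinuousAlternatingMap.smul_apply, covWedge_apply,
        Matrix.det_eq_zero_of_column_eq_zero i, smul_zero]
      intro j
      simp [hi _ (F.P_V j)]
    · rw [hval, neg_mul, neg_neg, inv_mul_cancel₀ hv]
  obtain ⟨h0, h1⟩ := Classical.epsilon_spec hex
  change ∀ a : Fin 3 → Cov 5, (∃ i, ∀ v, dProj π p v = 0 → a i v = 0) → QV π Ω ω₀ γ p a = 0 at h0
  change (iotaMV (l := 0) (QV π Ω ω₀ γ p) (omegaV π Ω ω₀ γ p)) ![] = 1 at h1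
  set Q := QV π Ω ω₀ γ p
  have h2 := F.vertical_cov_congr Q h0
  rw [h2, hval] at h1
  rw [h2]
  congr 1
  field_simp
  linarith

theorem QH_eq (hω : ω₀ (π p) ≠ 0) :
    QH π ω₀ γ p = (-(ω₀ (π p) F.C)⁻¹) • covWedge fun i => evalAt (F.H i) := by
  have hw := F.base_ne_zero hω
  have hval : ∀ r : ℝ, (iotaMV (l := 0) (r • covWedge fun a => evalAt (F.H a))
      (omegaH π ω₀ p)) ![] = -(r * ω₀ (π p) F.C) := by
    intro r
    rw [iotaMV_smul_left, iotaMV_covWedge, ContinuousAlternatingMap.smul_apply, insertAll_two,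
      F.omegaH_eq, ContinuousAlternatingMap.smul_apply, covWedge_two]
    simp [F.h_H]
  have hex : ∃ Q : MV 5 2,
      (∀ a : Fin 2 → Cov 5, (∃ i, ∀ v, γ p v = 0 → a i v = 0) → Q a = 0) ∧
        (iotaMV (l := 0) Q (omegaH π ω₀ p)) ![] = 1 := by
    refine ⟨(-(ω₀ (π p) F.C)⁻¹) • covWedge fun a => evalAt (F.H a), ?_, ?_⟩
    · rintro a ⟨i, hi⟩
      rw [ContinuousAlternatingMap.smul_apply, covWedge_apply,
        Matrix.det_eq_zero_of_column_eq_zero i, smul_zero]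
      intro j
      simp [hi _ (F.g_H j)]
    · rw [hval, neg_mul, neg_neg, inv_mul_cancel₀ hw]
  obtain ⟨h0, h1⟩ := Classical.epsilon_spec hex
  change ∀ a : Fin 2 → Cov 5, (∃ i, ∀ v, γ p v = 0 → a i v = 0) → QH π ω₀ γ p a = 0 at h0
  change (iotaMV (l := 0) (QH π ω₀ γ p) (omegaH π ω₀ p)) ![] = 1 at h1
  set Q := QH π ω₀ γ p
  have h2 := F.horizontal_cov_congr Q h0
  rw [h2, hval] at h1
  rw [h2]
  congr 1
  field_simp
  linarith

theorem theta_apply (hω : ω₀ (π p) ≠ 0) (hΩ : Ω p ≠ 0) (x : E 5) :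
    toCov (theta π Ω ω₀ γ p) x =
      (F.vol Ω ω₀)⁻¹ * d10 γ (omegaV π Ω ω₀ γ) p ![F.V 2, F.V 1, F.V 0, x] := by
  rw [toCov_apply, theta, F.QV_eq hω hΩ, iotaMV_smul_left, iotaMV_covWedge,
    ContinuousAlternatingMap.neg_apply, ContinuousAlternatingMap.smul_apply, insertAll_three,
    smul_eq_mul, neg_mul, neg_neg]

theorem rhoForm_apply (hω : ω₀ (π p) ≠ 0) (x y : E 5) :
    rhoForm π Ω ω₀ γ p ![x, y] =
      -(ω₀ (π p) F.C)⁻¹ * d2m1 γ (omegaV π Ω ω₀ γ) p ![F.H 1, F.H 0, x, y] := by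
  rw [rhoForm, F.QH_eq hω, iotaMV_smul_left, iotaMV_covWedge,
    ContinuousAlternatingMap.smul_apply, insertAll_two, smul_eq_mul]

/-- By the sign of Q_V, the bivector -i_β Q_V is the determinant of (β, a, b) on the vertical frame
divided by the volume, with a plus sign. -/
theorem iotaForm_QV_apply (hω : ω₀ (π p) ≠ 0) (hΩ : Ω p ≠ 0) (β : Alt 5 1) (a b : Cov 5) :
    iotaForm (l := 2) β (QV π Ω ω₀ γ p) ![a, b] =
      -(F.vol Ω ω₀)⁻¹ * covWedge (fun c => evalAt (F.V c)) ![toCov β, a, b] := by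
  conv_lhs => rw [← ofCov_toCov β]
  rw [ofCov_eq_covWedge, iotaForm_covWedge, insertAll_one, F.QV_eq hω hΩ]
  rfl

theorem covWedge_evalAt (b c d : Cov 5) :
    covWedge (fun a => evalAt (F.V a)) ![b, c, d] =
      b (F.V 0) * (c (F.V 1) * d (F.V 2) - c (F.V 2) * d (F.V 1)) +
      b (F.V 1) * (c (F.V 2) * d (F.V 0) - c (F.V 0) * d (F.V 2)) +
      b (F.V 2) * (c (F.V 0) * d (F.V 1) - c (F.V 1) * d (F.V 0)) := by
  simp [covWedge_three]
  ring

/-- The `2`-form with the given mixed components. -/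
theorem mixed_form_eq (α : Alt 5 2) (hHH : ∀ i j, α ![F.H i, F.H j] = 0)
    (hVV : ∀ a b, α ![F.V a, F.V b] = 0) :
    α = ∑ j : Fin 2, covWedge ![∑ a, α ![F.V a, F.H j] • F.η a, F.h j] := by
  refine F.two_form_ext (fun i j => ?_) (fun i a => ?_) (fun a b => ?_)
  · rw [hHH, ContinuousAlternatingMap.sum_apply, eq_comm]
    exact Finset.sum_eq_zero fun k _ => by simp [covWedge_two, F.η_H]
  · rw [ContinuousAlternatingMap.sum_apply, alt_two_swap]
    fin_cases i <;> simp [covWedge_two, F.h_H, F.h_V, F.η_V, F.η_H]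
  · rw [hVV, ContinuousAlternatingMap.sum_apply, eq_comm]
    exact Finset.sum_eq_zero fun k _ => by simp [covWedge_two, F.h_V]

omit F in
-- Laplace expansion along the row of X: the entries of b and n vanish, and the minor belonging to
-- a(X) has a zero column because h annihilates the V c.
theorem covWedge_append_one (V : Fin 3 → E 5) (X : E 5) (b h n a : Cov 5) (hV : ∀ c, h (V c) = 0)
    (hb : b X = 0) (hn : n X = 0) :
    covWedge (k := 3 + 1) (Fin.append (fun c => evalAt (V c)) ![evalAt X]) ![b, h, n, a] =
      h X * covWedge (fun c => evalAt (V c)) ![b, n, a] := by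
  have e : Fin.append (fun c => evalAt (V c)) ![evalAt X] =
      ![evalAt (V 0), evalAt (V 1), evalAt (V 2), evalAt X] := by
    funext i
    fin_cases i <;> rfl
  rw [e, covWedge_three, covWedge_apply, Matrix.det_succ_row _ (3 : Fin 4)]
  simp [Fin.sum_univ_succ, Matrix.det_fin_three, hV, hb, hn, Fin.succAbove]
  ring

set_option maxRecDepth 20000 in
-- With only mixed components, d_{0,1} μ is a sum of terms n_j ∧ h_j with n_j in the span of the η.
-- Its product with β is then a sum of decomposables, and the contraction with Q_V ∧ X becomes a sum
-- of 4 × 4 determinants, with the covectors in reversed order.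
theorem shift_apply {t : Triple M} (F : AdaptedFrame (dProj π p) (t.γ p)) (hω : ω₀ (π p) ≠ 0)
    (hΩ : Ω p ≠ 0) (μ : M → Alt 5 1) (hHH : ∀ i j, d01 t.γ μ p ![F.H i, F.H j] = 0)
    (hVV : ∀ a b, d01 t.γ μ p ![F.V a, F.V b] = 0) (X : E 5) (a : Cov 5) :
    a (connShift π Ω ω₀ μ t p X) = -(F.vol Ω ω₀)⁻¹ * ∑ j : Fin 2,
      covWedge (k := 3 + 1) (Fin.append (fun a => evalAt (F.V a)) ![evalAt X])
        ![toCov (t.β p), F.h j, ∑ c, d01 t.γ μ p ![F.V c, F.H j] • F.η c, a] := by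
  change a (toVec (iotaForm (l := 1) (wedge (d01 t.γ μ p) (t.β p))
        (wedge (QV π Ω ω₀ t.γ p) (ofVec X) : MV 5 (3 + 1)))) = _
  have h1 : ∀ n : Fin 2 → Cov 5, wedge (∑ j, covWedge ![n j, F.h j]) (t.β p) =
      ∑ j, covWedge ![n j, F.h j, toCov (t.β p)] := by
    intro n
    conv_lhs => rw [← ofCov_toCov (t.β p)]
    rw [ofCov_eq_covWedge, Fin.sum_univ_two, wedge_add_left, wedge_covWedge, wedge_covWedge,
      Fin.sum_univ_two]
    congr 2 <;> · funext i; fin_cases i <;> rfl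
  have h2 := F.mixed_form_eq _ hHH hVV
  set n : Fin 2 → Cov 5 := fun j => ∑ c, d01 t.γ μ p ![F.V c, F.H j] • F.η c with hn
  have h3 : ∀ j, (∑ c, d01 t.γ μ p ![F.V c, F.H j] • F.η c) = n j := fun j => rfl
  simp only [h3] at h2 ⊢
  rw [apply_toVec, h2, h1, F.QV_eq hω hΩ, ofVec_eq_covWedge,
    wedge_smul_left, wedge_covWedge, iotaForm_smul_right, Fin.sum_univ_two, iotaForm_add_left,
    iotaForm_covWedge, iotaForm_covWedge, ContinuousAlternatingMap.smul_apply,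
    ContinuousAlternatingMap.add_apply, insertAll_three, insertAll_three, Fin.sum_univ_two,
    smul_eq_mul]
  rfl

/-- For X = V c the determinant has two equal rows. -/
theorem shift_V {t : Triple M} (F : AdaptedFrame (dProj π p) (t.γ p)) (hω : ω₀ (π p) ≠ 0)
    (hΩ : Ω p ≠ 0) (μ : M → Alt 5 1) (hHH : ∀ i j, d01 t.γ μ p ![F.H i, F.H j] = 0)
    (hVV : ∀ a b, d01 t.γ μ p ![F.V a, F.V b] = 0) (c : Fin 3) :
    connShift π Ω ω₀ μ t p (F.V c) = 0 := by
  have h : ∀ a : Cov 5, a (connShift π Ω ω₀ μ t p (F.V c)) = 0 := by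
    intro a
    rw [F.shift_apply hω hΩ μ hHH hVV, Finset.sum_eq_zero, mul_zero]
    intro j _
    rw [covWedge_apply]
    refine Matrix.det_zero_of_row_eq (i := Fin.castAdd 1 c) (j := Fin.natAdd 3 0) ?_ ?_
    · intro h
      have := congrArg Fin.val h
      simp at this
      omega
    · funext k
      simp only [Matrix.of_apply, Fin.append_left, Fin.append_right]
      rfl
  rw [vec_eq_sum (connShift π Ω ω₀ μ t p (F.V c))]
  simp [h]

theorem shift_H {t : Triple M} (F : AdaptedFrame (dProj π p) (t.γ p)) (hω : ω₀ (π p) ≠ 0)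
    (hΩ : Ω p ≠ 0) (hβ : ∀ v, t.γ p v = 0 → toCov (t.β p) v = 0)
    (μ : M → Alt 5 1) (hHH : ∀ i j, d01 t.γ μ p ![F.H i, F.H j] = 0)
    (hVV : ∀ a b, d01 t.γ μ p ![F.V a, F.V b] = 0) (i : Fin 2) (a : Cov 5) :
    a (connShift π Ω ω₀ μ t p (F.H i)) = -(F.vol Ω ω₀)⁻¹ * covWedge (fun a => evalAt (F.V a))
      ![toCov (t.β p), ∑ c, d01 t.γ μ p ![F.V c, F.H i] • F.η c, a] := by
  have h1 : ∀ j : Fin 2, covWedge (k := 3 + 1)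
      (Fin.append (fun a => evalAt (F.V a)) ![evalAt (F.H i)])
        ![toCov (t.β p), F.h j, ∑ c, d01 t.γ μ p ![F.V c, F.H j] • F.η c, a] =
      F.h j (F.H i) * covWedge (fun a => evalAt (F.V a))
        ![toCov (t.β p), ∑ c, d01 t.γ μ p ![F.V c, F.H j] • F.η c, a] := fun j =>
    covWedge_append_one _ _ _ _ _ _ (F.h_V j) (hβ _ (F.g_H i)) (by simp [F.η_H])
  rw [F.shift_apply hω hΩ μ hHH hVV]
  simp only [h1, F.h_H, ite_mul, one_mul, zero_mul, Finset.sum_ite_eq', Finset.mem_univ, if_true]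

end AdaptedFrame

end Tensors

theorem split_mem {k n : ℕ} {γ : E n →L[ℝ] E n} {v : Fin k → E n} (S : Finset (Fin k)) {p : ℕ}
    (α : Alt n k) (hS : ∀ i, if i ∈ S then γ (v i) = 0 else γ (v i) = v i) :
    bideg γ p α v = if S.card = p then α v else 0 :=
  bideg_apply_of_split γ p α v S (fun i hi => by simpa [hi] using hS i)
    (fun i hi => by simpa [hi] using hS i)

theorem bideg_vanish_of_horizontal {k n : ℕ} {γ : E n →L[ℝ] E n} (α : Alt n k) (v : Fin k → E n)
    (hv : ∃ i, γ (v i) = 0) : bideg γ 0 α v = 0 := by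
  obtain ⟨i, hi⟩ := hv
  rw [bideg_apply, bidegFun]
  simp only [Finset.powersetCard_zero, Finset.sum_singleton, Finset.notMem_empty, if_false]
  exact α.toAlternatingMap.map_coord_zero i hi

/-! ### The equations of a Poisson triple on a frame -/

section Equations

variable {M B : Type*} [TopologicalSpace M] [ChartedSpace (E 5) M] [TopologicalSpace B]
  [ChartedSpace (E 2) B] {π : M → B} {Ω : M → Alt 5 5} {ω₀ : B → Alt 2 2} {t : Triple M}
  {p : M} (F : AdaptedFrame (dProj π p) (t.γ p))

theorem bideg_beta (hF : ∀ q, Nonempty (AdaptedFrame (dProj π q) (t.γ q)))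
    (hβ : ∀ q v, t.γ q v = 0 → toCov (t.β q) v = 0) (q : M) (s : ℕ) :
    bideg (t.γ q) s (t.β q) = if s = 0 then t.β q else 0 := by
  obtain ⟨F⟩ := hF q
  refine bideg_of_vertical _ F.g_g _ ?_ s
  rintro v ⟨i, hi⟩
  have hv : v = ![v 0] := by
    funext i
    fin_cases i
    rfl
  rw [hv, ← toCov_apply]
  fin_cases i
  exact hβ q _ hi

theorem bideg_omegaV (hF : ∀ q, Nonempty (AdaptedFrame (dProj π q) (t.γ q)))
    (hω : ∀ b, ω₀ b ≠ 0) (q : M) (s : ℕ) :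
    bideg (t.γ q) s (omegaV π Ω ω₀ t.γ q) = if s = 0 then omegaV π Ω ω₀ t.γ q else 0 := by
  obtain ⟨F⟩ := hF q
  refine bideg_of_vertical _ F.g_g _ (fun v hv => ?_) s
  rw [F.omegaV_eq (hω _), ContinuousAlternatingMap.smul_apply, F.covWedge_η_eq_zero v hv, smul_zero]

theorem bideg_mu (hF : ∀ q, Nonempty (AdaptedFrame (dProj π q) (t.γ q))) {μ : M → Alt 5 1}
    (hμ : ∀ q v, dProj π q v = 0 → toCov (μ q) v = 0) (q : M) (s : ℕ) (hs : s < 2) :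
    bideg (t.γ q) s (μ q) = if s = 1 then μ q else 0 := by
  obtain ⟨F⟩ := hF q
  refine bideg_one_form_of_horizontal _ _ (fun x => hμ q _ ?_) s hs
  rw [F.g_apply]
  simp [F.P_V]

theorem dPart_beta (hF : ∀ q, Nonempty (AdaptedFrame (dProj π q) (t.γ q)))
    (hβ : ∀ q v, t.γ q v = 0 → toCov (t.β q) v = 0) (r : ℕ) (p : M) :
    dPart t.γ r t.β p = bideg (t.γ p) r (extD t.β p) := by
  rw [dPart_of_pure t.γ r 0 t.β p (by omega) fun q s _ => bideg_beta hF hβ q s, zero_add]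

theorem dPart_omegaV (hF : ∀ q, Nonempty (AdaptedFrame (dProj π q) (t.γ q)))
    (hω : ∀ b, ω₀ b ≠ 0) (r : ℕ) (p : M) :
    dPart t.γ r (omegaV π Ω ω₀ t.γ) p = bideg (t.γ p) r (extD (omegaV π Ω ω₀ t.γ) p) := by
  rw [dPart_of_pure t.γ r 0 _ p (by omega) fun q s _ => bideg_omegaV hF hω q s, zero_add]

theorem dPart_mu (hF : ∀ q, Nonempty (AdaptedFrame (dProj π q) (t.γ q))) {μ : M → Alt 5 1}
    (hμ : ∀ q v, dProj π q v = 0 → toCov (μ q) v = 0) (r : ℕ) (p : M) :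
    dPart t.γ r μ p = bideg (t.γ p) (1 + r) (extD μ p) :=
  dPart_of_pure t.γ r 1 _ p (by omega) fun q s hs => bideg_mu hF hμ q s (by omega)

theorem d01_ofFun (γ : M → E 5 →L[ℝ] E 5) (f : M → ℝ) (p : M) :
    d01 γ (ofFun f) p = bideg (γ p) 0 (extD (ofFun f) p) := by
  refine dPart_of_pure γ 0 0 _ p le_rfl fun q s hs => ?_
  obtain rfl : s = 0 := by omega
  rw [if_pos rfl]
  ext v
  exact bideg_apply_of_split (γ q) 0 (ofFun f q) v ∅ (by simp) (fun i => i.elim0)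

include F

/-- The form d_{0,1}β ∧ β has bidegree (0, 3): with a horizontal argument, one factor of every term
vanishes. So its value on the vertical frame decides. -/
theorem eq1_iff (hF : ∀ q, Nonempty (AdaptedFrame (dProj π q) (t.γ q)))
    (hβ : ∀ q v, t.γ q v = 0 → toCov (t.β q) v = 0) :
    wedge (d01 t.γ t.β p) (t.β p) = 0 ↔
      extD t.β p ![F.V 0, F.V 1] * toCov (t.β p) (F.V 2) -
        extD t.β p ![F.V 0, F.V 2] * toCov (t.β p) (F.V 1) +
        extD t.β p ![F.V 1, F.V 2] * toCov (t.β p) (F.V 0) = 0 := by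
  have hd : d01 t.γ t.β p = bideg (t.γ p) 0 (extD t.β p) := dPart_beta hF hβ 0 p
  have hval : ∀ a b, bideg (t.γ p) 0 (extD t.β p) ![F.V a, F.V b] =
      extD t.β p ![F.V a, F.V b] := by
    intro a b
    rw [split_mem ∅ _ (by intro i; fin_cases i <;> simp [F.g_V]), if_pos (by simp)]
  have h1 : wedge (d01 t.γ t.β p) (t.β p) F.V =
      extD t.β p ![F.V 0, F.V 1] * toCov (t.β p) (F.V 2) -
        extD t.β p ![F.V 0, F.V 2] * toCov (t.β p) (F.V 1) +
        extD t.β p ![F.V 1, F.V 2] * toCov (t.β p) (F.V 0) := by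
    rw [wedge_two_one, hd, hval, hval, hval]
  rw [← h1]
  constructor
  · intro h
    rw [h]
    rfl
  · intro h
    have h2 := F.vertical_form_eq (α := wedge (d01 t.γ t.β p) (t.β p)) ?_
    · rw [h2]
      exact (congrArg (· • covWedge F.η) h).trans (zero_smul _ _)
    · rintro v ⟨i, hi⟩
      have hb : ∀ x y, t.γ p x = 0 → bideg (t.γ p) 0 (extD t.β p) ![x, y] = 0 :=
        fun x y hx => bideg_vanish_of_horizontal _ _ ⟨0, hx⟩
      have hb' : ∀ x y, t.γ p y = 0 → bideg (t.γ p) 0 (extD t.β p) ![x, y] = 0 :=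
        fun x y hx => bideg_vanish_of_horizontal _ _ ⟨1, hx⟩
      rw [wedge_two_one, hd]
      fin_cases i
      · have hi : t.γ p (v 0) = 0 := hi
        simp [hb _ _ hi, hβ _ _ hi]
      · have hi : t.γ p (v 1) = 0 := hi
        simp [hb _ _ hi, hb' _ _ hi, hβ _ _ hi]
      · have hi : t.γ p (v 2) = 0 := hi
        simp [hb' _ _ hi, hβ _ _ hi]

theorem theta_H (hF : ∀ q, Nonempty (AdaptedFrame (dProj π q) (t.γ q)))
    (hω : ∀ b, ω₀ b ≠ 0) (hΩ : ∀ q, Ω q ≠ 0) (i : Fin 2) :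
    toCov (theta π Ω ω₀ t.γ p) (F.H i) = (F.vol Ω ω₀)⁻¹ *
      extD (omegaV π Ω ω₀ t.γ) p ![F.V 2, F.V 1, F.V 0, F.H i] := by
  have hd : d10 t.γ (omegaV π Ω ω₀ t.γ) p = _ := dPart_omegaV hF hω 1 p
  rw [F.theta_apply (hω _) (hΩ _), hd,
    -- The set lists the slots occupied by horizontal vectors; its cardinality is compared with the
    -- horizontal degree, here 1.
    split_mem {3} _ (by intro i; fin_cases i <;> simp [F.g_V, F.g_H]), if_pos (by simp)]

theorem theta_V (hF : ∀ q, Nonempty (AdaptedFrame (dProj π q) (t.γ q)))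
    (hω : ∀ b, ω₀ b ≠ 0) (hΩ : ∀ q, Ω q ≠ 0) (a : Fin 3) :
    toCov (theta π Ω ω₀ t.γ p) (F.V a) = 0 := by
  have hd : d10 t.γ (omegaV π Ω ω₀ t.γ) p = _ := dPart_omegaV hF hω 1 p
  rw [F.theta_apply (hω _) (hΩ _), hd,
    split_mem ∅ _ (by intro i; fin_cases i <;> simp [F.g_V]), if_neg (by simp), mul_zero]

/-- Both terms have bidegree (1, 1), since θ vanishes on vertical and β on horizontal vectors. Only
mixed components carry information. -/
theorem eq2_iff (hF : ∀ q, Nonempty (AdaptedFrame (dProj π q) (t.γ q)))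
    (hβ : ∀ q v, t.γ q v = 0 → toCov (t.β q) v = 0)
    (hω : ∀ b, ω₀ b ≠ 0) (hΩ : ∀ q, Ω q ≠ 0) :
    t.κ p • (d10 t.γ t.β p - wedge (theta π Ω ω₀ t.γ p) (t.β p)) = 0 ↔
      ∀ i a, t.κ p * (extD t.β p ![F.H i, F.V a] - (F.vol Ω ω₀)⁻¹ *
        extD (omegaV π Ω ω₀ t.γ) p ![F.V 2, F.V 1, F.V 0, F.H i] * toCov (t.β p) (F.V a)) = 0 := by
  have hd : d10 t.γ t.β p = bideg (t.γ p) 1 (extD t.β p) := dPart_beta hF hβ 1 p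
  have hval : ∀ i a, (t.κ p • (d10 t.γ t.β p - wedge (theta π Ω ω₀ t.γ p) (t.β p)) : Alt 5 2)
      ![F.H i, F.V a] = t.κ p * (extD t.β p ![F.H i, F.V a] - (F.vol Ω ω₀)⁻¹ *
        extD (omegaV π Ω ω₀ t.γ) p ![F.V 2, F.V 1, F.V 0, F.H i] * toCov (t.β p) (F.V a)) := by
    intro i a
    rw [ContinuousAlternatingMap.smul_apply, ContinuousAlternatingMap.sub_apply, hd,
      split_mem {0} _ (by intro i; fin_cases i <;> simp [F.g_V, F.g_H]), if_pos (by simp),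
      wedge_one_one, ← theta_H F hF hω hΩ, smul_eq_mul]
    simp [hβ _ _ (F.g_H i)]
  constructor
  · intro h i a
    rw [← hval, h]
    rfl
  · intro h
    refine F.two_form_ext (fun i j => ?_) (fun i a => ?_) (fun a b => ?_)
    · rw [ContinuousAlternatingMap.smul_apply, ContinuousAlternatingMap.sub_apply, hd,
        split_mem {0, 1} _ (by intro i; fin_cases i <;> simp [F.g_H]), if_neg (by simp),
        wedge_one_one]
      simp [hβ _ _ (F.g_H _)]
    · rw [hval, h]
      rfl
    · rw [ContinuousAlternatingMap.smul_apply, ContinuousAlternatingMap.sub_apply, hd,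
        split_mem ∅ _ (by intro i; fin_cases i <;> simp [F.g_V]), if_neg (by simp),
        wedge_one_one]
      simp [theta_V F hF hω hΩ]

theorem d01_ofFun_H (f : M → ℝ) (i : Fin 2) : toCov (d01 t.γ (ofFun f) p) (F.H i) = 0 := by
  rw [toCov_apply, d01_ofFun]
  exact bideg_vanish_of_horizontal _ _ ⟨0, F.g_H i⟩

theorem d01_ofFun_V (f : M → ℝ) (a : Fin 3) :
    toCov (d01 t.γ (ofFun f) p) (F.V a) = extD (ofFun f) p ![F.V a] := by
  rw [toCov_apply, d01_ofFun]
  exact (split_mem ∅ _ (by intro i; fin_cases i; simp [F.g_V])).trans (if_pos rfl)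

/-- Both terms are vertical: contracting the (2, 2)-form d_{2,-1}Ω^V with Q_H uses up its horizontal
slots. The plus sign comes from Q_H = -(1/w) H_0 ∧ H_1. -/
theorem eq3_iff (hF : ∀ q, Nonempty (AdaptedFrame (dProj π q) (t.γ q)))
    (hβ : ∀ q v, t.γ q v = 0 → toCov (t.β q) v = 0)
    (hω : ∀ b, ω₀ b ≠ 0) :
    wedge (d01 t.γ (ofFun t.κ) p) (t.β p) - (t.κ p) ^ 2 • rhoForm π Ω ω₀ t.γ p = 0 ↔
      ∀ a b, extD (ofFun t.κ) p ![F.V a] * toCov (t.β p) (F.V b) -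
        extD (ofFun t.κ) p ![F.V b] * toCov (t.β p) (F.V a) + (t.κ p) ^ 2 *
        ((ω₀ (π p) F.C)⁻¹ * extD (omegaV π Ω ω₀ t.γ) p ![F.H 1, F.H 0, F.V a, F.V b]) = 0 := by
  have hd : d2m1 t.γ (omegaV π Ω ω₀ t.γ) p = _ := dPart_omegaV hF hω 2 p
  have hw : ∀ x y, (wedge (d01 t.γ (ofFun t.κ) p) (t.β p) : Alt 5 2) ![x, y] =
      toCov (d01 t.γ (ofFun t.κ) p) x * toCov (t.β p) y -
        toCov (d01 t.γ (ofFun t.κ) p) y * toCov (t.β p) x := fun x y => wedge_one_one _ _ _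
  have hsub : ∀ x y, (wedge (d01 t.γ (ofFun t.κ) p) (t.β p) -
      (t.κ p) ^ 2 • rhoForm π Ω ω₀ t.γ p : Alt 5 2) ![x, y] =
      toCov (d01 t.γ (ofFun t.κ) p) x * toCov (t.β p) y -
        toCov (d01 t.γ (ofFun t.κ) p) y * toCov (t.β p) x -
        (t.κ p) ^ 2 * rhoForm π Ω ω₀ t.γ p ![x, y] := by
    intro x y
    rw [← hw]
    rfl
  have hval : ∀ a b, (wedge (d01 t.γ (ofFun t.κ) p) (t.β p) -
      (t.κ p) ^ 2 • rhoForm π Ω ω₀ t.γ p : Alt 5 2) ![F.V a, F.V b] =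
      extD (ofFun t.κ) p ![F.V a] * toCov (t.β p) (F.V b) -
        extD (ofFun t.κ) p ![F.V b] * toCov (t.β p) (F.V a) + (t.κ p) ^ 2 *
        ((ω₀ (π p) F.C)⁻¹ * extD (omegaV π Ω ω₀ t.γ) p ![F.H 1, F.H 0, F.V a, F.V b]) := by
    intro a b
    rw [hsub, d01_ofFun_V F, d01_ofFun_V F, F.rhoForm_apply (hω _), hd,
      split_mem {0, 1} _ (by intro i; fin_cases i <;> simp [F.g_V, F.g_H]), if_pos (by simp)]
    ring
  constructor
  · intro h a b
    rw [← hval, h]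
    rfl
  · intro h
    refine F.two_form_ext (fun i j => ?_) (fun i a => ?_) (fun a b => ?_)
    · rw [hsub, d01_ofFun_H F, d01_ofFun_H F, F.rhoForm_apply (hω _), hd,
        split_mem {0, 1, 2, 3} _ (by intro i; fin_cases i <;> simp [F.g_H]), if_neg (by simp)]
      simp
    · rw [hsub, d01_ofFun_H F, hβ _ _ (F.g_H _), F.rhoForm_apply (hω _), hd,
        split_mem {0, 1, 2} _ (by intro i; fin_cases i <;> simp [F.g_V, F.g_H]), if_neg (by simp)]
      simp
    · rw [hval, h]
      rfl

end Equations

/-! ### Smoothness through components -/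

section Components

variable {X : Type*} [NormedAddCommGroup X] [NormedSpace ℝ X] {n k : ℕ}

/-- A field of alternating forms is smooth if its components are. -/
theorem contDiffAt_alt_of_components {V ι : Type*} [NormedAddCommGroup V] [NormedSpace ℝ V]
    [Fintype ι] (b : ι → V) (b' : ι → V →L[ℝ] ℝ) (hb : ∀ v, v = ∑ s, b' s v • b s)
    {α : X → V [⋀^Fin k]→L[ℝ] ℝ} {x : X}
    (h : ∀ f : Fin k → ι, ContDiffAt ℝ ∞ (fun y => α y fun i => b (f i)) x) :
    ContDiffAt ℝ ∞ α x := by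
  let Φ : (V [⋀^Fin k]→L[ℝ] ℝ) →ₗ[ℝ] ((Fin k → ι) → ℝ) :=
    { toFun := fun a f => a fun i => b (f i)
      map_add' := fun _ _ => rfl
      map_smul' := fun _ _ => rfl }
  have hΦ : LinearMap.ker Φ = ⊥ := by
    rw [LinearMap.ker_eq_bot']
    intro a ha
    ext v
    have hv : v = fun j => ∑ s, b' s (v j) • b s := funext fun j => hb (v j)
    rw [hv]
    refine (MultilinearMap.map_sum a.toMultilinearMap _).trans ?_
    refine Finset.sum_eq_zero fun f _ => ?_
    refine (MultilinearMap.map_smul_univ a.toMultilinearMap _ _).trans ?_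
    have : a (fun i => b (f i)) = 0 := congrFun ha f
    exact (congrArg _ this).trans (smul_zero _)
  -- The left inverse lives on the finite-dimensional space of component families, so it is
  -- continuous, and a form is recovered smoothly from its components.
  obtain ⟨g, hg⟩ := LinearMap.exists_leftInverse_of_injective Φ hΦ
  have h1 : α = fun y => LinearMap.toContinuousLinearMap g (Φ (α y)) := by
    funext y
    exact (LinearMap.congr_fun hg (α y)).symm
  rw [h1]
  exact (LinearMap.toContinuousLinearMap g).contDiff.contDiffAt.comp x (contDiffAt_pi.2 h)

theorem contDiffAt_of_basisVec {α : X → Alt n k} {x : X}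
    (h : ∀ f : Fin k → Fin n, ContDiffAt ℝ ∞ (fun y => α y fun i => basisVec (f i)) x) :
    ContDiffAt ℝ ∞ α x :=
  contDiffAt_alt_of_components basisVec basisCov vec_eq_sum h

theorem contDiffAt_mv_of_basisCov {Q : X → MV n k} {x : X}
    (h : ∀ f : Fin k → Fin n, ContDiffAt ℝ ∞ (fun y => Q y fun i => basisCov (f i)) x) :
    ContDiffAt ℝ ∞ Q x :=
  contDiffAt_alt_of_components basisCov (fun s => evalAt (basisVec s)) cov_eq_sum h

theorem ContDiffAt.alt_apply {α : X → Alt n k} {v : Fin k → X → E n} {x : X}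
    (hα : ContDiffAt ℝ ∞ α x) (hv : ∀ i, ContDiffAt ℝ ∞ (v i) x) :
    ContDiffAt ℝ ∞ (fun y => α y fun i => v i y) x := by
  have h1 : (fun y => α y fun i => v i y) = fun y => ∑ f : Fin k → Fin n,
      (∏ i, basisCov (f i) (v i y)) * α y fun i => basisVec (f i) := by
    funext y
    have hv : (fun i => v i y) = fun j => ∑ s, basisCov s (v j y) • basisVec s :=
      funext fun j => vec_eq_sum (v j y)
    conv_lhs => rw [hv]
    refine (MultilinearMap.map_sum (α y).toMultilinearMap _).trans ?_
    exact Finset.sum_congr rfl fun f _ => MultilinearMap.map_smul_univ (α y).toMultilinearMap _ _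
  rw [h1]
  refine ContDiffAt.sum fun f _ => ContDiffAt.mul (contDiffAt_prod fun i _ => ?_) ?_
  · exact (basisCov (f i)).contDiff.contDiffAt.comp x (hv i)
  · exact (ContinuousAlternatingMap.apply ℝ (E n) ℝ _).contDiff.contDiffAt.comp x hα

end Components

/-! ### Independence of charts for smoothness and for the exterior differential -/

section Charts

variable {n : ℕ} {N : Type*} [TopologicalSpace N] [ChartedSpace (E n) N]

/-- `e` is a smooth chart of the manifold. -/
structure IsSmoothChart (e : OpenPartialHomeomorph N (E n)) : Prop where
  smooth : ContMDiffOn 𝓘(ℝ, E n) 𝓘(ℝ, E n) ∞ e e.source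
  smooth_symm : ContMDiffOn 𝓘(ℝ, E n) 𝓘(ℝ, E n) ∞ e.symm e.target

/-- The differential of a chart. -/
def chartD (e : OpenPartialHomeomorph N (E n)) (q : N) : E n →L[ℝ] E n :=
  (mfderiv 𝓘(ℝ, E n) 𝓘(ℝ, E n) e q : E n →L[ℝ] E n)

/-- The differential of the inverse of a chart. -/
def chartInvD (e : OpenPartialHomeomorph N (E n)) (y : E n) : E n →L[ℝ] E n :=
  (mfderiv 𝓘(ℝ, E n) 𝓘(ℝ, E n) e.symm y : E n →L[ℝ] E n)

/-- The representation of a form in a chart. -/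
def formIn {k : ℕ} (e : OpenPartialHomeomorph N (E n)) (α : N → Alt n k) (y : E n) : Alt n k :=
  (α (e.symm y)).compContinuousLinearMap (chartInvD e y)

/-- The representation of a vector-valued `1`-form in a chart. -/
def endoIn (e : OpenPartialHomeomorph N (E n)) (γ : N → E n →L[ℝ] E n) (y : E n) :
    E n →L[ℝ] E n :=
  chartD e (e.symm y) ∘L γ (e.symm y) ∘L chartInvD e y

theorem isSmoothChart_chartAt [IsManifold 𝓘(ℝ, E n) ∞ N] (p₀ : N) :
    IsSmoothChart (chartAt (E n) p₀) :=
  ⟨contMDiffOn_chart, contMDiffOn_chart_symm⟩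

namespace IsSmoothChart

variable {e e' : OpenPartialHomeomorph N (E n)} (he : IsSmoothChart e) (he' : IsSmoothChart e')

include he

theorem contMDiffAt {q : N} (hq : q ∈ e.source) : ContMDiffAt 𝓘(ℝ, E n) 𝓘(ℝ, E n) ∞ e q :=
  he.smooth.contMDiffAt (e.open_source.mem_nhds hq)

theorem contMDiffAt_symm {y : E n} (hy : y ∈ e.target) :
    ContMDiffAt 𝓘(ℝ, E n) 𝓘(ℝ, E n) ∞ e.symm y :=
  he.smooth_symm.contMDiffAt (e.open_target.mem_nhds hy)

theorem mdifferentiable : e.MDifferentiable 𝓘(ℝ, E n) 𝓘(ℝ, E n) :=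
  ⟨he.smooth.mdifferentiableOn (by simp), he.smooth_symm.mdifferentiableOn (by simp)⟩

theorem chartD_chartInvD {y : E n} (hy : y ∈ e.target) (x : E n) :
    chartD e (e.symm y) (chartInvD e y x) = x :=
  congrArg (fun L : E n →L[ℝ] E n => L x) (he.mdifferentiable.comp_symm_deriv hy)

theorem chartInvD_chartD {y : E n} (hy : y ∈ e.target) (x : E n) :
    chartInvD e y (chartD e (e.symm y) x) = x := by
  have h := he.mdifferentiable.symm_comp_deriv (e.map_target hy)
  rw [e.right_inv hy] at h
  exact congrArg (fun L : E n →L[ℝ] E n => L x) h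

include he'

theorem contDiffAt_transition {y : E n} (hy : y ∈ e'.target) (hq : e'.symm y ∈ e.source) :
    ContDiffAt ℝ ∞ (e ∘ e'.symm) y :=
  contMDiffAt_iff_contDiffAt.1 ((he.contMDiffAt hq).comp y (he'.contMDiffAt_symm hy))

theorem eventually_transition {y : E n} (hy : y ∈ e'.target) (hq : e'.symm y ∈ e.source) :
    ∀ᶠ z in 𝓝 y, z ∈ e'.target ∧ e'.symm z ∈ e.source := by
  refine Filter.Eventually.and (e'.open_target.mem_nhds hy) ?_
  exact (e'.continuousAt_symm hy) (e.open_source.mem_nhds hq)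

theorem chartInvD_transition {y : E n} (hy : y ∈ e'.target) (hq : e'.symm y ∈ e.source) :
    chartInvD e' y = chartInvD e (e (e'.symm y)) ∘L fderiv ℝ (e ∘ e'.symm) y := by
  have h1 : e'.symm =ᶠ[𝓝 y] e.symm ∘ (e ∘ e'.symm) := by
    filter_upwards [he.eventually_transition he' hy hq] with z hz
    simp [e.left_inv hz.2]
  have h2 : mfderiv 𝓘(ℝ, E n) 𝓘(ℝ, E n) e'.symm y =
      mfderiv 𝓘(ℝ, E n) 𝓘(ℝ, E n) (e.symm ∘ (e ∘ e'.symm)) y := h1.mfderiv_eq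
  have h3 := mfderiv_comp (I := 𝓘(ℝ, E n)) (I' := 𝓘(ℝ, E n)) (I'' := 𝓘(ℝ, E n)) y
    ((he.contMDiffAt_symm (e.map_source hq)).mdifferentiableAt (by simp))
    ((contMDiffAt_iff_contDiffAt.2 (he.contDiffAt_transition he' hy hq)).mdifferentiableAt (by simp))
  rw [mfderiv_eq_fderiv] at h3
  ext1 x
  exact congrArg (fun L : E n →L[ℝ] E n => L x) (h2.trans h3)

theorem chartD_transition {y : E n} (hy : y ∈ e'.target) (hq : e'.symm y ∈ e.source) :
    chartD e (e'.symm y) = fderiv ℝ (e ∘ e'.symm) y ∘L chartD e' (e'.symm y) := by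
  ext1 x
  obtain ⟨z, rfl⟩ : ∃ z, x = chartInvD e' y z := ⟨_, (he'.chartInvD_chartD hy x).symm⟩
  rw [ContinuousLinearMap.comp_apply, he'.chartD_chartInvD hy,
    he.chartInvD_transition he' hy hq, ContinuousLinearMap.comp_apply]
  conv_lhs => rw [← e.left_inv hq]
  rw [e.left_inv hq]
  have := he.chartD_chartInvD (e.map_source hq) (fderiv ℝ (e ∘ e'.symm) y z)
  rwa [e.left_inv hq] at this

theorem formIn_transition {k : ℕ} (α : N → Alt n k) {y : E n} (hy : y ∈ e'.target)
    (hq : e'.symm y ∈ e.source) : formIn e' α y =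
      (formIn e α ((e ∘ e'.symm) y)).compContinuousLinearMap (fderiv ℝ (e ∘ e'.symm) y) := by
  ext v
  simp only [formIn, he.chartInvD_transition he' hy hq, Function.comp_apply, e.left_inv hq]
  rfl

theorem contDiffAt_formIn {k : ℕ} {α : N → Alt n k} {y : E n} (hy : y ∈ e'.target)
    (hq : e'.symm y ∈ e.source) (h : ContDiffAt ℝ ∞ (formIn e α) (e (e'.symm y))) :
    ContDiffAt ℝ ∞ (formIn e' α) y := by
  have h1 : formIn e' α =ᶠ[𝓝 y] fun z => (formIn e α ((e ∘ e'.symm) z)).compContinuousLinearMap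
      (fderiv ℝ (e ∘ e'.symm) z) := by
    filter_upwards [he.eventually_transition he' hy hq] with z hz
    exact he.formIn_transition he' α hz.1 hz.2
  refine ContDiffAt.congr_of_eventuallyEq ?_ h1
  have hτ := he.contDiffAt_transition he' hy hq
  refine contDiffAt_of_basisVec fun f => ?_
  exact ContDiffAt.alt_apply (α := fun z => formIn e α ((e ∘ e'.symm) z))
    (v := fun i z => fderiv ℝ (e ∘ e'.symm) z (basisVec (f i)))
    (ContDiffAt.comp y (g := formIn e α) h hτ) fun i =>
      (hτ.fderiv_right (m := ∞) (by simp)).clm_apply contDiffAt_const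

theorem endoIn_transition (γ : N → E n →L[ℝ] E n) {y : E n} (hy : y ∈ e'.target)
    (hq : e'.symm y ∈ e.source) : endoIn e' γ y =
      fderiv ℝ (e' ∘ e.symm) ((e ∘ e'.symm) y) ∘L endoIn e γ ((e ∘ e'.symm) y) ∘L
        fderiv ℝ (e ∘ e'.symm) y := by
  have h1 := he'.chartD_transition he (y := e (e'.symm y)) (e.map_source hq)
    (by rw [e.left_inv hq]; exact e'.map_target hy)
  rw [e.left_inv hq] at h1
  simp only [endoIn, he.chartInvD_transition he' hy hq, Function.comp_apply, e.left_inv hq, h1]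
  rfl

theorem contDiffAt_endoIn {γ : N → E n →L[ℝ] E n} {y : E n} (hy : y ∈ e'.target)
    (hq : e'.symm y ∈ e.source) (h : ContDiffAt ℝ ∞ (endoIn e γ) (e (e'.symm y))) :
    ContDiffAt ℝ ∞ (endoIn e' γ) y := by
  have h1 : endoIn e' γ =ᶠ[𝓝 y] fun z => fderiv ℝ (e' ∘ e.symm) ((e ∘ e'.symm) z) ∘L
      endoIn e γ ((e ∘ e'.symm) z) ∘L fderiv ℝ (e ∘ e'.symm) z := by
    filter_upwards [he.eventually_transition he' hy hq] with z hz
    exact he.endoIn_transition he' γ hz.1 hz.2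
  refine ContDiffAt.congr_of_eventuallyEq ?_ h1
  have hτ := he.contDiffAt_transition he' hy hq
  have hτ' := he'.contDiffAt_transition he (y := e (e'.symm y)) (e.map_source hq)
    (by rw [e.left_inv hq]; exact e'.map_target hy)
  have h2 : ContDiffAt ℝ ∞ (fun z => fderiv ℝ (e' ∘ e.symm) ((e ∘ e'.symm) z)) y :=
    ContDiffAt.comp y (g := fderiv ℝ (e' ∘ e.symm)) (hτ'.fderiv_right (m := ∞) (by simp)) hτ
  have h3 : ContDiffAt ℝ ∞ (fun z => endoIn e γ ((e ∘ e'.symm) z)) y :=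
    ContDiffAt.comp y (g := endoIn e γ) h hτ
  exact h2.clm_comp (h3.clm_comp (hτ.fderiv_right (m := ∞) (by simp)))

end IsSmoothChart

theorem extChartAt_target_eq (p₀ : N) :
    (extChartAt 𝓘(ℝ, E n) p₀).target = (chartAt (E n) p₀).target := by
  simp [mfld_simps]

theorem isOpen_chartSet (p₀ : N) {U : Set N} (hU : IsOpen U) :
    IsOpen (chartSet (n := n) p₀ U) := by
  have := (chartAt (E n) p₀).isOpen_inter_preimage_symm hU
  rw [chartSet, extChartAt_target_eq]
  exact this

theorem contDiffAt_comp_symm {f : N → ℝ} {e : OpenPartialHomeomorph N (E n)}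
    (he : IsSmoothChart e) {y : E n} (hy : y ∈ e.target)
    (hf : ContMDiffAt 𝓘(ℝ, E n) 𝓘(ℝ, ℝ) ∞ f (e.symm y)) : ContDiffAt ℝ ∞ (f ∘ e.symm) y :=
  contMDiffAt_iff_contDiffAt.1 (hf.comp y (he.contMDiffAt_symm hy))

theorem contMDiffAt_of_comp_symm {f : N → ℝ} {e : OpenPartialHomeomorph N (E n)}
    (he : IsSmoothChart e) {y : E n} (hy : y ∈ e.target)
    (hf : ContDiffAt ℝ ∞ (f ∘ e.symm) y) : ContMDiffAt 𝓘(ℝ, E n) 𝓘(ℝ, ℝ) ∞ f (e.symm y) := by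
  have h1 : f =ᶠ[𝓝 (e.symm y)] (f ∘ e.symm) ∘ e := by
    filter_upwards [e.open_source.mem_nhds (e.map_target hy)] with z hz
    simp [e.left_inv hz]
  refine ContMDiffAt.congr_of_eventuallyEq ?_ h1
  refine ContMDiffAt.comp _ ?_ (he.contMDiffAt (e.map_target hy))
  rw [e.right_inv hy]
  exact contMDiffAt_iff_contDiffAt.2 hf

variable [IsManifold 𝓘(ℝ, E n) ∞ N]

theorem IsSmoothFormOn.contDiffAt {k : ℕ} {α : N → Alt n k} {U : Set N} (hα : IsSmoothFormOn U α)
    (hU : IsOpen U) {e : OpenPartialHomeomorph N (E n)} (he : IsSmoothChart e) {y : E n}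
    (hy : y ∈ e.target) (hq : e.symm y ∈ U) : ContDiffAt ℝ ∞ (formIn e α) y := by
  set q := e.symm y with hqdef
  have hc := mem_chart_source (E n) q
  refine (isSmoothChart_chartAt q).contDiffAt_formIn he hy hc ?_
  refine (hα q).contDiffAt ((isOpen_chartSet q hU).mem_nhds ?_)
  refine ⟨by rw [extChartAt_target_eq]; exact (chartAt (E n) q).map_source hc, ?_⟩
  change (chartAt (E n) q).symm (chartAt (E n) q q) ∈ U
  rwa [(chartAt (E n) q).left_inv hc]

theorem IsSmoothEndoOn.contDiffAt {γ : N → E n →L[ℝ] E n} {U : Set N} (hα : IsSmoothEndoOn U γ)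
    (hU : IsOpen U) {e : OpenPartialHomeomorph N (E n)} (he : IsSmoothChart e) {y : E n}
    (hy : y ∈ e.target) (hq : e.symm y ∈ U) : ContDiffAt ℝ ∞ (endoIn e γ) y := by
  set q := e.symm y with hqdef
  have hc := mem_chart_source (E n) q
  refine (isSmoothChart_chartAt q).contDiffAt_endoIn he hy hc ?_
  refine (hα q).contDiffAt ((isOpen_chartSet q hU).mem_nhds ?_)
  refine ⟨by rw [extChartAt_target_eq]; exact (chartAt (E n) q).map_source hc, ?_⟩
  change (chartAt (E n) q).symm (chartAt (E n) q q) ∈ U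
  rwa [(chartAt (E n) q).left_inv hc]

/-- Smoothness of a vector-valued `1`-form may be checked in any charts. -/
theorem isSmoothEndoOn_of_charts {γ : N → E n →L[ℝ] E n} {U : Set N}
    (h : ∀ q ∈ U, ∃ e : OpenPartialHomeomorph N (E n), IsSmoothChart e ∧ q ∈ e.source ∧
      ContDiffAt ℝ ∞ (endoIn e γ) (e q)) : IsSmoothEndoOn U γ := by
  rintro p₀ y ⟨hy, hq⟩
  rw [extChartAt_target_eq] at hy
  obtain ⟨e, he, hqe, hs⟩ := h _ hq
  exact (he.contDiffAt_endoIn (isSmoothChart_chartAt p₀) hy hqe hs).contDiffWithinAt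

/-- The exterior differential may be computed in any chart. -/
theorem extD_apply_chart {k : ℕ} {α : N → Alt n k} {e : OpenPartialHomeomorph N (E n)}
    (he : IsSmoothChart e) {y : E n} (hy : y ∈ e.target) (hα : ContDiffAt ℝ ∞ (formIn e α) y)
    (v : Fin (k + 1) → E n) :
    extD α (e.symm y) (fun i => chartInvD e y (v i)) = extDeriv (formIn e α) y v := by
  set q := e.symm y with hq
  set c := chartAt (E n) q with hcdef
  have hc : q ∈ c.source := mem_chart_source (E n) q
  have hsc : IsSmoothChart c := isSmoothChart_chartAt q
  have hα' : ContDiffAt ℝ ∞ (formIn c α) (c q) := by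
    refine he.contDiffAt_formIn hsc (c.map_source hc) ?_ ?_
    · rw [c.left_inv hc]
      exact e.map_target hy
    · rw [c.left_inv hc, e.right_inv hy]
      exact hα
  have h1 : formIn e α =ᶠ[𝓝 y] fun z => (formIn c α ((c ∘ e.symm) z)).compContinuousLinearMap
      (fderiv ℝ (c ∘ e.symm) z) := by
    filter_upwards [hsc.eventually_transition he hy hc] with z hz
    exact hsc.formIn_transition he α hz.1 hz.2
  have hτ := hsc.contDiffAt_transition he hy hc
  have hd : DifferentiableAt ℝ (formIn c α) ((c ∘ e.symm) y) := hα'.differentiableAt (by simp)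
  -- `extD` is defined through the preferred chart at the point itself; naturality of d under the
  -- transition map carries it to `e`.
  rw [h1.extDeriv_eq, extDeriv_pullback hd hτ
    (by rw [minSmoothness_of_isRCLikeNormedField]; exact ENat.LEInfty.out)]
  change (extDeriv (formIn c α) (c q)) (fun i => chartD c q (chartInvD e y (v i))) =
    (extDeriv (formIn c α) (c q)) (fun i => fderiv ℝ (c ∘ e.symm) y (v i))
  congr 1
  funext i
  rw [hsc.chartD_transition he hy hc, ContinuousLinearMap.comp_apply, he.chartD_chartInvD hy]

theorem dFun_apply_chart {f : N → ℝ} {e : OpenPartialHomeomorph N (E n)}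
    (he : IsSmoothChart e) {y : E n} (hy : y ∈ e.target)
    (hf : ContDiffAt ℝ ∞ (f ∘ e.symm) y) (x : E n) :
    dFun f (e.symm y) (chartInvD e y x) = fderiv ℝ (f ∘ e.symm) y x := by
  have h := mfderiv_comp (I := 𝓘(ℝ, E n)) (I' := 𝓘(ℝ, E n)) (I'' := 𝓘(ℝ, ℝ)) y
    ((contMDiffAt_of_comp_symm he hy hf).mdifferentiableAt (by simp))
    ((he.contMDiffAt_symm hy).mdifferentiableAt (by simp))
  rw [mfderiv_eq_fderiv] at h
  exact (congrArg (fun L : E n →L[ℝ] ℝ => L x) h).symm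

theorem extD_ofFun_apply_chart {f : N → ℝ} {e : OpenPartialHomeomorph N (E n)}
    (he : IsSmoothChart e) {y : E n} (hy : y ∈ e.target)
    (hf : ContDiffAt ℝ ∞ (f ∘ e.symm) y) (x : E n) :
    extD (ofFun f) (e.symm y) ![chartInvD e y x] = fderiv ℝ (f ∘ e.symm) y x := by
  have h1 : formIn e (ofFun f) = fun z =>
      ContinuousAlternatingMap.constOfIsEmpty ℝ (E n) (Fin 0) ((f ∘ e.symm) z) := by
    funext z
    ext v
    rfl
  have h2 : ContDiffAt ℝ ∞ (formIn e (ofFun f)) y := by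
    refine contDiffAt_of_basisVec fun g => ?_
    rw [h1]
    exact hf
  have h3 := extD_apply_chart he hy h2 ![x]
  have h4 : (fun i => chartInvD e y ((![x] : Fin 1 → E n) i)) = ![chartInvD e y x] := by
    funext i
    fin_cases i
    rfl
  rw [h4] at h3
  refine h3.trans ?_
  rw [h1, extDeriv_constOfIsEmpty]
  rfl

/-- Smoothness of a family of bivector fields may be checked in any charts. -/
theorem isSmoothMVFamilyOn_of_charts {k : ℕ} {Q : ℝ → N → MV n k} {W : Set (ℝ × N)}
    (h : ∀ z ∈ W, ∃ e : OpenPartialHomeomorph N (E n), IsSmoothChart e ∧ z.2 ∈ e.source ∧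
      ∀ g : Fin k → Fin n, ContDiffAt ℝ ∞ (fun x : ℝ × E n => Q x.1 (e.symm x.2)
        fun i => basisCov (g i) ∘L chartD e (e.symm x.2)) (z.1, e z.2)) :
    IsSmoothMVFamilyOn W Q := by
  rintro p₀ ⟨ε, y⟩ ⟨hy, hq⟩
  set c := chartAt (E n) p₀ with hcdef
  have hsc : IsSmoothChart c := isSmoothChart_chartAt p₀
  rw [extChartAt_target_eq] at hy
  change y ∈ c.target at hy
  change (ε, c.symm y) ∈ W at hq
  obtain ⟨e, he, hqe, hs⟩ := h _ hq
  change c.symm y ∈ e.source at hqe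
  refine ContDiffAt.contDiffWithinAt ?_
  have hτ := he.contDiffAt_transition hsc hy hqe
  have hcy : e.symm (e (c.symm y)) ∈ c.source := by
    rw [e.left_inv hqe]
    exact c.map_target hy
  have hτ' := hsc.contDiffAt_transition he (e.map_source hqe) hcy
  refine contDiffAt_mv_of_basisCov fun f => ?_
  -- Components in the preferred chart are components in `e` contracted with the Jacobian of the
  -- transition, which does not involve the parameter.
  have h1 : (fun x : ℝ × E n => mvInChart p₀ (Q x.1) x.2 fun i => basisCov (f i)) =ᶠ[𝓝 (ε, y)]
      fun x => ∑ g : Fin k → Fin n, (∏ i, basisCov (f i)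
        (fderiv ℝ (c ∘ e.symm) ((e ∘ c.symm) x.2) (basisVec (g i)))) *
        Q x.1 (e.symm ((e ∘ c.symm) x.2))
          fun i => basisCov (g i) ∘L chartD e (e.symm ((e ∘ c.symm) x.2)) := by
    have hev : ∀ᶠ x : ℝ × E n in 𝓝 (ε, y), x.2 ∈ c.target ∧ c.symm x.2 ∈ e.source :=
      (continuous_snd.tendsto (ε, y)).eventually (he.eventually_transition hsc hy hqe)
    filter_upwards [hev] with x hx
    have e1 : e.symm ((e ∘ c.symm) x.2) = c.symm x.2 := e.left_inv hx.2
    have hcx : e.symm (e (c.symm x.2)) ∈ c.source := by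
      rw [e.left_inv hx.2]
      exact c.map_target hx.1
    have h2 := hsc.chartD_transition he (e.map_source hx.2) hcx
    rw [e.left_inv hx.2] at h2
    rw [e1]
    change Q x.1 (c.symm x.2) (fun i => basisCov (f i) ∘L chartD c (c.symm x.2)) = _
    have h3 : (fun i => basisCov (f i) ∘L chartD c (c.symm x.2)) = fun i => ∑ s,
        basisCov (f i) (fderiv ℝ (c ∘ e.symm) (e (c.symm x.2)) (basisVec s)) •
          (basisCov s ∘L chartD e (c.symm x.2)) := by
      funext i
      rw [h2]
      ext1 v
      simp only [ContinuousLinearMap.comp_apply, sum_apply,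
        smul_apply, smul_eq_mul]
      conv_lhs => rw [vec_eq_sum (chartD e (c.symm x.2) v)]
      simp [mul_comm]
    rw [h3]
    refine (MultilinearMap.map_sum (Q x.1 (c.symm x.2)).toMultilinearMap _).trans ?_
    exact Finset.sum_congr rfl fun g _ =>
      MultilinearMap.map_smul_univ (Q x.1 (c.symm x.2)).toMultilinearMap _ _
  refine ContDiffAt.congr_of_eventuallyEq ?_ h1
  have hsnd : ContDiffAt ℝ ∞ (fun x : ℝ × E n => (e ∘ c.symm) x.2) (ε, y) :=
    ContDiffAt.comp (ε, y) (g := e ∘ c.symm) hτ contDiffAt_snd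
  refine ContDiffAt.sum fun g _ => ContDiffAt.mul (contDiffAt_prod fun i _ => ?_) ?_
  · refine (basisCov (f i)).contDiff.contDiffAt.comp (ε, y) ?_
    refine ContDiffAt.clm_apply ?_ contDiffAt_const
    exact ContDiffAt.comp (ε, y) (g := fderiv ℝ (c ∘ e.symm))
      (hτ'.fderiv_right (m := ∞) (by simp)) hsnd
  · exact ContDiffAt.comp (ε, y) (g := fun x : ℝ × E n => Q x.1 (e.symm x.2)
        fun i => basisCov (g i) ∘L chartD e (e.symm x.2)) (f := fun x => (x.1, (e ∘ c.symm) x.2))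
      (hs g) (contDiffAt_fst.prodMk hsnd)

end Charts

/-! ### Charts adapted to the submersion -/

/-- The indices of the coordinates of the base. -/
def hidx : Fin 2 → Fin 5 := ![0, 1]

/-- The indices of the fibre coordinates. -/
def vidx : Fin 3 → Fin 5 := ![2, 3, 4]

theorem basisVec_apply {n : ℕ} (i j : Fin n) : (basisVec i : E n) j = if j = i then 1 else 0 := by
  simp [basisVec]

theorem basisCov_apply {n : ℕ} (i : Fin n) (y : E n) : basisCov i y = y i := rfl

theorem sum_idx (y : E 5) :
    y = ∑ i, y (hidx i) • basisVec (hidx i) + ∑ a, y (vidx a) • basisVec (vidx a) := by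
  conv_lhs => rw [vec_eq_sum y]
  simp only [basisCov_apply, Fin.sum_univ_succ, hidx, vidx]
  simp
  abel

/-- The kernel of L has dimension 5 - 2 = 3; any extension to the whole space of an isomorphism from
the kernel to ℝ^3 will do. -/
theorem exists_complementary_coordinates (L : E 5 →L[ℝ] E 2) (hL : Function.Surjective L) :
    ∃ l : E 5 →L[ℝ] (Fin 3 → ℝ), ∀ x, L x = 0 → l x = 0 → x = 0 := by
  have hr := LinearMap.finrank_range_add_finrank_ker L.toLinearMap
  have h2 : LinearMap.range L.toLinearMap = ⊤ := LinearMap.range_eq_top.2 hL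
  rw [h2, finrank_top, finrank_euclideanSpace_fin, finrank_euclideanSpace_fin] at hr
  have h3 : Module.finrank ℝ (LinearMap.ker L.toLinearMap) = Module.finrank ℝ (Fin 3 → ℝ) := by
    rw [Module.finrank_fin_fun]
    omega
  let φ := LinearEquiv.ofFinrankEq _ _ h3
  obtain ⟨g, hg⟩ := LinearMap.exists_extend φ.toLinearMap
  refine ⟨LinearMap.toContinuousLinearMap g, fun x hx hgx => ?_⟩
  have h4 : φ ⟨x, hx⟩ = 0 := by
    have := LinearMap.congr_fun hg ⟨x, hx⟩
    exact this.symm.trans hgx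
  have h5 := (LinearEquiv.map_eq_zero_iff φ).1 h4
  exact congrArg Subtype.val h5

section Adapted

variable {M B : Type*} [TopologicalSpace M] [ChartedSpace (E 5) M] [TopologicalSpace B]
  [ChartedSpace (E 2) B]

/-- `e` is a chart of `M` in which the projection becomes the projection to the first two
coordinates of the preferred chart at `b₀`. -/
structure IsAdaptedChart (π : M → B) (b₀ : B) (e : OpenPartialHomeomorph M (E 5)) : Prop where
  chart : IsSmoothChart e
  mapsTo : ∀ q ∈ e.source, π q ∈ (chartAt (E 2) b₀).source
  proj : ∀ q ∈ e.source, ∀ i, (chartAt (E 2) b₀ (π q)) i = e q (hidx i)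

variable [IsManifold 𝓘(ℝ, E 5) ∞ M] [IsManifold 𝓘(ℝ, E 2) ∞ B]

/-- The submersion theorem: the two base coordinates, completed by three linear functions that are
injective on the kernel of the differential, have invertible differential at the point, and the
inverse function theorem applies. -/
theorem exists_adapted_chart {π : M → B} (hπ : ContMDiff 𝓘(ℝ, E 5) 𝓘(ℝ, E 2) ∞ π)
    (hs : ∀ p : M, Function.Surjective (dProj π p)) (p : M) :
    ∃ e, IsAdaptedChart π (π p) e ∧ p ∈ e.source := by
  set c := chartAt (E 5) p with hc
  set C := chartAt (E 2) (π p) with hC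
  have hsc : IsSmoothChart c := isSmoothChart_chartAt p
  have hsC : IsSmoothChart C := isSmoothChart_chartAt (π p)
  have hpc : p ∈ c.source := mem_chart_source _ p
  have hpC : π p ∈ C.source := mem_chart_source _ (π p)
  set f : E 5 → E 2 := C ∘ π ∘ c.symm with hf
  set y₀ := c p with hy₀
  have hcp : c.symm y₀ = p := c.left_inv hpc
  have hy₀t : y₀ ∈ c.target := c.map_source hpc
  set W : Set (E 5) := c.target ∩ c.symm ⁻¹' (π ⁻¹' C.source) with hW
  have hWo : IsOpen W := c.isOpen_inter_preimage_symm (C.open_source.preimage hπ.continuous)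
  have hy₀W : y₀ ∈ W := ⟨hy₀t, by
    change π (c.symm y₀) ∈ C.source
    rwa [hcp]⟩
  have hfs : ∀ y ∈ W, ContDiffAt ℝ ∞ f y := fun y hy =>
    contMDiffAt_iff_contDiffAt.1 (ContMDiffAt.comp y (hsC.contMDiffAt hy.2)
      ((hπ _).comp y (hsc.contMDiffAt_symm hy.1)))
  have hfsurj : Function.Surjective (fderiv ℝ f y₀) := by
    have h1 := mfderiv_comp (I := 𝓘(ℝ, E 5)) (I' := 𝓘(ℝ, E 5)) (I'' := 𝓘(ℝ, E 2)) (g := π) y₀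
      ((hπ _).mdifferentiableAt (by simp)) ((hsc.contMDiffAt_symm hy₀t).mdifferentiableAt (by simp))
    have h2 := mfderiv_comp (I := 𝓘(ℝ, E 5)) (I' := 𝓘(ℝ, E 2)) (I'' := 𝓘(ℝ, E 2)) (g := C)
      (f := π ∘ c.symm) y₀ ((hsC.contMDiffAt hy₀W.2).mdifferentiableAt (by simp))
      (((hπ _).comp y₀ (hsc.contMDiffAt_symm hy₀t)).mdifferentiableAt (by simp))
    rw [← mfderiv_eq_fderiv]
    intro z
    have h3 : ∃ z', chartD C (π (c.symm y₀)) z' = z := by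
      have := hsC.chartD_chartInvD (C.map_source hy₀W.2)
      rw [C.left_inv hy₀W.2] at this
      exact ⟨_, this z⟩
    obtain ⟨z', hz'⟩ := h3
    obtain ⟨x', hx'⟩ := hs (c.symm y₀) z'
    refine ⟨chartD c (c.symm y₀) x', ?_⟩
    have h4 : chartInvD c y₀ (chartD c (c.symm y₀) x') = x' := hsc.chartInvD_chartD hy₀t x'
    have h5 : ∀ x, (mfderiv 𝓘(ℝ, E 5) 𝓘(ℝ, E 2) f y₀ : E 5 →L[ℝ] E 2) x =
        chartD C (π (c.symm y₀)) (dProj π (c.symm y₀) (chartInvD c y₀ x)) := by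
      intro x
      have h6 := congrArg (fun L : E 5 →L[ℝ] E 2 => L x) h2
      have h7 := congrArg (fun L : E 5 →L[ℝ] E 2 => L x) h1
      refine h6.trans ?_
      exact congrArg (chartD C (π (c.symm y₀))) h7
    refine (h5 _).trans ?_
    rw [h4, hx', hz']
  obtain ⟨l, hl⟩ := exists_complementary_coordinates _ hfsurj
  set K : E 2 →L[ℝ] E 5 := ∑ i, (basisCov i).smulRight (basisVec (hidx i)) with hK
  set K' : (Fin 3 → ℝ) →L[ℝ] E 5 :=
    ∑ a, (ContinuousLinearMap.proj a).smulRight (basisVec (vidx a)) with hK'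
  set G : E 5 → E 5 := fun y => K (f y) + K' (l y) with hG
  have hKv : ∀ x z i, (K x + K' z) (hidx i) = x i := by
    intro x z i
    fin_cases i <;> simp [hK, hK', hidx, vidx, basisCov_apply, basisVec_apply, Fin.sum_univ_succ]
  have hKv' : ∀ x z a, (K x + K' z) (vidx a) = z a := by
    intro x z i
    fin_cases i <;> simp [hK, hK', hidx, vidx, basisCov_apply, basisVec_apply, Fin.sum_univ_succ]
  have hGs : ∀ y ∈ W, ContDiffAt ℝ ∞ G y := fun y hy =>
    (K.contDiff.contDiffAt.comp y (hfs y hy)).add (K'.contDiff.contDiffAt.comp y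
      l.contDiff.contDiffAt)
  have hGd : HasFDerivAt G (K ∘L fderiv ℝ f y₀ + K' ∘L l) y₀ :=
    (K.hasFDerivAt.comp y₀ ((hfs y₀ hy₀W).differentiableAt (by simp)).hasFDerivAt).add
      (K'.hasFDerivAt.comp y₀ l.hasFDerivAt)
  set T : E 5 →L[ℝ] E 5 := K ∘L fderiv ℝ f y₀ + K' ∘L l with hT
  have hTinj : Function.Injective T.toLinearMap := by
    rw [injective_iff_map_eq_zero]
    intro x hx
    have hx' : K (fderiv ℝ f y₀ x) + K' (l x) = 0 := hx
    refine hl x ?_ ?_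
    · ext i
      rw [← hKv (fderiv ℝ f y₀ x) (l x) i, hx']
      rfl
    · funext a
      rw [← hKv' (fderiv ℝ f y₀ x) (l x) a, hx']
      rfl
  let Te : E 5 ≃L[ℝ] E 5 := (LinearEquiv.ofInjectiveEndo T.toLinearMap hTinj).toContinuousLinearEquiv
  have hTe : (Te : E 5 →L[ℝ] E 5) = T := by
    ext1 x
    rfl
  rw [← hTe] at hGd
  have hn0 : (∞ : ℕ∞ω) ≠ 0 := by simp
  -- The inverse function theorem yields a smooth inverse at the image of y₀ only. Shrinking to the
  -- open set where the differential of G is invertible makes the inverse smooth on its whole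
  -- domain.
  set W' : Set (E 5) := W ∩ fderiv ℝ G ⁻¹' Set.range ((↑) : (E 5 ≃L[ℝ] E 5) → E 5 →L[ℝ] E 5)
    with hW'
  have hW'o : IsOpen W' := by
    have hcont : ContinuousOn (fderiv ℝ G) W := fun y hy =>
      ((hGs y hy).fderiv_right (m := ∞) (by simp)).continuousAt.continuousWithinAt
    exact hcont.isOpen_inter_preimage hWo ContinuousLinearEquiv.isOpen
  have hy₀W' : y₀ ∈ W' := ⟨hy₀W, ⟨Te, hGd.fderiv.symm⟩⟩
  set g := ((hGs y₀ hy₀W).toOpenPartialHomeomorph G hGd hn0).restrOpen W' hW'o with hg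
  have hgG : ∀ y, g y = G y := fun y => rfl
  have hgs : g.source ⊆ W' := by
    rw [hg, OpenPartialHomeomorph.restrOpen_source]
    exact Set.inter_subset_right
  have hy₀g : y₀ ∈ g.source := by
    rw [hg, OpenPartialHomeomorph.restrOpen_source]
    exact ⟨ContDiffAt.mem_toOpenPartialHomeomorph_source _ hGd hn0, hy₀W'⟩
  have hg1 : ∀ y ∈ g.source, ContDiffAt ℝ ∞ g y := fun y hy => hGs y (hgs hy).1
  have hg2 : ∀ z ∈ g.target, ContDiffAt ℝ ∞ g.symm z := by
    intro z hz
    have hy := g.map_target hz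
    obtain ⟨A, hA⟩ := (hgs hy).2
    refine g.contDiffAt_symm (f₀' := A) hz ?_ (hg1 _ hy)
    rw [hA]
    exact ((hg1 _ hy).differentiableAt (by simp)).hasFDerivAt
  refine ⟨c.trans g, ⟨⟨?_, ?_⟩, ?_, ?_⟩, ?_⟩
  · intro q hq
    rw [OpenPartialHomeomorph.trans_source] at hq
    exact (ContMDiffAt.comp q (contMDiffAt_iff_contDiffAt.2 (hg1 _ hq.2))
      (hsc.contMDiffAt hq.1)).contMDiffWithinAt
  · intro z hz
    rw [OpenPartialHomeomorph.trans_target] at hz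
    exact (ContMDiffAt.comp z (hsc.contMDiffAt_symm hz.2)
      (contMDiffAt_iff_contDiffAt.2 (hg2 _ hz.1))).contMDiffWithinAt
  · intro q hq
    rw [OpenPartialHomeomorph.trans_source] at hq
    have := (hgs hq.2).1.2
    change π (c.symm (c q)) ∈ C.source at this
    rwa [c.left_inv hq.1] at this
  · intro q hq i
    rw [OpenPartialHomeomorph.trans_source] at hq
    change _ = G (c q) (hidx i)
    rw [hG, hKv]
    simp only [hf, Function.comp_apply, c.left_inv hq.1]
    rfl
  · rw [OpenPartialHomeomorph.trans_source]
    exact ⟨hpc, hy₀g⟩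

end Adapted

/-! ### Coordinate data and the frame of an adapted chart -/

section Local

variable {M B : Type*} [TopologicalSpace M] [ChartedSpace (E 5) M] [TopologicalSpace B]
  [ChartedSpace (E 2) B]

/-- The components of a connection form in an adapted chart. -/
def locG (e : OpenPartialHomeomorph M (E 5)) (γ : M → E 5 →L[ℝ] E 5) (i : Fin 2) (a : Fin 3)
    (y : E 5) : ℝ := (endoIn e γ y (basisVec (hidx i))) (vidx a)

/-- The components of a `1`-form in a chart. -/
def locOne (e : OpenPartialHomeomorph M (E 5)) (α : M → Alt 5 1) (j : Fin 5) (y : E 5) : ℝ :=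
  toCov (α (e.symm y)) (chartInvD e y (basisVec j))

/-- The coefficient of the area form of the base in an adapted chart. -/
def locW (π : M → B) (ω₀ : B → Alt 2 2) (b₀ : B) (e : OpenPartialHomeomorph M (E 5)) (y : E 5) : ℝ :=
  ω₀ (π (e.symm y)) fun i => coordField b₀ i (π (e.symm y))

/-- The coefficient of the vertical volume form in an adapted chart. -/
def locV (π : M → B) (Ω : M → Alt 5 5) (ω₀ : B → Alt 2 2) (b₀ : B)
    (e : OpenPartialHomeomorph M (E 5)) (y : E 5) : ℝ :=
  formIn e Ω y basisVec / locW π ω₀ b₀ e y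

/-- The horizontal vector field with given components. -/
def horDir (G : Fin 2 → Fin 3 → E 5 → ℝ) (i : Fin 2) (y : E 5) : E 5 :=
  basisVec (hidx i) - ∑ a, G i a y • basisVec (vidx a)

/-- The projection to the coordinates of the base. -/
def baseProj : E 5 →L[ℝ] E 2 := ∑ i, (basisCov (hidx i)).smulRight (basisVec i)

theorem baseProj_apply (x : E 5) (i : Fin 2) : baseProj x i = x (hidx i) := by
  fin_cases i <;> simp [baseProj, basisCov_apply, basisVec_apply, Fin.sum_univ_succ]

theorem baseProj_vidx (a : Fin 3) : baseProj (basisVec (vidx a)) = 0 := by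
  ext i
  rw [baseProj_apply]
  fin_cases a <;> fin_cases i <;> simp [hidx, vidx, basisVec_apply]

theorem hidx_vidx (i : Fin 2) (a : Fin 3) : hidx i ≠ vidx a := by
  fin_cases a <;> fin_cases i <;> simp [hidx, vidx]

theorem hidx_inj {i j : Fin 2} : hidx i = hidx j ↔ i = j := by
  fin_cases i <;> fin_cases j <;> simp [hidx]

theorem vidx_inj {a b : Fin 3} : vidx a = vidx b ↔ a = b := by
  fin_cases a <;> fin_cases b <;> simp [vidx]

/-- A connection form without smoothness. -/
def IsSplitting (π : M → B) (γ : M → E 5 →L[ℝ] E 5) : Prop :=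
  ∀ p, (∀ v, dProj π p (γ p v) = 0) ∧ ∀ v, dProj π p v = 0 → γ p v = v

variable [IsManifold 𝓘(ℝ, E 5) ∞ M] [IsManifold 𝓘(ℝ, E 2) ∞ B]

namespace IsAdaptedChart

variable {π : M → B} {b₀ : B} {e : OpenPartialHomeomorph M (E 5)} (he : IsAdaptedChart π b₀ e)

include he

theorem base_chart {y : E 5} (hy : y ∈ e.target) :
    chartAt (E 2) b₀ (π (e.symm y)) = baseProj y := by
  ext i
  rw [he.proj _ (e.map_target hy), e.right_inv hy, baseProj_apply]

theorem chartD_dProj (hπ : ContMDiff 𝓘(ℝ, E 5) 𝓘(ℝ, E 2) ∞ π) {y : E 5} (hy : y ∈ e.target)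
    (x : E 5) : chartD (chartAt (E 2) b₀) (π (e.symm y)) (dProj π (e.symm y) (chartInvD e y x)) =
      baseProj x := by
  set C := chartAt (E 2) b₀
  have hC : IsSmoothChart C := isSmoothChart_chartAt b₀
  have h0 := he.mapsTo _ (e.map_target hy)
  have h1 := mfderiv_comp (I := 𝓘(ℝ, E 5)) (I' := 𝓘(ℝ, E 5)) (I'' := 𝓘(ℝ, E 2)) (g := π) y
    ((hπ _).mdifferentiableAt (by simp)) ((he.chart.contMDiffAt_symm hy).mdifferentiableAt (by simp))
  have h2 := mfderiv_comp (I := 𝓘(ℝ, E 5)) (I' := 𝓘(ℝ, E 2)) (I'' := 𝓘(ℝ, E 2)) (g := C)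
    (f := π ∘ e.symm) y ((hC.contMDiffAt h0).mdifferentiableAt (by simp))
    (((hπ _).comp y (he.chart.contMDiffAt_symm hy)).mdifferentiableAt (by simp))
  have h3 : C ∘ (π ∘ e.symm) =ᶠ[𝓝 y] baseProj := by
    filter_upwards [e.open_target.mem_nhds hy] with z hz
    exact he.base_chart hz
  rw [mfderiv_eq_fderiv, h3.fderiv_eq, baseProj.fderiv] at h2
  have h4 := congrArg (fun L : E 5 →L[ℝ] E 2 => L x) h1
  have h5 := congrArg (fun L : E 5 →L[ℝ] E 2 => L x) h2
  refine Eq.trans ?_ h5.symm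
  exact (congrArg (chartD C (π (e.symm y))) h4).symm

theorem coordField_dual {y : E 5} (hy : y ∈ e.target) (i j : Fin 2) :
    basisCov i (chartD (chartAt (E 2) b₀) (π (e.symm y)) (coordField b₀ j (π (e.symm y)))) =
      if i = j then 1 else 0 := by
  set C := chartAt (E 2) b₀ with hCdef
  have hC : IsSmoothChart C := isSmoothChart_chartAt b₀
  have h0 := he.mapsTo _ (e.map_target hy)
  have h1 := hC.chartD_chartInvD (C.map_source h0) (basisVec j)
  rw [C.left_inv h0] at h1
  change basisCov i (chartD C (π (e.symm y)) (chartInvD C (C (π (e.symm y))) (basisVec j))) = _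
  rw [h1, basisCov_apply, basisVec_apply]

theorem base_decomp {y : E 5} (hy : y ∈ e.target) (x : E 2) :
    x = ∑ i, basisCov i (chartD (chartAt (E 2) b₀) (π (e.symm y)) x) •
      coordField b₀ i (π (e.symm y)) := by
  set C := chartAt (E 2) b₀ with hCdef
  have hC : IsSmoothChart C := isSmoothChart_chartAt b₀
  have h0 := he.mapsTo _ (e.map_target hy)
  have h1 := hC.chartInvD_chartD (C.map_source h0) x
  rw [C.left_inv h0] at h1
  conv_lhs => rw [← h1, vec_eq_sum (chartD C (π (e.symm y)) x)]
  rw [map_sum]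
  simp only [map_smul]
  rfl

theorem dProj_eq (hπ : ContMDiff 𝓘(ℝ, E 5) 𝓘(ℝ, E 2) ∞ π) {y : E 5} (hy : y ∈ e.target)
    (x : E 5) : dProj π (e.symm y) (chartInvD e y x) =
      ∑ i, x (hidx i) • coordField b₀ i (π (e.symm y)) := by
  rw [he.base_decomp hy (dProj π (e.symm y) (chartInvD e y x))]
  simp only [he.chartD_dProj hπ hy, basisCov_apply, baseProj_apply]

theorem coord_eq_zero (hπ : ContMDiff 𝓘(ℝ, E 5) 𝓘(ℝ, E 2) ∞ π) {y : E 5} (hy : y ∈ e.target)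
    {z : E 5} (hz : dProj π (e.symm y) z = 0) (i : Fin 2) :
    chartD e (e.symm y) z (hidx i) = 0 := by
  have h := he.chartD_dProj hπ hy (chartD e (e.symm y) z)
  rw [he.chart.chartInvD_chartD hy, hz, map_zero] at h
  rw [← baseProj_apply, ← h]
  rfl

theorem vertical_eq (hπ : ContMDiff 𝓘(ℝ, E 5) 𝓘(ℝ, E 2) ∞ π) {y : E 5} (hy : y ∈ e.target)
    {z : E 5} (hz : dProj π (e.symm y) z = 0) :
    z = ∑ a, chartD e (e.symm y) z (vidx a) • chartInvD e y (basisVec (vidx a)) := by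
  have h1 := sum_idx (chartD e (e.symm y) z)
  simp only [he.coord_eq_zero hπ hy hz, zero_smul, Finset.sum_const_zero, zero_add] at h1
  conv_lhs => rw [← he.chart.chartInvD_chartD hy z, h1]
  simp

theorem dProj_vidx (hπ : ContMDiff 𝓘(ℝ, E 5) 𝓘(ℝ, E 2) ∞ π) {y : E 5} (hy : y ∈ e.target)
    (a : Fin 3) : dProj π (e.symm y) (chartInvD e y (basisVec (vidx a))) = 0 := by
  rw [he.dProj_eq hπ hy]
  refine Finset.sum_eq_zero fun i _ => ?_
  rw [basisVec_apply, if_neg (hidx_vidx i a), zero_smul]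

theorem gamma_hidx (hπ : ContMDiff 𝓘(ℝ, E 5) 𝓘(ℝ, E 2) ∞ π) {γ : M → E 5 →L[ℝ] E 5}
    (hγ : IsSplitting π γ) {y : E 5} (hy : y ∈ e.target) (i : Fin 2) :
    γ (e.symm y) (chartInvD e y (basisVec (hidx i))) =
      ∑ a, locG e γ i a y • chartInvD e y (basisVec (vidx a)) :=
  he.vertical_eq hπ hy ((hγ _).1 _)

theorem horDir_eq (hπ : ContMDiff 𝓘(ℝ, E 5) 𝓘(ℝ, E 2) ∞ π) {γ : M → E 5 →L[ℝ] E 5}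
    (hγ : IsSplitting π γ) {y : E 5} (hy : y ∈ e.target) (i : Fin 2) :
    chartInvD e y (horDir (locG e γ) i y) = chartInvD e y (basisVec (hidx i)) -
      γ (e.symm y) (chartInvD e y (basisVec (hidx i))) := by
  rw [he.gamma_hidx hπ hγ hy, horDir, map_sub, map_sum]
  simp

/-- The frame of a tangent space defined by an adapted chart and a connection. -/
def frame (hπ : ContMDiff 𝓘(ℝ, E 5) 𝓘(ℝ, E 2) ∞ π) {γ : M → E 5 →L[ℝ] E 5}
    (hγ : IsSplitting π γ) {y : E 5} (hy : y ∈ e.target) :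
    AdaptedFrame (dProj π (e.symm y)) (γ (e.symm y)) where
  H i := chartInvD e y (horDir (locG e γ) i y)
  V a := chartInvD e y (basisVec (vidx a))
  h i := basisCov (hidx i) ∘L chartD e (e.symm y)
  η a := basisCov (vidx a) ∘L chartD e (e.symm y) ∘L γ (e.symm y)
  C i := coordField b₀ i (π (e.symm y))
  cc i := basisCov i ∘L chartD (chartAt (E 2) b₀) (π (e.symm y))
  h_H i j := by
    rw [ContinuousLinearMap.comp_apply, he.chart.chartD_chartInvD hy, basisCov_apply, horDir]
    simp [basisVec_apply, hidx_vidx, hidx_inj]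
  h_V i a := by
    rw [ContinuousLinearMap.comp_apply, he.chart.chartD_chartInvD hy, basisCov_apply,
      basisVec_apply, if_neg (hidx_vidx i a)]
  η_H a i := by
    rw [he.horDir_eq hπ hγ hy, ContinuousLinearMap.comp_apply, ContinuousLinearMap.comp_apply,
      map_sub, (hγ _).2 _ ((hγ _).1 _), sub_self, map_zero, map_zero]
  η_V a b := by
    rw [ContinuousLinearMap.comp_apply, ContinuousLinearMap.comp_apply,
      (hγ _).2 _ (he.dProj_vidx hπ hy b), he.chart.chartD_chartInvD hy, basisCov_apply,
      basisVec_apply]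
    simp [vidx_inj]
  decomp x := by
    have h1 : ∑ a, (basisCov (vidx a) ∘L chartD e (e.symm y) ∘L γ (e.symm y)) x •
        chartInvD e y (basisVec (vidx a)) = γ (e.symm y) x :=
      (he.vertical_eq hπ hy ((hγ _).1 x)).symm
    have h2 : x = ∑ i, chartD e (e.symm y) x (hidx i) • chartInvD e y (basisVec (hidx i)) +
        ∑ a, chartD e (e.symm y) x (vidx a) • chartInvD e y (basisVec (vidx a)) := by
      conv_lhs => rw [← he.chart.chartInvD_chartD hy x, sum_idx (chartD e (e.symm y) x)]
      simp
    have h3 : γ (e.symm y) x = ∑ i, chartD e (e.symm y) x (hidx i) •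
        γ (e.symm y) (chartInvD e y (basisVec (hidx i))) +
        ∑ a, chartD e (e.symm y) x (vidx a) • chartInvD e y (basisVec (vidx a)) := by
      conv_lhs => rw [h2]
      rw [map_add, map_sum, map_sum]
      simp only [map_smul, (hγ _).2 _ (he.dProj_vidx hπ hy _)]
    rw [h1]
    simp only [he.horDir_eq hπ hγ hy, smul_sub, Finset.sum_sub_distrib,
      ContinuousLinearMap.comp_apply, basisCov_apply]
    refine h2.trans ?_
    rw [h3]
    abel
  P_H i := by
    rw [he.horDir_eq hπ hγ hy, map_sub, (hγ _).1, sub_zero, he.dProj_eq hπ hy]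
    simp [basisVec_apply, hidx_inj]
  P_V a := he.dProj_vidx hπ hy a
  g_H i := by rw [he.horDir_eq hπ hγ hy, map_sub, (hγ _).2 _ ((hγ _).1 _), sub_self]
  g_V a := (hγ _).2 _ (he.dProj_vidx hπ hy a)
  cc_C i j := he.coordField_dual hy i j
  decompB x := he.base_decomp hy x

/-- The coframe evaluated on the coordinate basis is unitriangular, so Ω takes the same value on the
frame as on the coordinate basis. In particular the vertical volume coefficient does not depend on
the connection. -/
theorem frame_vol (hπ : ContMDiff 𝓘(ℝ, E 5) 𝓘(ℝ, E 2) ∞ π) {γ : M → E 5 →L[ℝ] E 5}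
    (hγ : IsSplitting π γ) {y : E 5} (hy : y ∈ e.target) (Ω : M → Alt 5 5) (ω₀ : B → Alt 2 2) :
    (he.frame hπ hγ hy).vol Ω ω₀ = locV π Ω ω₀ b₀ e y := by
  set F := he.frame hπ hγ hy with hF
  have h1 : formIn e Ω y basisVec = Ω (e.symm y) F.all := by
    change Ω (e.symm y) (fun j => chartInvD e y (basisVec j)) = _
    conv_lhs => rw [F.total_eq (Ω := Ω)]
    rw [ContinuousAlternatingMap.smul_apply, covWedge_apply]
    have hh : ∀ i j, F.h i (chartInvD e y (basisVec j)) = if hidx i = j then 1 else 0 := by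
      intro i j
      change basisCov (hidx i) (chartD e (e.symm y) (chartInvD e y (basisVec j))) = _
      rw [he.chart.chartD_chartInvD hy, basisCov_apply, basisVec_apply]
    have hη : ∀ a b, F.η a (chartInvD e y (basisVec (vidx b))) = if a = b then 1 else 0 :=
      F.η_V
    have hη2 := hη 0 0
    have hη3 := hη 1 1
    have hη4 := hη 2 2
    have hη5 := hη 0 1
    have hη6 := hη 0 2
    have hη7 := hη 1 2
    simp only [vidx, Matrix.cons_val] at hη2 hη3 hη4 hη5 hη6 hη7
    have e0 : F.allCov 0 = F.h 0 := rfl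
    have e1 : F.allCov 1 = F.h 1 := rfl
    have e2 : F.allCov 2 = F.η 0 := rfl
    have e3 : F.allCov 3 = F.η 1 := rfl
    have e4 : F.allCov 4 = F.η 2 := rfl
    -- The connection coefficients occupy only the entries η_a(∂_i), below the diagonal.
    rw [Matrix.det_of_isLowerTriangular]
    · simp only [Fin.prod_univ_five, Matrix.of_apply, e0, e1, e2, e3, e4, hh, hη2, hη3, hη4]
      simp [hidx]
    · intro i j hij
      have hij : i < j := hij
      fin_cases i <;> fin_cases j <;> first
        | exact absurd hij (by decide)
        | simp [e0, e1, e2, e3, e4, hh, hidx, hη5, hη6, hη7]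
  rw [locV, h1]
  rfl

end IsAdaptedChart

theorem exists_frame {π : M → B} (hπ : ContMDiff 𝓘(ℝ, E 5) 𝓘(ℝ, E 2) ∞ π)
    (hs : ∀ p : M, Function.Surjective (dProj π p)) {γ : M → E 5 →L[ℝ] E 5}
    (hγ : IsSplitting π γ) (p : M) : Nonempty (AdaptedFrame (dProj π p) (γ p)) := by
  obtain ⟨e, he, hp⟩ := exists_adapted_chart hπ hs p
  have := he.frame hπ hγ (e.map_source hp)
  rw [e.left_inv hp] at this
  exact ⟨this⟩

end Local

/-! ### Fibre derivatives, horizontal derivatives and the vertical bracket -/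

section Calculus

/-- Partial derivatives. -/
def pd (j : Fin 5) (f : E 5 → ℝ) (y : E 5) : ℝ := fderiv ℝ f y (basisVec j)

/-- Derivatives along the fibres. -/
def vd (a : Fin 3) (f : E 5 → ℝ) : E 5 → ℝ := pd (vidx a) f

/-- Derivatives along the horizontal vector fields `horDir G i`. -/
def hd (G : Fin 2 → Fin 3 → E 5 → ℝ) (i : Fin 2) (f : E 5 → ℝ) (y : E 5) : ℝ :=
  pd (hidx i) f y - (G i 0 y * vd 0 f y + G i 1 y * vd 1 f y + G i 2 y * vd 2 f y)

/-- The vertical bracket with coefficients `u b`. -/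
def pb (u : E 5 → ℝ) (b : Fin 3 → E 5 → ℝ) (f g : E 5 → ℝ) (y : E 5) : ℝ :=
  u y * (b 0 y * (vd 1 f y * vd 2 g y - vd 2 f y * vd 1 g y) +
    b 1 y * (vd 2 f y * vd 0 g y - vd 0 f y * vd 2 g y) +
    b 2 y * (vd 0 f y * vd 1 g y - vd 1 f y * vd 0 g y))

variable {y : E 5} {f g h k u v w α : E 5 → ℝ} {G : Fin 2 → Fin 3 → E 5 → ℝ} {b : Fin 3 → E 5 → ℝ}

theorem contDiffAt_pd (hf : ContDiffAt ℝ ∞ f y) (j : Fin 5) : ContDiffAt ℝ ∞ (pd j f) y :=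
  (hf.fderiv_right (m := ∞) (by simp)).clm_apply contDiffAt_const

theorem contDiffAt_vd (hf : ContDiffAt ℝ ∞ f y) (a : Fin 3) : ContDiffAt ℝ ∞ (vd a f) y :=
  contDiffAt_pd hf _

theorem contDiffAt_hd (hG : ∀ i a, ContDiffAt ℝ ∞ (G i a) y) (hf : ContDiffAt ℝ ∞ f y)
    (i : Fin 2) : ContDiffAt ℝ ∞ (hd G i f) y := by
  have hv := contDiffAt_vd hf
  exact (contDiffAt_pd hf _).sub
    ((((hG i 0).mul (hv 0)).add ((hG i 1).mul (hv 1))).add ((hG i 2).mul (hv 2)))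

theorem contDiffAt_pb (hu : ContDiffAt ℝ ∞ u y) (hb : ∀ a, ContDiffAt ℝ ∞ (b a) y)
    (hf : ContDiffAt ℝ ∞ f y) (hg : ContDiffAt ℝ ∞ g y) : ContDiffAt ℝ ∞ (pb u b f g) y := by
  have hv := contDiffAt_vd hf
  have hw := contDiffAt_vd hg
  exact hu.mul (((((hb 0).mul (((hv 1).mul (hw 2)).sub ((hv 2).mul (hw 1))))).add
    ((hb 1).mul (((hv 2).mul (hw 0)).sub ((hv 0).mul (hw 2))))).add
    ((hb 2).mul (((hv 0).mul (hw 1)).sub ((hv 1).mul (hw 0)))))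

theorem diffAt_of_contDiffAt (hf : ContDiffAt ℝ ∞ f y) : DifferentiableAt ℝ f y :=
  hf.differentiableAt (by simp)

theorem pd_congr (h : f =ᶠ[𝓝 y] g) (j : Fin 5) : pd j f y = pd j g y := by
  rw [pd, pd, h.fderiv_eq]

theorem vd_congr (h : f =ᶠ[𝓝 y] g) (a : Fin 3) : vd a f y = vd a g y := pd_congr h _

theorem hd_congr (h : f =ᶠ[𝓝 y] g) (i : Fin 2) : hd G i f y = hd G i g y := by
  simp only [hd, pd_congr h, vd_congr h]

theorem pb_congr {f' g' : E 5 → ℝ} (hf : f =ᶠ[𝓝 y] f') (hg : g =ᶠ[𝓝 y] g') :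
    pb u b f g y = pb u b f' g' y := by
  simp only [pb, vd_congr hf, vd_congr hg]

theorem pd_add (hf : ContDiffAt ℝ ∞ f y) (hg : ContDiffAt ℝ ∞ g y) (j : Fin 5) :
    pd j (fun z => f z + g z) y = pd j f y + pd j g y := by
  rw [pd, fderiv_fun_add (diffAt_of_contDiffAt hf) (diffAt_of_contDiffAt hg)]
  rfl

theorem pd_sub (hf : ContDiffAt ℝ ∞ f y) (hg : ContDiffAt ℝ ∞ g y) (j : Fin 5) :
    pd j (fun z => f z - g z) y = pd j f y - pd j g y := by
  rw [pd, fderiv_fun_sub (diffAt_of_contDiffAt hf) (diffAt_of_contDiffAt hg)]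
  rfl

theorem pd_mul (hf : ContDiffAt ℝ ∞ f y) (hg : ContDiffAt ℝ ∞ g y) (j : Fin 5) :
    pd j (fun z => f z * g z) y = pd j f y * g y + f y * pd j g y := by
  rw [pd, fderiv_fun_mul (diffAt_of_contDiffAt hf) (diffAt_of_contDiffAt hg)]
  simp [pd]
  ring

theorem pd_const (r : ℝ) (j : Fin 5) : pd j (fun _ => r) y = 0 := by
  simp [pd]

theorem pd_inv (hf : ContDiffAt ℝ ∞ f y) (hf0 : f y ≠ 0) (j : Fin 5) :
    pd j (fun z => (f z)⁻¹) y = -((f y)⁻¹ ^ 2 * pd j f y) := by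
  have h1 : HasFDerivAt (fun z => (f z)⁻¹) _ y :=
    (hasFDerivAt_inv hf0).comp y (diffAt_of_contDiffAt hf).hasFDerivAt
  rw [pd, h1.fderiv]
  simp [pd, mul_comm]

theorem pd_pd_comm (hf : ContDiffAt ℝ ∞ f y) (i j : Fin 5) :
    pd i (pd j f) y = pd j (pd i f) y := by
  have hd : DifferentiableAt ℝ (fderiv ℝ f) y :=
    (hf.fderiv_right (m := ∞) (by simp)).differentiableAt (by simp)
  have h1 : ∀ i j, pd i (pd j f) y = fderiv ℝ (fderiv ℝ f) y (basisVec i) (basisVec j) := by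
    intro i j
    have h2 : HasFDerivAt (pd j f) _ y := hd.hasFDerivAt.clm_apply (hasFDerivAt_const (basisVec j) y)
    rw [pd, h2.fderiv]
    simp
  have hs : IsSymmSndFDerivAt ℝ f y := hf.isSymmSndFDerivAt (by
    rw [minSmoothness_of_isRCLikeNormedField]; exact ENat.LEInfty.out)
  rw [h1, h1, hs]

theorem pd_hd (hG : ∀ i a, ContDiffAt ℝ ∞ (G i a) y) (hf : ContDiffAt ℝ ∞ f y) (i : Fin 2)
    (j : Fin 5) : pd j (hd G i f) y = pd j (pd (hidx i) f) y -
      (pd j (G i 0) y * vd 0 f y + G i 0 y * pd j (vd 0 f) y +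
        (pd j (G i 1) y * vd 1 f y + G i 1 y * pd j (vd 1 f) y) +
        (pd j (G i 2) y * vd 2 f y + G i 2 y * pd j (vd 2 f) y)) := by
  have hp := (diffAt_of_contDiffAt (contDiffAt_pd hf (hidx i))).hasFDerivAt
  have hv := fun a => (diffAt_of_contDiffAt (contDiffAt_vd hf a)).hasFDerivAt
  have hg := fun a => (diffAt_of_contDiffAt (hG i a)).hasFDerivAt
  have h : HasFDerivAt (hd G i f) _ y := hp.sub
    ((((hg 0).mul (hv 0)).add ((hg 1).mul (hv 1))).add ((hg 2).mul (hv 2)))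
  rw [pd, h.fderiv]
  simp only [pd, sub_apply, add_apply, smul_apply, smul_eq_mul]
  ring

theorem pd_pb (hu : ContDiffAt ℝ ∞ u y) (hb : ∀ a, ContDiffAt ℝ ∞ (b a) y)
    (hf : ContDiffAt ℝ ∞ f y) (hg : ContDiffAt ℝ ∞ g y) (j : Fin 5) :
    pd j (pb u b f g) y =
      pd j u y * (b 0 y * (vd 1 f y * vd 2 g y - vd 2 f y * vd 1 g y) +
        b 1 y * (vd 2 f y * vd 0 g y - vd 0 f y * vd 2 g y) +
        b 2 y * (vd 0 f y * vd 1 g y - vd 1 f y * vd 0 g y)) +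
      u y * (pd j (b 0) y * (vd 1 f y * vd 2 g y - vd 2 f y * vd 1 g y) +
        pd j (b 1) y * (vd 2 f y * vd 0 g y - vd 0 f y * vd 2 g y) +
        pd j (b 2) y * (vd 0 f y * vd 1 g y - vd 1 f y * vd 0 g y)) +
      u y * (b 0 y * (pd j (vd 1 f) y * vd 2 g y - pd j (vd 2 f) y * vd 1 g y) +
        b 1 y * (pd j (vd 2 f) y * vd 0 g y - pd j (vd 0 f) y * vd 2 g y) +
        b 2 y * (pd j (vd 0 f) y * vd 1 g y - pd j (vd 1 f) y * vd 0 g y)) +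
      u y * (b 0 y * (vd 1 f y * pd j (vd 2 g) y - vd 2 f y * pd j (vd 1 g) y) +
        b 1 y * (vd 2 f y * pd j (vd 0 g) y - vd 0 f y * pd j (vd 2 g) y) +
        b 2 y * (vd 0 f y * pd j (vd 1 g) y - vd 1 f y * pd j (vd 0 g) y)) := by
  have h0 := (diffAt_of_contDiffAt hu).hasFDerivAt
  have hv := fun a => (diffAt_of_contDiffAt (contDiffAt_vd hf a)).hasFDerivAt
  have hw := fun a => (diffAt_of_contDiffAt (contDiffAt_vd hg a)).hasFDerivAt
  have hc := fun a => (diffAt_of_contDiffAt (hb a)).hasFDerivAt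
  have h : HasFDerivAt (pb u b f g) _ y := h0.mul
    (((((hc 0).mul (((hv 1).mul (hw 2)).sub ((hv 2).mul (hw 1))))).add
    ((hc 1).mul (((hv 2).mul (hw 0)).sub ((hv 0).mul (hw 2))))).add
    ((hc 2).mul (((hv 0).mul (hw 1)).sub ((hv 1).mul (hw 0)))))
  rw [pd, h.fderiv]
  simp only [pd, sub_apply, add_apply, smul_apply, smul_eq_mul, Pi.sub_apply,
    Pi.mul_apply]
  ring

/-- The integrability of the kernel of `b` along the fibres. -/
def FibreIntegrable (b : Fin 3 → E 5 → ℝ) (y : E 5) : Prop :=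
  (vd 0 (b 1) y - vd 1 (b 0) y) * b 2 y - (vd 0 (b 2) y - vd 2 (b 0) y) * b 1 y +
    (vd 1 (b 2) y - vd 2 (b 1) y) * b 0 y = 0

/-- The Jacobiator equals -u² (db ∧ b) det(df, dg, dh) along the fibre: second derivatives cancel by
symmetry, and the derivatives of u drop out. In dimension three, integrability of b therefore
suffices for any factor u. -/
theorem pb_jacobi (hb1 : FibreIntegrable b y) (hu : ContDiffAt ℝ ∞ u y)
    (hb : ∀ a, ContDiffAt ℝ ∞ (b a) y) (hf : ContDiffAt ℝ ∞ f y) (hg : ContDiffAt ℝ ∞ g y)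
    (hh : ContDiffAt ℝ ∞ h y) :
    pb u b f (pb u b g h) y + pb u b g (pb u b h f) y + pb u b h (pb u b f g) y = 0 := by
  have e1 : ∀ a, vd a (pb u b g h) y = _ := fun a => pd_pb hu hb hg hh (vidx a)
  have e2 : ∀ a, vd a (pb u b h f) y = _ := fun a => pd_pb hu hb hh hf (vidx a)
  have e3 : ∀ a, vd a (pb u b f g) y = _ := fun a => pd_pb hu hb hf hg (vidx a)
  have cf : ∀ a c, pd (vidx a) (vd c f) y = pd (vidx c) (vd a f) y := fun a c => pd_pd_comm hf _ _
  have cg : ∀ a c, pd (vidx a) (vd c g) y = pd (vidx c) (vd a g) y := fun a c => pd_pd_comm hg _ _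
  have ch : ∀ a c, pd (vidx a) (vd c h) y = pd (vidx c) (vd a h) y := fun a c => pd_pd_comm hh _ _
  rw [pb, pb, pb]
  simp only [e1, e2, e3, cf 1 0, cf 2 0, cf 2 1, cg 1 0, cg 2 0, cg 2 1, ch 1 0, ch 2 0, ch 2 1]
  rw [FibreIntegrable] at hb1
  simp only [show ∀ a F, vd a F y = pd (vidx a) F y from fun _ _ => rfl] at hb1 ⊢
  linear_combination (-u y ^ 2 *
    (pd (vidx 0) f y * (pd (vidx 1) g y * pd (vidx 2) h y - pd (vidx 2) g y * pd (vidx 1) h y) +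
    pd (vidx 1) f y * (pd (vidx 2) g y * pd (vidx 0) h y - pd (vidx 0) g y * pd (vidx 2) h y) +
    pd (vidx 2) f y * (pd (vidx 0) g y * pd (vidx 1) h y - pd (vidx 1) g y * pd (vidx 0) h y))) * hb1

/-- The coefficients of the parallelism of `u b` along the horizontal fields. -/
def parCoeff (u : E 5 → ℝ) (b : Fin 3 → E 5 → ℝ) (G : Fin 2 → Fin 3 → E 5 → ℝ) (i : Fin 2)
    (a : Fin 3) (y : E 5) : ℝ :=
  u y * (hd G i (b a) y - (b 0 y * vd a (G i 0) y + b 1 y * vd a (G i 1) y +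
    b 2 y * vd a (G i 2) y)) +
    (hd G i u y + u y * (vd 0 (G i 0) y + vd 1 (G i 1) y + vd 2 (G i 2) y)) * b a y

/-- The failure of h_i to be a derivation is the sum of the `parCoeff` against the 2 × 2 minors of
(df, dg). The factor r is carried along because the second equation of a triple holds only after
multiplication by κ. -/
theorem hd_pb (hG : ∀ i a, ContDiffAt ℝ ∞ (G i a) y) (hu : ContDiffAt ℝ ∞ u y)
    (hb : ∀ a, ContDiffAt ℝ ∞ (b a) y) (hf : ContDiffAt ℝ ∞ f y) (hg : ContDiffAt ℝ ∞ g y)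
    (i : Fin 2) {r : ℝ} (hp : ∀ a, r * parCoeff u b G i a y = 0) :
    r * hd G i (pb u b f g) y = r * (pb u b (hd G i f) g y + pb u b f (hd G i g) y) := by
  have e1 : ∀ j, pd j (pb u b f g) y = _ := fun j => pd_pb hu hb hf hg j
  have e2 : ∀ a, vd a (hd G i f) y = _ := fun a => pd_hd hG hf i (vidx a)
  have e3 : ∀ a, vd a (hd G i g) y = _ := fun a => pd_hd hG hg i (vidx a)
  have cf : ∀ a c, pd (vidx a) (vd c f) y = pd (vidx c) (vd a f) y := fun a c => pd_pd_comm hf _ _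
  have cg : ∀ a c, pd (vidx a) (vd c g) y = pd (vidx c) (vd a g) y := fun a c => pd_pd_comm hg _ _
  have cf' : ∀ a, pd (vidx a) (pd (hidx i) f) y = pd (hidx i) (vd a f) y :=
    fun a => pd_pd_comm hf _ _
  have cg' : ∀ a, pd (vidx a) (pd (hidx i) g) y = pd (hidx i) (vd a g) y :=
    fun a => pd_pd_comm hg _ _
  have h0 := hp 0
  have h1 := hp 1
  have h2 := hp 2
  simp only [parCoeff, hd] at h0 h1 h2
  rw [pb, pb, hd]
  simp only [show ∀ a F, vd a F y = pd (vidx a) F y from fun _ _ => rfl] at e2 e3 h0 h1 h2 ⊢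
  simp only [e1, e2, e3, cf 1 0, cf 2 0, cf 2 1, cg 1 0, cg 2 0, cg 2 1, cf', cg']
  simp only [show ∀ a F, vd a F y = pd (vidx a) F y from fun _ _ => rfl]
  linear_combination
    (pd (vidx 1) f y * pd (vidx 2) g y - pd (vidx 2) f y * pd (vidx 1) g y) * h0 +
    (pd (vidx 2) f y * pd (vidx 0) g y - pd (vidx 0) f y * pd (vidx 2) g y) * h1 +
    (pd (vidx 0) f y * pd (vidx 1) g y - pd (vidx 1) f y * pd (vidx 0) g y) * h2

/-- The coefficients of the curvature of the connection. -/
def curv (G : Fin 2 → Fin 3 → E 5 → ℝ) (a : Fin 3) (y : E 5) : ℝ :=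
  hd G 0 (G 1 a) y - hd G 1 (G 0 a) y

/-- The base parts of the two horizontal fields commute, so the commutator is vertical; the sign is
negative because the lifts are ∂_i minus G_i^a ∂_a. -/
theorem hd_comm (hG : ∀ i a, ContDiffAt ℝ ∞ (G i a) y) (hf : ContDiffAt ℝ ∞ f y) :
    hd G 0 (hd G 1 f) y - hd G 1 (hd G 0 f) y =
      -(curv G 0 y * vd 0 f y + curv G 1 y * vd 1 f y + curv G 2 y * vd 2 f y) := by
  have e2 : ∀ i j, pd j (hd G i f) y = _ := fun i j => pd_hd hG hf i j
  have cf : ∀ a c, pd (vidx a) (vd c f) y = pd (vidx c) (vd a f) y := fun a c => pd_pd_comm hf _ _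
  have cf' : ∀ i a, pd (vidx a) (pd (hidx i) f) y = pd (hidx i) (vd a f) y :=
    fun i a => pd_pd_comm hf _ _
  have cf'' : pd (hidx 1) (pd (hidx 0) f) y = pd (hidx 0) (pd (hidx 1) f) y := pd_pd_comm hf _ _
  rw [hd, hd]
  simp only [show ∀ a F, vd a F y = pd (vidx a) F y from fun _ _ => rfl, curv, hd, e2,
    cf 1 0, cf 2 0, cf 2 1, cf', cf'']
  ring

/-- The fibre coordinates. -/
def coordFn (a : Fin 3) (y : E 5) : ℝ := y (vidx a)

theorem contDiffAt_coordFn (a : Fin 3) : ContDiffAt ℝ ∞ (coordFn a) y :=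
  (basisCov (vidx a)).contDiff.contDiffAt

theorem pd_coordFn (j : Fin 5) (a : Fin 3) : pd j (coordFn a) = fun _ => if vidx a = j then 1 else 0 := by
  funext z
  rw [pd, show fderiv ℝ (coordFn a) z = basisCov (vidx a) from (basisCov (vidx a)).fderiv,
    basisCov_apply, basisVec_apply]

theorem vd_coordFn (c a : Fin 3) : vd c (coordFn a) = fun _ => if a = c then 1 else 0 := by
  rw [vd, pd_coordFn]
  simp only [vidx_inj]

/-- Applying h_i to fibre coordinates returns the connection coefficients, which converts identities
between derivations into identities between coefficients. -/
theorem hd_coordFn (i : Fin 2) (a : Fin 3) : hd G i (coordFn a) = fun z => -G i a z := by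
  funext z
  rw [hd, pd_coordFn, vd_coordFn, vd_coordFn, vd_coordFn, if_neg (hidx_vidx i a).symm]
  fin_cases a <;> simp

/-- The components of Hamiltonian vector fields of the vertical bracket. -/
def ham (u : E 5 → ℝ) (b : Fin 3 → E 5 → ℝ) (f : E 5 → ℝ) (a : Fin 3) : E 5 → ℝ :=
  pb u b f (coordFn a)

theorem contDiffAt_ham (hu : ContDiffAt ℝ ∞ u y) (hb : ∀ a, ContDiffAt ℝ ∞ (b a) y)
    (hf : ContDiffAt ℝ ∞ f y) (a : Fin 3) : ContDiffAt ℝ ∞ (ham u b f a) y :=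
  contDiffAt_pb hu hb hf (contDiffAt_coordFn a)

theorem ham_zero : ham u b f 0 = fun z => u z * (b 1 z * vd 2 f z - b 2 z * vd 1 f z) := by
  funext z
  simp only [ham, pb, vd_coordFn]
  simp [-mul_eq_mul_left_iff]
  ring

theorem ham_one : ham u b f 1 = fun z => u z * (b 2 z * vd 0 f z - b 0 z * vd 2 f z) := by
  funext z
  simp only [ham, pb, vd_coordFn]
  simp [-mul_eq_mul_left_iff]
  ring

theorem ham_two : ham u b f 2 = fun z => u z * (b 0 z * vd 1 f z - b 1 z * vd 0 f z) := by
  funext z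
  simp only [ham, pb, vd_coordFn]
  simp [-mul_eq_mul_left_iff]
  ring

theorem pb_eq_ham (z : E 5) : pb u b f g z =
    ham u b f 0 z * vd 0 g z + ham u b f 1 z * vd 1 g z + ham u b f 2 z * vd 2 g z := by
  rw [ham_zero, ham_one, ham_two, pb]
  ring

theorem pb_swap (z : E 5) : pb u b g f z = -pb u b f g z := by
  rw [pb, pb]
  ring

end Calculus

/-! ### The Jacobi identity for a triple in coordinates -/

section Coordinates

variable {y : E 5} {f g h k u w m₀ m₁ c : E 5 → ℝ} {G : Fin 2 → Fin 3 → E 5 → ℝ}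
  {b : Fin 3 → E 5 → ℝ} {m : Fin 2 → E 5 → ℝ}

theorem vd_add (hf : ContDiffAt ℝ ∞ f y) (hg : ContDiffAt ℝ ∞ g y) (a : Fin 3) :
    vd a (fun z => f z + g z) y = vd a f y + vd a g y := pd_add hf hg _

theorem vd_mul (hf : ContDiffAt ℝ ∞ f y) (hg : ContDiffAt ℝ ∞ g y) (a : Fin 3) :
    vd a (fun z => f z * g z) y = vd a f y * g y + f y * vd a g y := pd_mul hf hg _

theorem hd_add (hf : ContDiffAt ℝ ∞ f y) (hg : ContDiffAt ℝ ∞ g y) (i : Fin 2) :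
    hd G i (fun z => f z + g z) y = hd G i f y + hd G i g y := by
  simp only [hd, pd_add hf hg, vd_add hf hg]
  ring

theorem hd_mul (hf : ContDiffAt ℝ ∞ f y) (hg : ContDiffAt ℝ ∞ g y) (i : Fin 2) :
    hd G i (fun z => f z * g z) y = hd G i f y * g y + f y * hd G i g y := by
  simp only [hd, pd_mul hf hg, vd_mul hf hg]
  ring

theorem hd_sub (hf : ContDiffAt ℝ ∞ f y) (hg : ContDiffAt ℝ ∞ g y) (i : Fin 2) :
    hd G i (fun z => f z - g z) y = hd G i f y - hd G i g y := by
  simp only [hd, vd, pd_sub hf hg]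
  ring

theorem pb_add (hf : ContDiffAt ℝ ∞ f y) (hg : ContDiffAt ℝ ∞ g y) :
    pb u b h (fun z => f z + g z) y = pb u b h f y + pb u b h g y := by
  simp only [pb, vd_add hf hg]
  ring

theorem pb_mul (hf : ContDiffAt ℝ ∞ f y) (hg : ContDiffAt ℝ ∞ g y) :
    pb u b h (fun z => f z * g z) y = pb u b h f y * g y + f y * pb u b h g y := by
  simp only [pb, vd_mul hf hg]
  ring

theorem pb_sub (hf : ContDiffAt ℝ ∞ f y) (hg : ContDiffAt ℝ ∞ g y) :
    pb u b h (fun z => f z - g z) y = pb u b h f y - pb u b h g y := by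
  simp only [pb, vd, pd_sub hf hg]
  ring

/-- The equations of a Poisson triple at a point of an adapted chart. -/
structure LocalTriple (u w : E 5 → ℝ) (G : Fin 2 → Fin 3 → E 5 → ℝ) (k : E 5 → ℝ)
    (b : Fin 3 → E 5 → ℝ) (y : E 5) : Prop where
  int : FibreIntegrable b y
  par : ∀ i a, k y * parCoeff u b G i a y = 0
  cur : ∀ a, w y * ham u b k a y + k y ^ 2 * curv G a y = 0

/-- The coordinate expression of the bracket of the bivector field of a triple. -/
def triBracket (u : E 5 → ℝ) (G : Fin 2 → Fin 3 → E 5 → ℝ) (α : E 5 → ℝ)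
    (b : Fin 3 → E 5 → ℝ) (f g : E 5 → ℝ) (y : E 5) : ℝ :=
  α y * (hd G 0 f y * hd G 1 g y - hd G 1 f y * hd G 0 g y) + pb u b f g y

theorem contDiffAt_triBracket {α : E 5 → ℝ} (hG : ∀ i a, ContDiffAt ℝ ∞ (G i a) y)
    (hu : ContDiffAt ℝ ∞ u y) (hb : ∀ a, ContDiffAt ℝ ∞ (b a) y) (hα : ContDiffAt ℝ ∞ α y)
    (hf : ContDiffAt ℝ ∞ f y) (hg : ContDiffAt ℝ ∞ g y) :
    ContDiffAt ℝ ∞ (triBracket u G α b f g) y := by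
  have h1 := contDiffAt_hd hG hf
  have h2 := contDiffAt_hd hG hg
  exact (hα.mul (((h1 0).mul (h2 1)).sub ((h1 1).mul (h2 0)))).add (contDiffAt_pb hu hb hf hg)

theorem hd_triBracket {α : E 5 → ℝ} (hG : ∀ i a, ContDiffAt ℝ ∞ (G i a) y)
    (hu : ContDiffAt ℝ ∞ u y) (hb : ∀ a, ContDiffAt ℝ ∞ (b a) y) (hα : ContDiffAt ℝ ∞ α y)
    (hf : ContDiffAt ℝ ∞ f y) (hg : ContDiffAt ℝ ∞ g y) (i : Fin 2) :
    hd G i (triBracket u G α b f g) y =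
      hd G i α y * (hd G 0 f y * hd G 1 g y - hd G 1 f y * hd G 0 g y) +
      α y * (hd G i (hd G 0 f) y * hd G 1 g y + hd G 0 f y * hd G i (hd G 1 g) y -
        (hd G i (hd G 1 f) y * hd G 0 g y + hd G 1 f y * hd G i (hd G 0 g) y)) +
      hd G i (pb u b f g) y := by
  have h1 := contDiffAt_hd hG hf
  have h2 := contDiffAt_hd hG hg
  have h3 := ((h1 0).mul (h2 1)).sub ((h1 1).mul (h2 0))
  refine (hd_add (f := fun z => α z * (hd G 0 f z * hd G 1 g z - hd G 1 f z * hd G 0 g z))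
    (hα.mul h3) (contDiffAt_pb hu hb hf hg) i).trans ?_
  rw [hd_mul hα h3, hd_sub ((h1 0).mul (h2 1)) ((h1 1).mul (h2 0)), hd_mul (h1 0) (h2 1),
    hd_mul (h1 1) (h2 0)]

theorem pb_triBracket {α : E 5 → ℝ} (hG : ∀ i a, ContDiffAt ℝ ∞ (G i a) y)
    (hu : ContDiffAt ℝ ∞ u y) (hb : ∀ a, ContDiffAt ℝ ∞ (b a) y) (hα : ContDiffAt ℝ ∞ α y)
    (hf : ContDiffAt ℝ ∞ f y) (hg : ContDiffAt ℝ ∞ g y) :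
    pb u b h (triBracket u G α b f g) y =
      pb u b h α y * (hd G 0 f y * hd G 1 g y - hd G 1 f y * hd G 0 g y) +
      α y * (pb u b h (hd G 0 f) y * hd G 1 g y + hd G 0 f y * pb u b h (hd G 1 g) y -
        (pb u b h (hd G 1 f) y * hd G 0 g y + hd G 1 f y * pb u b h (hd G 0 g) y)) +
      pb u b h (pb u b f g) y := by
  have h1 := contDiffAt_hd hG hf
  have h2 := contDiffAt_hd hG hg
  have h3 := ((h1 0).mul (h2 1)).sub ((h1 1).mul (h2 0))
  refine (pb_add (f := fun z => α z * (hd G 0 f z * hd G 1 g z - hd G 1 f z * hd G 0 g z))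
    (hα.mul h3) (contDiffAt_pb hu hb hf hg)).trans ?_
  rw [pb_mul hα h3, pb_sub ((h1 0).mul (h2 1)) ((h1 1).mul (h2 0)), pb_mul (h1 0) (h2 1),
    pb_mul (h1 1) (h2 0)]

/-- The bracket of a Poisson triple satisfies the Jacobi identity. -/
theorem LocalTriple.jacobi {α : E 5 → ℝ} (ht : LocalTriple u w G k b y)
    (hG : ∀ i a, ContDiffAt ℝ ∞ (G i a) y)
    (hu : ContDiffAt ℝ ∞ u y) (hb : ∀ a, ContDiffAt ℝ ∞ (b a) y) (hα : ContDiffAt ℝ ∞ α y)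
    (hw : ContDiffAt ℝ ∞ w y) (hw0 : w y ≠ 0) (hwv : ∀ a, vd a w y = 0)
    (hk : k =ᶠ[𝓝 y] fun z => w z * α z) (hf : ContDiffAt ℝ ∞ f y)
    (hg : ContDiffAt ℝ ∞ g y) (hh : ContDiffAt ℝ ∞ h y) :
    triBracket u G α b f (triBracket u G α b g h) y +
      triBracket u G α b g (triBracket u G α b h f) y +
      triBracket u G α b h (triBracket u G α b f g) y = 0 := by
  have hky : k y = w y * α y := hk.eq_of_nhds
  -- As k = w α with w nonzero, the equation multiplied by k also holds multiplied by α.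
  have hp : ∀ i a, α y * parCoeff u b G i a y = 0 := by
    intro i a
    have := ht.par i a
    rw [hky, mul_assoc] at this
    exact (mul_eq_zero.1 this).resolve_left hw0
  -- The curvature equation in invariant form, α² [h_0, h_1] = X_α; w passes through fibre
  -- derivatives because it is constant along the fibres.
  have hc : ∀ F : E 5 → ℝ, ContDiffAt ℝ ∞ F y →
      α y ^ 2 * (hd G 0 (hd G 1 F) y - hd G 1 (hd G 0 F) y) = pb u b α F y := by
    intro F hF
    have h1 : ∀ a, ham u b α a y + α y ^ 2 * curv G a y = 0 := by
      intro a
      have h2 := ht.cur a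
      have h3 : ham u b k a y = w y * ham u b α a y := by
        rw [ham, ham, pb_congr hk EventuallyEq.rfl, pb_swap, pb_mul hw hα]
        rw [pb_swap (f := coordFn a) (g := α)]
        simp only [pb, hwv]
        ring
      rw [h3, hky] at h2
      have h4 : w y ^ 2 * (ham u b α a y + α y ^ 2 * curv G a y) = 0 := by
        linear_combination h2
      exact (mul_eq_zero.1 h4).resolve_left (pow_ne_zero 2 hw0)
    rw [hd_comm hG hF, pb_eq_ham]
    linear_combination -vd 0 F y * h1 0 - vd 1 F y * h1 1 - vd 2 F y * h1 2
  have pf : ∀ F H : E 5 → ℝ, ContDiffAt ℝ ∞ F y → ContDiffAt ℝ ∞ H y → ∀ i,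
      α y * hd G i (pb u b F H) y = α y * (pb u b (hd G i F) H y + pb u b F (hd G i H) y) :=
    fun F H hF hH i => hd_pb hG hu hb hF hH i (hp i)
  have hJ := pb_jacobi ht.int hu hb hf hg hh
  rw [triBracket, triBracket, triBracket]
  simp only [hd_triBracket hG hu hb hα hf hg, hd_triBracket hG hu hb hα hg hh,
    hd_triBracket hG hu hb hα hh hf, pb_triBracket hG hu hb hα hf hg,
    pb_triBracket hG hu hb hα hg hh, pb_triBracket hG hu hb hα hh hf]
  have s1 := fun i => pb_swap (u := u) (b := b) (f := hd G i f) (g := g) y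
  have s2 := fun i => pb_swap (u := u) (b := b) (f := hd G i g) (g := h) y
  have s3 := fun i => pb_swap (u := u) (b := b) (f := hd G i h) (g := f) y
  have s4 := fun i => pb_swap (u := u) (b := b) (f := hd G i f) (g := h) y
  have s5 := fun i => pb_swap (u := u) (b := b) (f := hd G i g) (g := f) y
  have s6 := fun i => pb_swap (u := u) (b := b) (f := hd G i h) (g := g) y
  have s7 := pb_swap (u := u) (b := b) (f := α) (g := f) y
  have s8 := pb_swap (u := u) (b := b) (f := α) (g := g) y
  have s9 := pb_swap (u := u) (b := b) (f := α) (g := h) y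
  simp only [s1, s2, s3, s4, s5, s6, s7, s8, s9]
  have p1 := fun i => pf g h hg hh i
  have p2 := fun i => pf h f hh hf i
  have p3 := fun i => pf f g hf hg i
  simp only [s4, s5, s6] at p1 p2 p3
  -- The purely vertical terms cancel by the fibrewise Jacobi identity, those with one horizontal
  -- derivative of a bracket by the derivation property, and the commutators against the brackets
  -- with α by `hc`. Terms containing a horizontal derivative of α cancel cyclically.
  linear_combination hJ + hd G 0 f y * p1 1 - hd G 1 f y * p1 0 + hd G 0 g y * p2 1 -
    hd G 1 g y * p2 0 + hd G 0 h y * p3 1 - hd G 1 h y * p3 0 +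
    (hd G 0 g y * hd G 1 h y - hd G 1 g y * hd G 0 h y) * hc f hf +
    (hd G 0 h y * hd G 1 f y - hd G 1 h y * hd G 0 f y) * hc g hg +
    (hd G 0 f y * hd G 1 g y - hd G 1 f y * hd G 0 g y) * hc h hh

end Coordinates

/-! ### The gauge transformation in coordinates -/

section Gauge

variable {y : E 5} {f g k u w c : E 5 → ℝ} {G : Fin 2 → Fin 3 → E 5 → ℝ}
  {b : Fin 3 → E 5 → ℝ} {m : Fin 2 → E 5 → ℝ} {ε : ℝ}

/-- The components of the transformed connection. -/
def gaugeG (u : E 5 → ℝ) (G : Fin 2 → Fin 3 → E 5 → ℝ) (b : Fin 3 → E 5 → ℝ)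
    (m : Fin 2 → E 5 → ℝ) (ε : ℝ) (i : Fin 2) (a : Fin 3) (y : E 5) : ℝ :=
  G i a y - ε * ham u b (m i) a y

/-- The coordinate expression of `w ϰ_{μ,ε}`. -/
def gaugeF (u : E 5 → ℝ) (G : Fin 2 → Fin 3 → E 5 → ℝ) (b : Fin 3 → E 5 → ℝ)
    (m : Fin 2 → E 5 → ℝ) (ε : ℝ) (y : E 5) : ℝ :=
  hd G 0 (m 1) y - hd G 1 (m 0) y + ε * pb u b (m 0) (m 1) y

/-- The coordinate expression of `1 - ε κ (ϰ_{μ,ε} - c)`. -/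
def gaugeS (u w : E 5 → ℝ) (G : Fin 2 → Fin 3 → E 5 → ℝ) (k : E 5 → ℝ) (b : Fin 3 → E 5 → ℝ)
    (m : Fin 2 → E 5 → ℝ) (c : E 5 → ℝ) (ε : ℝ) (y : E 5) : ℝ :=
  1 - ε * k y * ((w y)⁻¹ * gaugeF u G b m ε y - c y)

/-- The transformed lifts are h_i + ε X_{m_i}; the remaining computations use the new connection
through this form. -/
theorem hd_gaugeG (i : Fin 2) (f : E 5 → ℝ) : hd (gaugeG u G b m ε) i f =
    fun z => hd G i f z + ε * pb u b (m i) f z := by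
  funext z
  rw [hd, hd, pb_eq_ham]
  simp only [gaugeG]
  ring

theorem hd_const_mul (hf : ContDiffAt ℝ ∞ f y) (r : ℝ) (i : Fin 2) :
    hd G i (fun z => r * f z) y = r * hd G i f y := by
  simp only [hd, vd, pd_mul contDiffAt_const hf, pd_const]
  ring

theorem contDiffAt_gaugeG (hu : ContDiffAt ℝ ∞ u y) (hb : ∀ a, ContDiffAt ℝ ∞ (b a) y)
    (hG : ∀ i a, ContDiffAt ℝ ∞ (G i a) y) (hm : ∀ i, ContDiffAt ℝ ∞ (m i) y) (i : Fin 2)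
    (a : Fin 3) : ContDiffAt ℝ ∞ (gaugeG u G b m ε i a) y :=
  (hG i a).sub (contDiffAt_const.mul (contDiffAt_ham hu hb (hm i) a))

theorem contDiffAt_gaugeF (hu : ContDiffAt ℝ ∞ u y) (hb : ∀ a, ContDiffAt ℝ ∞ (b a) y)
    (hG : ∀ i a, ContDiffAt ℝ ∞ (G i a) y) (hm : ∀ i, ContDiffAt ℝ ∞ (m i) y) :
    ContDiffAt ℝ ∞ (gaugeF u G b m ε) y :=
  ((contDiffAt_hd hG (hm 1) 0).sub (contDiffAt_hd hG (hm 0) 1)).add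
    (contDiffAt_const.mul (contDiffAt_pb hu hb (hm 0) (hm 1)))

/-- Expand [h_0 + ε X_{m_0}, h_1 + ε X_{m_1}] on a fibre coordinate. The mixed commutators are
Hamiltonian because the h_i are derivations, and the quadratic one is X_{{m_0, m_1}} by Jacobi;
together they give ε X_F. The factor k is needed since the derivation property holds only up to it.
-/
theorem curv_gaugeG (ht : LocalTriple u w G k b y) (hu : ContDiffAt ℝ ∞ u y)
    (hb : ∀ a, ContDiffAt ℝ ∞ (b a) y) (hG : ∀ i a, ContDiffAt ℝ ∞ (G i a) y)
    (hm : ∀ i, ContDiffAt ℝ ∞ (m i) y) (a : Fin 3) :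
    k y * (curv (gaugeG u G b m ε) a y - curv G a y + ε * ham u b (gaugeF u G b m ε) a y) = 0 := by
  have hx := contDiffAt_coordFn (y := y) a
  have hham := fun i => contDiffAt_ham hu hb (hm i) a
  have hεham := fun i => contDiffAt_const (c := ε) |>.mul (hham i)
  have h1 : ∀ i j, hd (gaugeG u G b m ε) i (gaugeG u G b m ε j a) y = hd G i (G j a) y -
      ε * hd G i (ham u b (m j) a) y + ε * (pb u b (m i) (G j a) y -
        ε * pb u b (m i) (pb u b (m j) (coordFn a)) y) := by
    intro i j
    have e1 := hd_sub (G := G) (hG j a) (hεham j) i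
    have e2 := pb_sub (u := u) (b := b) (h := m i) (hG j a) (hεham j)
    have e3 : pb u b (m i) (fun z => ε * ham u b (m j) a z) y =
        ε * pb u b (m i) (pb u b (m j) (coordFn a)) y := by
      rw [pb_mul contDiffAt_const (hham j)]
      simp only [pb, vd, pd_const, ham]
      ring
    rw [hd_const_mul (hham j)] at e1
    rw [e3] at e2
    rw [hd_gaugeG]
    exact congrArg₂ (fun s t => s + ε * t) e1 e2
  -- This is k [h_i, X_{m_j}] = k X_{h_i m_j}, tested on the fibre coordinate.
  have h2 : ∀ i j, k y * hd G i (ham u b (m j) a) y =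
      k y * (ham u b (hd G i (m j)) a y - pb u b (m j) (G i a) y) := by
    intro i j
    have e1 := hd_pb hG hu hb (hm j) hx i (ht.par i)
    have e2 : pb u b (m j) (fun z => -G i a z) y = -pb u b (m j) (G i a) y := by
      have e3 := pb_mul (u := u) (b := b) (h := m j) (contDiffAt_const (c := (-1 : ℝ))) (hG i a)
      simp only [neg_mul, one_mul] at e3
      rw [e3]
      simp only [pb, vd, pd_const]
      ring
    rw [hd_coordFn, e2] at e1
    rw [ham, e1, ham]
    ring
  have h3 : ham u b (gaugeF u G b m ε) a y = ham u b (hd G 0 (m 1)) a y -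
      ham u b (hd G 1 (m 0)) a y + ε * pb u b (pb u b (m 0) (m 1)) (coordFn a) y := by
    have hF : gaugeF u G b m ε = fun z => (hd G 0 (m 1) z - hd G 1 (m 0) z) +
      ε * pb u b (m 0) (m 1) z := rfl
    have c1 := contDiffAt_hd hG (hm 1) 0
    have c2 := contDiffAt_hd hG (hm 0) 1
    have c3 := contDiffAt_pb hu hb (hm 0) (hm 1)
    rw [ham, ham, ham, hF, pb_swap, pb_add (c1.sub c2) (contDiffAt_const.mul c3),
      pb_sub c1 c2, pb_mul contDiffAt_const c3, pb_swap (f := coordFn a) (g := hd G 0 (m 1)),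
      pb_swap (f := coordFn a) (g := hd G 1 (m 0)),
      pb_swap (f := coordFn a) (g := pb u b (m 0) (m 1))]
    simp only [pb, vd, pd_const]
    ring
  have hJ := pb_jacobi ht.int hu hb (hm 0) (hm 1) hx
  have s1 := pb_swap (u := u) (b := b) (f := pb u b (m 0) (m 1)) (g := coordFn a) y
  have s2 : pb u b (m 1) (pb u b (coordFn a) (m 0)) y =
      -pb u b (m 1) (pb u b (m 0) (coordFn a)) y := by
    have : pb u b (coordFn a) (m 0) = fun z => 0 - pb u b (m 0) (coordFn a) z := by
      funext z
      rw [pb_swap]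
      ring
    have hp : ContDiffAt ℝ ∞ (pb u b (m 0) (coordFn a)) y := hham 0
    rw [this, pb_sub contDiffAt_const hp]
    simp only [pb, vd, pd_const, ham]
    ring
  rw [s1, s2] at hJ
  rw [curv, curv, h1, h1, h3]
  linear_combination -ε * h2 0 1 + ε * h2 1 0 - k y * ε ^ 2 * hJ

/-- Hamiltonian fields preserve the bracket. In coefficients, the change is -ε u² ∂_a m_i times the
integrability expression, so equality holds exactly, with no factor κ. -/
theorem parCoeff_gaugeG (hb1 : FibreIntegrable b y) (hu : ContDiffAt ℝ ∞ u y)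
    (hb : ∀ a, ContDiffAt ℝ ∞ (b a) y) (hG : ∀ i a, ContDiffAt ℝ ∞ (G i a) y)
    (hm : ∀ i, ContDiffAt ℝ ∞ (m i) y) (i : Fin 2) (a : Fin 3) :
    parCoeff u b (gaugeG u G b m ε) i a y = parCoeff u b G i a y := by
  have h1 : ∀ j a, pd j (gaugeG u G b m ε i a) y = pd j (G i a) y -
      ε * pd j (ham u b (m i) a) y := by
    intro j a
    have hh := contDiffAt_ham hu hb (hm i) a
    refine (pd_sub (hG i a) (contDiffAt_const.mul hh) j).trans ?_
    rw [pd_mul contDiffAt_const hh, pd_const]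
    ring
  have h2 : ∀ j a, pd j (ham u b (m i) a) y = _ :=
    fun j a => pd_pb hu hb (hm i) (contDiffAt_coordFn a) j
  have cm : ∀ a c, pd (vidx a) (vd c (m i)) y = pd (vidx c) (vd a (m i)) y :=
    fun a c => pd_pd_comm (hm i) _ _
  have h3 : ∀ c a, vd c (gaugeG u G b m ε i a) y = _ := fun c a => h1 (vidx c) a
  simp only [parCoeff, hd_gaugeG, h3, h2, pb]
  simp only [vd_coordFn, pd_const, cm 1 0, cm 2 0, cm 2 1]
  simp only [vd, FibreIntegrable] at hb1 ⊢
  fin_cases a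
  · simp
    linear_combination (-ε * u y ^ 2 * pd (vidx 0) (m i) y) * hb1
  · simp
    linear_combination (-ε * u y ^ 2 * pd (vidx 1) (m i) y) * hb1
  · simp
    linear_combination (-ε * u y ^ 2 * pd (vidx 2) (m i) y) * hb1

/-- This is the derivative of the reciprocal of 1/k - ε (g/w - c), written so that zeros of k are
allowed. Derivatives of w disappear because w is constant along the fibres. -/
theorem vd_gaugeK (hw : ContDiffAt ℝ ∞ w y) (hw0 : w y ≠ 0) (hwv : ∀ a, vd a w y = 0)
    (hk : ContDiffAt ℝ ∞ k y) (hF : ContDiffAt ℝ ∞ g y) (hc : ContDiffAt ℝ ∞ c y)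
    (hs : 1 - ε * k y * ((w y)⁻¹ * g y - c y) ≠ 0) (a : Fin 3) :
    vd a (fun z => k z / (1 - ε * k z * ((w z)⁻¹ * g z - c z))) y =
      ((1 - ε * k y * ((w y)⁻¹ * g y - c y))⁻¹) ^ 2 *
        (vd a k y + ε * k y ^ 2 * ((w y)⁻¹ * vd a g y - vd a c y)) := by
  have hwi : ContDiffAt ℝ ∞ (fun z => (w z)⁻¹) y := hw.inv hw0
  have e0 : ContDiffAt ℝ ∞ (fun z => ε * k z) y := contDiffAt_const.mul hk
  have e1 : ContDiffAt ℝ ∞ (fun z => (w z)⁻¹ * g z - c z) y := (hwi.mul hF).sub hc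
  have e2 : ContDiffAt ℝ ∞ (fun z => 1 - ε * k z * ((w z)⁻¹ * g z - c z)) y :=
    contDiffAt_const.sub (e0.mul e1)
  have e3 : ContDiffAt ℝ ∞ (fun z => (1 - ε * k z * ((w z)⁻¹ * g z - c z))⁻¹) y := e2.inv hs
  have hwv' : pd (vidx a) w y = 0 := hwv a
  simp only [div_eq_mul_inv, vd]
  rw [pd_mul hk e3, pd_inv e2 hs, pd_sub contDiffAt_const (e0.mul e1), pd_mul e0 e1,
    pd_mul contDiffAt_const hk, pd_sub (hwi.mul hF) hc, pd_mul hwi hF, pd_inv hw hw0, pd_const,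
    pd_const, hwv']
  field_simp
  ring

/-- The gauge transformation of a Poisson triple is a Poisson triple. -/
theorem LocalTriple.gauge (ht : LocalTriple u w G k b y) (hu : ContDiffAt ℝ ∞ u y)
    (hw : ContDiffAt ℝ ∞ w y) (hw0 : w y ≠ 0) (hwv : ∀ a, vd a w y = 0)
    (hb : ∀ a, ContDiffAt ℝ ∞ (b a) y) (hG : ∀ i a, ContDiffAt ℝ ∞ (G i a) y)
    (hk : ContDiffAt ℝ ∞ k y) (hm : ∀ i, ContDiffAt ℝ ∞ (m i) y) (hc : ContDiffAt ℝ ∞ c y)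
    (hcb : ∀ a, ham u b c a y = 0) (hs : gaugeS u w G k b m c ε y ≠ 0) :
    LocalTriple u w (gaugeG u G b m ε) (fun z => k z / gaugeS u w G k b m c ε z) b y := by
  refine ⟨ht.int, fun i a => ?_, fun a => ?_⟩
  · rw [parCoeff_gaugeG ht.int hu hb hG hm, div_mul_eq_mul_div, ht.par, zero_div]
  · have hF := contDiffAt_gaugeF (ε := ε) hu hb hG hm
    have hv := fun a => vd_gaugeK hw hw0 hwv hk hF hc hs a
    have h1 := curv_gaugeG (ε := ε) ht hu hb hG hm a
    have h2 := ht.cur a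
    have h3 : ham u b (fun z => k z / gaugeS u w G k b m c ε z) a y =
        ((gaugeS u w G k b m c ε y)⁻¹) ^ 2 * (ham u b k a y + ε * k y ^ 2 *
          ((w y)⁻¹ * ham u b (gaugeF u G b m ε) a y - ham u b c a y)) := by
      rw [ham, ham, ham, ham, pb, pb, pb, pb]
      simp only [gaugeS, hv]
      ring
    rw [h3, hcb, div_pow, div_eq_mul_inv, ← inv_pow]
    have h4 : w y * (w y)⁻¹ = 1 := mul_inv_cancel₀ hw0
    -- After extraction of the squared reciprocal of the denominator, the new equation is the old
    -- one plus k times the curvature change, which compensates the derivative of F; the term with c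
    -- is already gone.
    linear_combination ((gaugeS u w G k b m c ε y)⁻¹) ^ 2 * (h2 + k y * h1 +
      ε * k y ^ 2 * ham u b (gaugeF u G b m ε) a y * h4)

end Gauge

/-! ### Exterior derivatives of vertical forms in coordinates -/

section ExtDeriv

/-- The arguments are constant vectors, so no Lie bracket term appears. -/
theorem extDeriv_one_form {n : ℕ} {σ : E n → Alt n 1} {y : E n} (h : ContDiffAt ℝ ∞ σ y)
    (x₀ x₁ : E n) : extDeriv σ y ![x₀, x₁] =
      fderiv ℝ (fun z => σ z ![x₁]) y x₀ - fderiv ℝ (fun z => σ z ![x₀]) y x₁ := by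
  rw [extDeriv_apply (h.differentiableAt (by simp)), Fin.sum_univ_two]
  have e0 : Fin.removeNth (0 : Fin 2) ![x₀, x₁] = ![x₁] := by
    funext i; fin_cases i; rfl
  have e1 : Fin.removeNth (1 : Fin 2) ![x₀, x₁] = ![x₀] := by
    funext i; fin_cases i; rfl
  simp [e0, e1]
  ring

theorem extDeriv_three_form {n : ℕ} {σ : E n → Alt n 3} {y : E n} (h : ContDiffAt ℝ ∞ σ y)
    (x₀ x₁ x₂ x₃ : E n) : extDeriv σ y ![x₀, x₁, x₂, x₃] =
      fderiv ℝ (fun z => σ z ![x₁, x₂, x₃]) y x₀ - fderiv ℝ (fun z => σ z ![x₀, x₂, x₃]) y x₁ +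
      fderiv ℝ (fun z => σ z ![x₀, x₁, x₃]) y x₂ - fderiv ℝ (fun z => σ z ![x₀, x₁, x₂]) y x₃ := by
  rw [extDeriv_apply (h.differentiableAt (by simp)), Fin.sum_univ_four]
  have e0 : Fin.removeNth (0 : Fin 4) ![x₀, x₁, x₂, x₃] = ![x₁, x₂, x₃] := by
    funext i; fin_cases i <;> rfl
  have e1 : Fin.removeNth (1 : Fin 4) ![x₀, x₁, x₂, x₃] = ![x₀, x₂, x₃] := by
    funext i; fin_cases i <;> rfl
  have e2 : Fin.removeNth (2 : Fin 4) ![x₀, x₁, x₂, x₃] = ![x₀, x₁, x₃] := by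
    funext i; fin_cases i <;> rfl
  have e3 : Fin.removeNth (3 : Fin 4) ![x₀, x₁, x₂, x₃] = ![x₀, x₁, x₂] := by
    funext i; fin_cases i <;> rfl
  simp [e0, e1, e2, e3]
  ring

variable {y : E 5} {f g k u v w : E 5 → ℝ} {G : Fin 2 → Fin 3 → E 5 → ℝ} {b : Fin 3 → E 5 → ℝ}

theorem fderiv_vidx (f : E 5 → ℝ) (y : E 5) (a : Fin 3) :
    fderiv ℝ f y (basisVec (vidx a)) = vd a f y := rfl

theorem fderiv_horDir (f : E 5 → ℝ) (y : E 5) (i : Fin 2) :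
    fderiv ℝ f y (horDir G i y) = hd G i f y := by
  rw [horDir, map_sub, map_sum, Fin.sum_univ_three]
  simp [hd, vd, pd]

/-- The vertical coframe of a connection in adapted coordinates. -/
def coframe (G : Fin 2 → Fin 3 → E 5 → ℝ) (a : Fin 3) (z : E 5) : Cov 5 :=
  basisCov (vidx a) + ∑ i, G i a z • basisCov (hidx i)

theorem coframe_apply (a : Fin 3) (z x : E 5) :
    coframe G a z x = x (vidx a) + (G 0 a z * x (hidx 0) + G 1 a z * x (hidx 1)) := by
  simp [coframe, basisCov_apply, Fin.sum_univ_two]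

theorem coframe_vidx (a c : Fin 3) (z : E 5) :
    coframe G a z (basisVec (vidx c)) = if a = c then 1 else 0 := by
  rw [coframe_apply]
  simp [basisVec_apply, vidx_inj, hidx_vidx]

theorem horDir_hidx (i j : Fin 2) (y : E 5) : horDir G i y (hidx j) = if j = i then 1 else 0 := by
  simp [horDir, basisVec_apply, hidx_vidx, hidx_inj]

theorem horDir_vidx (i : Fin 2) (a : Fin 3) (y : E 5) : horDir G i y (vidx a) = -G i a y := by
  simp [horDir, basisVec_apply, (hidx_vidx _ _).symm, vidx_inj]

/-- The horizontal vector is frozen at y while the coframe varies with z. The pairing vanishes at z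
= y, and its derivative there brings in the derivatives of the connection coefficients. -/
theorem coframe_horDir (a : Fin 3) (i : Fin 2) (z : E 5) :
    coframe G a z (horDir G i y) = G i a z - G i a y := by
  rw [coframe_apply, horDir_vidx, horDir_hidx, horDir_hidx]
  fin_cases i <;> simp <;> ring

theorem contDiffAt_coframe (hG : ∀ i a, ContDiffAt ℝ ∞ (G i a) y) (a : Fin 3) :
    ContDiffAt ℝ ∞ (coframe G a) y :=
  contDiffAt_const.add (ContDiffAt.sum fun i _ => (hG i a).smul contDiffAt_const)

section OneForm

variable {σ : E 5 → Alt 5 1} (hσ : ContDiffAt ℝ ∞ σ y)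
  (h : ∀ᶠ z in 𝓝 y, ∀ x, σ z ![x] = ∑ a, b a z * coframe G a z x)

include hσ h

theorem extDeriv_vertical_VV (a c : Fin 3) :
    extDeriv σ y ![basisVec (vidx a), basisVec (vidx c)] = vd a (b c) y - vd c (b a) y := by
  have e : ∀ a, (fun z => σ z ![basisVec (vidx a)]) =ᶠ[𝓝 y] b a := by
    intro a
    filter_upwards [h] with z hz
    rw [hz]
    simp [coframe_vidx]
  rw [extDeriv_one_form hσ, (e a).fderiv_eq, (e c).fderiv_eq]
  rfl

theorem extDeriv_vertical_HV (hG : ∀ i a, ContDiffAt ℝ ∞ (G i a) y)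
    (hb : ∀ a, ContDiffAt ℝ ∞ (b a) y) (i : Fin 2) (a : Fin 3) :
    extDeriv σ y ![horDir G i y, basisVec (vidx a)] = hd G i (b a) y -
      (b 0 y * vd a (G i 0) y + b 1 y * vd a (G i 1) y + b 2 y * vd a (G i 2) y) := by
  have e : (fun z => σ z ![basisVec (vidx a)]) =ᶠ[𝓝 y] b a := by
    filter_upwards [h] with z hz
    rw [hz]
    simp [coframe_vidx]
  have e' : (fun z => σ z ![horDir G i y]) =ᶠ[𝓝 y] fun z => b 0 z * (G i 0 z - G i 0 y) +
      b 1 z * (G i 1 z - G i 1 y) + b 2 z * (G i 2 z - G i 2 y) := by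
    filter_upwards [h] with z hz
    rw [hz]
    simp [coframe_horDir, Fin.sum_univ_three]
  have hd' : ∀ c, ContDiffAt ℝ ∞ (fun z => G i c z - G i c y) y :=
    fun c => (hG i c).sub contDiffAt_const
  have hm : ∀ c, ContDiffAt ℝ ∞ (fun z => b c z * (G i c z - G i c y)) y :=
    fun c => (hb c).mul (hd' c)
  rw [extDeriv_one_form hσ, e.fderiv_eq, e'.fderiv_eq, fderiv_horDir, fderiv_vidx, vd,
    pd_add ((hm 0).add (hm 1)) (hm 2), pd_add (hm 0) (hm 1), pd_mul (hb _) (hd' _),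
    pd_mul (hb _) (hd' _), pd_mul (hb _) (hd' _), pd_sub (hG _ _) contDiffAt_const,
    pd_sub (hG _ _) contDiffAt_const, pd_sub (hG _ _) contDiffAt_const]
  simp only [pd_const, vd]
  ring

end OneForm

/-- The determinant of `x` and two basis vectors. -/
def det₂ (a c : Fin 3) (x : Fin 3 → ℝ) : ℝ :=
  x 0 * ((if 1 = a then 1 else 0) * (if 2 = c then 1 else 0) -
    (if 2 = a then 1 else 0) * (if 1 = c then 1 else 0)) +
  x 1 * ((if 2 = a then 1 else 0) * (if 0 = c then 1 else 0) -
    (if 0 = a then 1 else 0) * (if 2 = c then 1 else 0)) +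
  x 2 * ((if 0 = a then 1 else 0) * (if 1 = c then 1 else 0) -
    (if 1 = a then 1 else 0) * (if 0 = c then 1 else 0))

section ThreeForm

variable {σ : E 5 → Alt 5 3} (hσ : ContDiffAt ℝ ∞ σ y)
  (h : ∀ᶠ z in 𝓝 y, σ z = v z • covWedge fun a => coframe G a z)
  (hv : ContDiffAt ℝ ∞ v y) (hG : ∀ i a, ContDiffAt ℝ ∞ (G i a) y)

include hσ h hv hG

theorem extDeriv_volume_VH (i : Fin 2) :
    extDeriv σ y ![basisVec (vidx 2), basisVec (vidx 1), basisVec (vidx 0), horDir G i y] =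
      hd G i v y - v y * (vd 0 (G i 0) y + vd 1 (G i 1) y + vd 2 (G i 2) y) := by
  have hδ : ∀ c, ContDiffAt ℝ ∞ (fun z => G i c z - G i c y) y :=
    fun c => (hG i c).sub contDiffAt_const
  have e0 : (fun z => σ z ![basisVec (vidx 1), basisVec (vidx 0), horDir G i y]) =ᶠ[𝓝 y]
      fun z => v z * -(G i 2 z - G i 2 y) := by
    filter_upwards [h] with z hz
    rw [hz, ContinuousAlternatingMap.smul_apply, covWedge_three]
    simp [coframe_vidx, coframe_horDir]
  have e1 : (fun z => σ z ![basisVec (vidx 2), basisVec (vidx 0), horDir G i y]) =ᶠ[𝓝 y]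
      fun z => v z * (G i 1 z - G i 1 y) := by
    filter_upwards [h] with z hz
    rw [hz, ContinuousAlternatingMap.smul_apply, covWedge_three]
    simp [coframe_vidx, coframe_horDir]
  have e2 : (fun z => σ z ![basisVec (vidx 2), basisVec (vidx 1), horDir G i y]) =ᶠ[𝓝 y]
      fun z => v z * -(G i 0 z - G i 0 y) := by
    filter_upwards [h] with z hz
    rw [hz, ContinuousAlternatingMap.smul_apply, covWedge_three]
    simp [coframe_vidx, coframe_horDir]
  have e3 : (fun z => σ z ![basisVec (vidx 2), basisVec (vidx 1), basisVec (vidx 0)]) =ᶠ[𝓝 y]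
      fun z => v z * -1 := by
    filter_upwards [h] with z hz
    rw [hz, ContinuousAlternatingMap.smul_apply, covWedge_three]
    simp [coframe_vidx]
  have hn : ∀ j c, pd j (fun z => -(G i c z - G i c y)) y = -pd j (G i c) y := by
    intro j c
    have := pd_sub (contDiffAt_const (c := (0 : ℝ))) (hδ c) j
    simp only [zero_sub, pd_const] at this
    rw [this, pd_sub (hG i c) contDiffAt_const, pd_const, sub_zero]
  rw [extDeriv_three_form hσ, e0.fderiv_eq, e1.fderiv_eq, e2.fderiv_eq, e3.fderiv_eq,
    fderiv_horDir, fderiv_vidx, fderiv_vidx, fderiv_vidx, vd, vd, vd,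
    pd_mul hv (hδ 2).neg, pd_mul hv (hδ 1), pd_mul hv (hδ 0).neg, hd_mul hv contDiffAt_const,
    hn, hn, pd_sub (hG i 1) contDiffAt_const]
  simp only [pd_const, vd, hd]
  ring

theorem extDeriv_volume_HH (a c : Fin 3) :
    extDeriv σ y ![horDir G 1 y, horDir G 0 y, basisVec (vidx a), basisVec (vidx c)] =
      -v y * det₂ a c fun d => curv G d y := by
  have hδ : ∀ i c, ContDiffAt ℝ ∞ (fun z => G i c z - G i c y) y :=
    fun i c => (hG i c).sub contDiffAt_const
  have e0 : ∀ i, (fun z => σ z ![horDir G i y, basisVec (vidx a), basisVec (vidx c)]) =ᶠ[𝓝 y]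
      fun z => v z * det₂ a c fun d => G i d z - G i d y := by
    intro i
    filter_upwards [h] with z hz
    rw [hz, ContinuousAlternatingMap.smul_apply, covWedge_three, det₂, smul_eq_mul]
    simp only [coframe_vidx, coframe_horDir, Matrix.cons_val]
    ring
  -- With two frozen horizontal arguments every term contains a product of two differences vanishing
  -- at y, so the first derivative is zero.
  have e1 : ∀ a, fderiv ℝ (fun z => σ z ![horDir G 1 y, horDir G 0 y, basisVec (vidx a)]) y = 0 := by
    intro a
    have : (fun z => σ z ![horDir G 1 y, horDir G 0 y, basisVec (vidx a)]) =ᶠ[𝓝 y]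
      fun z => v z * (((G 1 1 z - G 1 1 y) * (G 0 2 z - G 0 2 y) -
          (G 1 2 z - G 1 2 y) * (G 0 1 z - G 0 1 y)) * (if 0 = a then 1 else 0) +
        ((G 1 2 z - G 1 2 y) * (G 0 0 z - G 0 0 y) -
          (G 1 0 z - G 1 0 y) * (G 0 2 z - G 0 2 y)) * (if 1 = a then 1 else 0) +
        ((G 1 0 z - G 1 0 y) * (G 0 1 z - G 0 1 y) -
          (G 1 1 z - G 1 1 y) * (G 0 0 z - G 0 0 y)) * (if 2 = a then 1 else 0)) := by
      filter_upwards [h] with z hz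
      rw [hz, ContinuousAlternatingMap.smul_apply, covWedge_three, smul_eq_mul]
      simp only [coframe_vidx, coframe_horDir, Matrix.cons_val]
      ring
    have hp : ∀ c d, HasFDerivAt (fun z => (G 1 c z - G 1 c y) * (G 0 d z - G 0 d y))
        (0 : Cov 5) y := by
      intro c d
      have h1 := (diffAt_of_contDiffAt (hδ 1 c)).hasFDerivAt.mul
        (diffAt_of_contDiffAt (hδ 0 d)).hasFDerivAt
      exact h1.congr_fderiv (by simp)
    have h2 := (diffAt_of_contDiffAt hv).hasFDerivAt.mul
      (((((hp 1 2).sub (hp 2 1)).mul_const (if 0 = a then (1 : ℝ) else 0)).add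
      (((hp 2 0).sub (hp 0 2)).mul_const (if 1 = a then (1 : ℝ) else 0))).add
      (((hp 0 1).sub (hp 1 0)).mul_const (if 2 = a then (1 : ℝ) else 0)))
    rw [this.fderiv_eq]
    refine h2.fderiv.trans ?_
    simp
  -- The differences vanish at y, so the derivative of v does not contribute.
  have e2 : ∀ i j, hd G j (fun z => v z * det₂ a c fun d => G i d z - G i d y) y =
      v y * det₂ a c fun d => hd G j (G i d) y := by
    intro i j
    have h1 := fun d => (diffAt_of_contDiffAt (hG i d)).hasFDerivAt.sub_const (G i d y)
    have h2 := (diffAt_of_contDiffAt hv).hasFDerivAt.mul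
      ((((h1 0).mul_const ((if 1 = a then 1 else 0) * (if 2 = c then 1 else 0) -
    (if 2 = a then 1 else 0) * (if 1 = c then (1 : ℝ) else 0))).add
      ((h1 1).mul_const ((if 2 = a then 1 else 0) * (if 0 = c then 1 else 0) -
    (if 0 = a then 1 else 0) * (if 2 = c then (1 : ℝ) else 0)))).add
      ((h1 2).mul_const ((if 0 = a then 1 else 0) * (if 1 = c then 1 else 0) -
    (if 1 = a then 1 else 0) * (if 0 = c then (1 : ℝ) else 0))))
    rw [← fderiv_horDir]
    refine (congrArg (fun L : Cov 5 => L (horDir G j y)) h2.fderiv).trans ?_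
    simp only [add_apply, smul_apply, smul_eq_mul, Pi.add_apply, sub_self, zero_mul, add_zero,
      det₂, fderiv_horDir]
    ring
  rw [extDeriv_three_form hσ, e1, e1, (e0 0).fderiv_eq, (e0 1).fderiv_eq, fderiv_horDir,
    fderiv_horDir, e2, e2, zero_apply, zero_apply]
  simp only [det₂, curv]
  ring

end ThreeForm

end ExtDeriv

/-! ### Forms and connections in an adapted chart -/

section LocalGeometry

variable {M B : Type*} [TopologicalSpace M] [ChartedSpace (E 5) M] [TopologicalSpace B]
  [ChartedSpace (E 2) B] [IsManifold 𝓘(ℝ, E 5) ∞ M] [IsManifold 𝓘(ℝ, E 2) ∞ B]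

namespace IsAdaptedChart

variable {π : M → B} {b₀ : B} {e : OpenPartialHomeomorph M (E 5)} (he : IsAdaptedChart π b₀ e)
  (hπ : ContMDiff 𝓘(ℝ, E 5) 𝓘(ℝ, E 2) ∞ π) {γ : M → E 5 →L[ℝ] E 5} (hγ : IsSplitting π γ)
  {Ω : M → Alt 5 5} {ω₀ : B → Alt 2 2} {y : E 5}

include he

/-- The area coefficient is a function of the base coordinates alone, which is why its fibre
derivatives vanish. -/
theorem locW_eq (hy : y ∈ e.target) :
    locW π ω₀ b₀ e y = formIn (chartAt (E 2) b₀) ω₀ (baseProj y) basisVec := by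
  have h0 := he.mapsTo _ (e.map_target hy)
  rw [← he.base_chart hy]
  change _ = ω₀ ((chartAt (E 2) b₀).symm (chartAt (E 2) b₀ (π (e.symm y)))) _
  rw [(chartAt (E 2) b₀).left_inv h0]
  rfl

theorem eventually_locW (hy : y ∈ e.target) :
    locW π ω₀ b₀ e =ᶠ[𝓝 y] fun z => formIn (chartAt (E 2) b₀) ω₀ (baseProj z) basisVec := by
  filter_upwards [e.open_target.mem_nhds hy] with z hz
  exact he.locW_eq hz

theorem base_mem (hy : y ∈ e.target) : baseProj y ∈ (chartAt (E 2) b₀).target := by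
  rw [← he.base_chart hy]
  exact (chartAt (E 2) b₀).map_source (he.mapsTo _ (e.map_target hy))

theorem contDiffAt_baseW (hω : IsSmoothFormOn Set.univ ω₀) (hy : y ∈ e.target) :
    ContDiffAt ℝ ∞ (fun x => formIn (chartAt (E 2) b₀) ω₀ x basisVec) (baseProj y) :=
  (hω.contDiffAt isOpen_univ (isSmoothChart_chartAt b₀) (he.base_mem hy)
    (Set.mem_univ _)).alt_apply fun _ => contDiffAt_const

theorem contDiffAt_locW (hω : IsSmoothFormOn Set.univ ω₀) (hy : y ∈ e.target) :
    ContDiffAt ℝ ∞ (locW π ω₀ b₀ e) y :=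
  ContDiffAt.congr_of_eventuallyEq
    ((he.contDiffAt_baseW hω hy).comp y baseProj.contDiff.contDiffAt) (he.eventually_locW hy)

/-- Functions of the base coordinates are constant along the fibres. -/
theorem vd_comp_baseProj {f : E 2 → ℝ} (hf : ContDiffAt ℝ ∞ f (baseProj y)) (a : Fin 3) :
    vd a (fun z => f (baseProj z)) y = 0 := by
  have h := (hf.differentiableAt (by simp)).hasFDerivAt.comp y baseProj.hasFDerivAt
  rw [← fderiv_vidx]
  refine (congrArg (fun L : Cov 5 => L (basisVec (vidx a))) h.fderiv).trans ?_
  simp [baseProj_vidx]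

theorem vd_locW (hω : IsSmoothFormOn Set.univ ω₀) (hy : y ∈ e.target) (a : Fin 3) :
    vd a (locW π ω₀ b₀ e) y = 0 :=
  (vd_congr (he.eventually_locW hy) a).trans (he.vd_comp_baseProj (he.contDiffAt_baseW hω hy) a)

theorem contDiffAt_locOne {α : M → Alt 5 1} {U : Set M} (hα : IsSmoothFormOn U α) (hU : IsOpen U)
    (hy : y ∈ e.target) (hq : e.symm y ∈ U) (j : Fin 5) : ContDiffAt ℝ ∞ (locOne e α j) y := by
  have h := (hα.contDiffAt hU he.chart hy hq).alt_apply (v := fun _ _ => basisVec j)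
    fun _ => contDiffAt_const
  refine h.congr_of_eventuallyEq (Eventually.of_forall fun z => ?_)
  change toCov _ _ = α (e.symm z) fun _ => chartInvD e z (basisVec j)
  rw [toCov_apply]
  congr 1
  funext i
  fin_cases i
  rfl

theorem contDiffAt_locG (hs : IsSmoothEndoOn Set.univ γ) (hy : y ∈ e.target) (i : Fin 2)
    (a : Fin 3) : ContDiffAt ℝ ∞ (locG e γ i a) y :=
  (basisCov (vidx a)).contDiff.contDiffAt.comp y
    ((hs.contDiffAt isOpen_univ he.chart hy (Set.mem_univ _)).clm_apply contDiffAt_const)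

include hπ

theorem locW_ne_zero (hγ : IsSplitting π γ) (hω : ∀ x, ω₀ x ≠ 0) (hy : y ∈ e.target) :
    locW π ω₀ b₀ e y ≠ 0 :=
  (he.frame hπ hγ hy).base_ne_zero (hω _)

theorem locV_ne_zero (hγ : IsSplitting π γ) (hω : ∀ x, ω₀ x ≠ 0) (hΩ : ∀ p, Ω p ≠ 0)
    (hy : y ∈ e.target) : locV π Ω ω₀ b₀ e y ≠ 0 := by
  rw [← he.frame_vol hπ hγ hy]
  exact AdaptedFrame.vol_ne_zero _ (hω _) (hΩ _)

theorem contDiffAt_locV (hγ : IsSplitting π γ) (hΩs : IsSmoothFormOn Set.univ Ω)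
    (hωs : IsSmoothFormOn Set.univ ω₀) (hω : ∀ x, ω₀ x ≠ 0) (hy : y ∈ e.target) :
    ContDiffAt ℝ ∞ (locV π Ω ω₀ b₀ e) y := by
  have h1 := (hΩs.contDiffAt isOpen_univ he.chart hy (Set.mem_univ _)).alt_apply
    (v := fun j _ => basisVec j) fun _ => contDiffAt_const
  exact h1.div (he.contDiffAt_locW hωs hy) (he.locW_ne_zero hπ hγ hω hy)

include hγ

theorem endoIn_apply (hy : y ∈ e.target) (x : E 5) :
    endoIn e γ y x = ∑ a, coframe (locG e γ) a y x • basisVec (vidx a) := by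
  have h1 : endoIn e γ y x = ∑ a, (endoIn e γ y x (vidx a)) • basisVec (vidx a) := by
    conv_lhs => rw [sum_idx (endoIn e γ y x)]
    have : ∀ i, endoIn e γ y x (hidx i) = 0 := fun i => he.coord_eq_zero hπ hy ((hγ _).1 _) i
    simp [this]
  have h2 : ∀ c, endoIn e γ y (basisVec (vidx c)) = basisVec (vidx c) := by
    intro c
    change chartD e (e.symm y) (γ (e.symm y) (chartInvD e y (basisVec (vidx c)))) = _
    rw [(hγ _).2 _ (he.dProj_vidx hπ hy c), he.chart.chartD_chartInvD hy]
  rw [h1]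
  refine Finset.sum_congr rfl fun a _ => ?_
  congr 1
  rw [coframe_apply]
  conv_lhs => rw [sum_idx x]
  simp only [map_add, map_sum, map_smul, h2, Fin.sum_univ_two, Fin.sum_univ_three]
  fin_cases a <;> simp [basisVec_apply, locG, vidx] <;> ring

theorem frame_η (hy : y ∈ e.target) (a : Fin 3) (x : E 5) :
    (he.frame hπ hγ hy).η a (chartInvD e y x) = coframe (locG e γ) a y x := by
  change endoIn e γ y x (vidx a) = _
  rw [he.endoIn_apply hπ hγ hy]
  fin_cases a <;> simp [Fin.sum_univ_three, basisVec_apply, vidx]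

theorem contDiffAt_endoIn (hy : y ∈ e.target) (hG : ∀ i a, ContDiffAt ℝ ∞ (locG e γ i a) y) :
    ContDiffAt ℝ ∞ (endoIn e γ) y := by
  have h : endoIn e γ =ᶠ[𝓝 y] fun z => ∑ a, (coframe (locG e γ) a z).smulRight
      (basisVec (vidx a)) := by
    filter_upwards [e.open_target.mem_nhds hy] with z hz
    ext1 x
    rw [he.endoIn_apply hπ hγ hz]
    simp
  refine ContDiffAt.congr_of_eventuallyEq (ContDiffAt.sum fun a _ => ?_) h
  exact (contDiffAt_coframe hG a).smulRight contDiffAt_const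

theorem formIn_vertical {β : M → Alt 5 1} (hβ : ∀ q v, γ q v = 0 → toCov (β q) v = 0)
    (hy : y ∈ e.target) (x : E 5) :
    formIn e β y ![x] = ∑ a, locOne e β (vidx a) y * coframe (locG e γ) a y x := by
  have h1 : formIn e β y ![x] = toCov (β (e.symm y)) (chartInvD e y x) := by
    rw [toCov_apply]
    change β (e.symm y) _ = _
    congr 1
    funext i
    fin_cases i
    rfl
  have h2 := (he.frame hπ hγ hy).decomp (chartInvD e y x)
  rw [h1]
  conv_lhs => rw [h2]
  simp only [map_add, map_sum, map_smul, hβ _ _ ((he.frame hπ hγ hy).g_H _), he.frame_η hπ hγ hy,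
    smul_eq_mul, mul_zero, Finset.sum_const_zero, zero_add]
  exact Finset.sum_congr rfl fun a _ => mul_comm _ _

theorem formIn_omegaV (hω : ∀ x, ω₀ x ≠ 0) (hy : y ∈ e.target) :
    formIn e (omegaV π Ω ω₀ γ) y =
      locV π Ω ω₀ b₀ e y • covWedge fun a => coframe (locG e γ) a y := by
  ext x
  change omegaV π Ω ω₀ γ (e.symm y) (fun j => chartInvD e y (x j)) = _
  rw [(he.frame hπ hγ hy).omegaV_eq (hω _)]
  change (he.frame hπ hγ hy).vol Ω ω₀ * covWedge (he.frame hπ hγ hy).η _ = _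
  rw [he.frame_vol hπ hγ hy, covWedge_apply, ContinuousAlternatingMap.smul_apply, covWedge_apply]
  simp only [he.frame_η hπ hγ hy, smul_eq_mul]

theorem contDiffAt_formIn_omegaV (hω : ∀ x, ω₀ x ≠ 0) (hy : y ∈ e.target)
    (hΩs : IsSmoothFormOn Set.univ Ω) (hωs : IsSmoothFormOn Set.univ ω₀)
    (hG : ∀ i a, ContDiffAt ℝ ∞ (locG e γ i a) y) :
    ContDiffAt ℝ ∞ (formIn e (omegaV π Ω ω₀ γ)) y := by
  refine contDiffAt_of_basisVec fun f => ?_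
  have h : (fun z => formIn e (omegaV π Ω ω₀ γ) z fun i => basisVec (f i)) =ᶠ[𝓝 y]
      fun z => locV π Ω ω₀ b₀ e z * Matrix.det (Matrix.of fun i j =>
        coframe (locG e γ) j z (basisVec (f i))) := by
    filter_upwards [e.open_target.mem_nhds hy] with z hz
    rw [he.formIn_omegaV hπ hγ hω hz, ContinuousAlternatingMap.smul_apply, covWedge_apply,
      smul_eq_mul, ← Matrix.det_transpose]
    rfl
  refine ContDiffAt.congr_of_eventuallyEq ?_ h
  refine (he.contDiffAt_locV hπ hγ hΩs hωs hω hy).mul ?_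
  have hc : ∀ a j, ContDiffAt ℝ ∞ (fun z => coframe (locG e γ) a z (basisVec (f j))) y :=
    fun a j => (contDiffAt_coframe hG a).clm_apply contDiffAt_const
  simp only [Matrix.det_apply', Matrix.of_apply]
  exact ContDiffAt.sum fun s _ => contDiffAt_const.mul (contDiffAt_prod fun i _ => hc _ _)

end IsAdaptedChart

end LocalGeometry

/-! ### The tensor equations and their local form -/

section LocalEquations

variable {M B : Type*} [TopologicalSpace M] [ChartedSpace (E 5) M] [TopologicalSpace B]
  [ChartedSpace (E 2) B] [IsManifold 𝓘(ℝ, E 5) ∞ M] [IsManifold 𝓘(ℝ, E 2) ∞ B]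

/-- The coefficient of the vertical trivector field in an adapted chart. -/
def locU (π : M → B) (Ω : M → Alt 5 5) (ω₀ : B → Alt 2 2) (b₀ : B)
    (e : OpenPartialHomeomorph M (E 5)) (y : E 5) : ℝ := (locV π Ω ω₀ b₀ e y)⁻¹

/-- The local equations of a triple in an adapted chart. -/
def IsLocalTriple (π : M → B) (Ω : M → Alt 5 5) (ω₀ : B → Alt 2 2) (b₀ : B)
    (e : OpenPartialHomeomorph M (E 5)) (t : Triple M) (y : E 5) : Prop :=
  LocalTriple (locU π Ω ω₀ b₀ e) (locW π ω₀ b₀ e) (locG e t.γ) (t.κ ∘ e.symm)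
    (fun a => locOne e t.β (vidx a)) y

namespace IsAdaptedChart

variable {π : M → B} {b₀ : B} {e : OpenPartialHomeomorph M (E 5)} (he : IsAdaptedChart π b₀ e)
  (hπ : ContMDiff 𝓘(ℝ, E 5) 𝓘(ℝ, E 2) ∞ π) (hsub : ∀ p : M, Function.Surjective (dProj π p))
  {Ω : M → Alt 5 5} (hΩs : IsSmoothFormOn Set.univ Ω) (hΩ : ∀ p, Ω p ≠ 0)
  {ω₀ : B → Alt 2 2} (hωs : IsSmoothFormOn Set.univ ω₀) (hω : ∀ x, ω₀ x ≠ 0)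
  {t : Triple M} (hγ : IsSplitting π t.γ) (hs : IsSmoothEndoOn Set.univ t.γ)
  (hβ : ∀ q v, t.γ q v = 0 → toCov (t.β q) v = 0) (hβs : IsSmoothFormOn Set.univ t.β)
  {y : E 5}

include he

theorem extD_two {α : M → Alt 5 1} (hα : ContDiffAt ℝ ∞ (formIn e α) y) (hy : y ∈ e.target)
    (x₀ x₁ : E 5) : extD α (e.symm y) ![chartInvD e y x₀, chartInvD e y x₁] =
      extDeriv (formIn e α) y ![x₀, x₁] := by
  rw [← extD_apply_chart he.chart hy hα]
  congr 1
  funext i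
  fin_cases i <;> rfl

theorem extD_four {α : M → Alt 5 3} (hα : ContDiffAt ℝ ∞ (formIn e α) y) (hy : y ∈ e.target)
    (x₀ x₁ x₂ x₃ : E 5) : extD α (e.symm y) ![chartInvD e y x₀, chartInvD e y x₁,
      chartInvD e y x₂, chartInvD e y x₃] = extDeriv (formIn e α) y ![x₀, x₁, x₂, x₃] := by
  rw [← extD_apply_chart he.chart hy hα]
  congr 1
  funext i
  fin_cases i <;> rfl

include hπ hγ

theorem contDiffAt_locU (hΩs : IsSmoothFormOn Set.univ Ω) (hΩ : ∀ p, Ω p ≠ 0)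
    (hωs : IsSmoothFormOn Set.univ ω₀) (hω : ∀ x, ω₀ x ≠ 0) (hy : y ∈ e.target) :
    ContDiffAt ℝ ∞ (locU π Ω ω₀ b₀ e) y :=
  (he.contDiffAt_locV hπ hγ hΩs hωs hω hy).inv (he.locV_ne_zero hπ hγ hω hΩ hy)

include hsub hΩs hΩ hωs hω hs hβ hβs

/-- On the coordinate frame the components of dβ and dΩ^V are known explicitly. The first equation
becomes fibre integrability verbatim, the second differs from the parallelism equation by the factor
1/v, and the components of the third are those of the curvature equation up to sign and nonzero
factors v and w. -/
theorem localTriple_iff (hy : y ∈ e.target) (hκ : ContDiffAt ℝ ∞ (t.κ ∘ e.symm) y) :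
    (wedge (d01 t.γ t.β (e.symm y)) (t.β (e.symm y)) = 0 ∧
      t.κ (e.symm y) • (d10 t.γ t.β (e.symm y) -
        wedge (theta π Ω ω₀ t.γ (e.symm y)) (t.β (e.symm y))) = 0 ∧
      wedge (d01 t.γ (ofFun t.κ) (e.symm y)) (t.β (e.symm y)) -
        (t.κ (e.symm y)) ^ 2 • rhoForm π Ω ω₀ t.γ (e.symm y) = 0) ↔
      IsLocalTriple π Ω ω₀ b₀ e t y := by
  set F := he.frame hπ hγ hy with hF
  have hFr := exists_frame hπ hsub hγ
  have hG : ∀ i a, ContDiffAt ℝ ∞ (locG e t.γ i a) y := he.contDiffAt_locG hs hy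
  have hb : ∀ a, ContDiffAt ℝ ∞ (locOne e t.β (vidx a)) y := fun a =>
    he.contDiffAt_locOne hβs isOpen_univ hy (Set.mem_univ _) _
  have hv := he.contDiffAt_locV hπ hγ hΩs hωs hω hy
  have hv0 := he.locV_ne_zero hπ hγ hω hΩ hy
  have hw0 : locW π ω₀ b₀ e y ≠ 0 := he.locW_ne_zero hπ hγ hω hy
  have hβd : ContDiffAt ℝ ∞ (formIn e t.β) y :=
    hβs.contDiffAt isOpen_univ he.chart hy (Set.mem_univ _)
  have hΩd := he.contDiffAt_formIn_omegaV hπ hγ hω hy hΩs hωs hG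
  have hβf : ∀ᶠ z in 𝓝 y, ∀ x, formIn e t.β z ![x] =
      ∑ a, locOne e t.β (vidx a) z * coframe (locG e t.γ) a z x := by
    filter_upwards [e.open_target.mem_nhds hy] with z hz
    exact he.formIn_vertical hπ hγ hβ hz
  have hΩf : ∀ᶠ z in 𝓝 y, formIn e (omegaV π Ω ω₀ t.γ) z =
      locV π Ω ω₀ b₀ e z • covWedge fun a => coframe (locG e t.γ) a z := by
    filter_upwards [e.open_target.mem_nhds hy] with z hz
    exact he.formIn_omegaV hπ hγ hω hz
  have hVV : ∀ a c, extD t.β (e.symm y) ![F.V a, F.V c] = _ := fun a c =>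
    (he.extD_two hβd hy _ _).trans (extDeriv_vertical_VV hβd hβf a c)
  have hHV : ∀ i a, extD t.β (e.symm y) ![F.H i, F.V a] = _ := fun i a =>
    (he.extD_two hβd hy _ _).trans (extDeriv_vertical_HV hβd hβf hG hb i a)
  have hVH : ∀ i, extD (omegaV π Ω ω₀ t.γ) (e.symm y) ![F.V 2, F.V 1, F.V 0, F.H i] = _ := fun i =>
    (he.extD_four hΩd hy _ _ _ _).trans (extDeriv_volume_VH hΩd hΩf hv hG i)
  have hHH : ∀ a c, extD (omegaV π Ω ω₀ t.γ) (e.symm y) ![F.H 1, F.H 0, F.V a, F.V c] = _ :=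
    fun a c => (he.extD_four hΩd hy _ _ _ _).trans (extDeriv_volume_HH hΩd hΩf hv hG a c)
  have hκV : ∀ a, extD (ofFun t.κ) (e.symm y) ![F.V a] = vd a (t.κ ∘ e.symm) y := fun a =>
    extD_ofFun_apply_chart he.chart hy hκ _
  have hbV : ∀ a, toCov (t.β (e.symm y)) (F.V a) = locOne e t.β (vidx a) y := fun a => rfl
  have hvol : F.vol Ω ω₀ = locV π Ω ω₀ b₀ e y := he.frame_vol hπ hγ hy Ω ω₀
  have hwF : ω₀ (π (e.symm y)) F.C = locW π ω₀ b₀ e y := rfl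
  rw [eq1_iff F hFr hβ, eq2_iff F hFr hβ hω hΩ, eq3_iff F hFr hβ hω]
  simp only [hVV, hHV, hVH, hHH, hκV, hbV, hvol, hwF]
  have hhu : ∀ i, hd (locG e t.γ) i (locU π Ω ω₀ b₀ e) y =
      -((locV π Ω ω₀ b₀ e y)⁻¹ ^ 2 * hd (locG e t.γ) i (locV π Ω ω₀ b₀ e) y) := by
    intro i
    have : ∀ j, pd j (locU π Ω ω₀ b₀ e) y = _ := fun j => pd_inv hv hv0 j
    simp only [hd, vd, this]
    ring
  have hpar : ∀ i a, parCoeff (locU π Ω ω₀ b₀ e) (fun a => locOne e t.β (vidx a)) (locG e t.γ) i a y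
      = (locV π Ω ω₀ b₀ e y)⁻¹ * (hd (locG e t.γ) i (locOne e t.β (vidx a)) y -
        (locOne e t.β (vidx 0) y * vd a (locG e t.γ i 0) y +
          locOne e t.β (vidx 1) y * vd a (locG e t.γ i 1) y +
          locOne e t.β (vidx 2) y * vd a (locG e t.γ i 2) y) -
        (locV π Ω ω₀ b₀ e y)⁻¹ * (hd (locG e t.γ) i (locV π Ω ω₀ b₀ e) y -
          locV π Ω ω₀ b₀ e y * (vd 0 (locG e t.γ i 0) y + vd 1 (locG e t.γ i 1) y +
            vd 2 (locG e t.γ i 2) y)) * locOne e t.β (vidx a) y) := by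
    intro i a
    rw [parCoeff, hhu, locU]
    field_simp
    ring
  have hvi : (locV π Ω ω₀ b₀ e y)⁻¹ ≠ 0 := inv_ne_zero hv0
  constructor
  · rintro ⟨h1, h2, h3⟩
    refine ⟨h1, fun i a => ?_, fun a => ?_⟩
    · rw [hpar, ← mul_assoc, mul_comm (_ : ℝ) (locV π Ω ω₀ b₀ e y)⁻¹, mul_assoc]
      exact mul_eq_zero_of_right _ (h2 i a)
    -- A vertical 2-form in dimension three corresponds to a vector: the pairs (1,2), (2,0), (0,1)
    -- give its components 0, 1, 2.
    · have h12 := h3 1 2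
      have h20 := h3 2 0
      have h01 := h3 0 1
      simp only [det₂] at h12 h20 h01
      simp at h12 h20 h01
      fin_cases a
      · simp only [Fin.zero_eta, ham_zero, locU, Function.comp_apply]
        field_simp at h12 ⊢
        linear_combination -h12
      · simp only [Fin.mk_one, ham_one, locU, Function.comp_apply]
        field_simp at h20 ⊢
        linear_combination -h20
      · simp only [Fin.reduceFinMk, ham_two, locU, Function.comp_apply]
        field_simp at h01 ⊢
        linear_combination -h01
  · rintro ⟨h1, h2, h3⟩
    refine ⟨h1, fun i a => ?_, fun a c => ?_⟩
    · have h4 := h2 i a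
      rw [hpar, ← mul_assoc, mul_comm (_ : ℝ) (locV π Ω ω₀ b₀ e y)⁻¹, mul_assoc] at h4
      exact (mul_eq_zero.1 h4).resolve_left hvi
    · have h0 := h3 0
      have h1 := h3 1
      have h2 := h3 2
      simp only [ham_zero, ham_one, ham_two, locU, Function.comp_apply] at h0 h1 h2
      field_simp at h0 h1 h2
      simp only [det₂]
      -- Equal indices give a trivial identity; each remaining pair is, up to sign, one of the three
      -- vector components.
      fin_cases a <;> fin_cases c <;> simp <;> field_simp <;>
        first
        | ring1
        | linear_combination h0
        | linear_combination h1
        | linear_combination h2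
        | linear_combination -h0
        | linear_combination -h1
        | linear_combination -h2

end IsAdaptedChart

end LocalEquations

/-! ### The transformed connection -/

section GaugeGeometry

variable {M B : Type*} [TopologicalSpace M] [ChartedSpace (E 5) M] [TopologicalSpace B]
  [ChartedSpace (E 2) B]

/-- The regularity of a fibration with volume forms, a connection, a vertical and a horizontal
`1`-form. -/
structure GaugeData (π : M → B) (Ω : M → Alt 5 5) (ω₀ : B → Alt 2 2) (t : Triple M)
    (μ : M → Alt 5 1) : Prop where
  proj : ContMDiff 𝓘(ℝ, E 5) 𝓘(ℝ, E 2) ∞ π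
  subm : ∀ p : M, Function.Surjective (dProj π p)
  smooth_Ω : IsSmoothFormOn Set.univ Ω
  Ω_ne : ∀ p, Ω p ≠ 0
  smooth_base : IsSmoothFormOn Set.univ ω₀
  base_ne : ∀ x, ω₀ x ≠ 0
  split : IsSplitting π t.γ
  smooth_γ : IsSmoothEndoOn Set.univ t.γ
  vertical_β : ∀ q v, t.γ q v = 0 → toCov (t.β q) v = 0
  smooth_β : IsSmoothFormOn Set.univ t.β
  horizontal_μ : ∀ q v, dProj π q v = 0 → toCov (μ q) v = 0
  smooth_μ : IsSmoothFormOn Set.univ μ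

/-- The components of a horizontal `1`-form in an adapted chart. -/
def locM (e : OpenPartialHomeomorph M (E 5)) (μ : M → Alt 5 1) (i : Fin 2) : E 5 → ℝ :=
  locOne e μ (hidx i)

/-- The components of a vertical `1`-form in an adapted chart. -/
def locB (e : OpenPartialHomeomorph M (E 5)) (β : M → Alt 5 1) (a : Fin 3) : E 5 → ℝ :=
  locOne e β (vidx a)

/-- The components of the transformed connection in an adapted chart. -/
def locGauge (π : M → B) (Ω : M → Alt 5 5) (ω₀ : B → Alt 2 2) (b₀ : B)
    (e : OpenPartialHomeomorph M (E 5)) (t : Triple M) (μ : M → Alt 5 1) (ε : ℝ) :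
    Fin 2 → Fin 3 → E 5 → ℝ :=
  gaugeG (locU π Ω ω₀ b₀ e) (locG e t.γ) (locB e t.β) (locM e μ) ε

variable [IsManifold 𝓘(ℝ, E 5) ∞ M] [IsManifold 𝓘(ℝ, E 2) ∞ B]

namespace GaugeData

variable {π : M → B} {b₀ : B} {e : OpenPartialHomeomorph M (E 5)}
  {Ω : M → Alt 5 5} {ω₀ : B → Alt 2 2} {t : Triple M} {μ : M → Alt 5 1}
  (D : GaugeData π Ω ω₀ t μ) (he : IsAdaptedChart π b₀ e) {y : E 5} (hy : y ∈ e.target)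

include D

theorem frames (q : M) : Nonempty (AdaptedFrame (dProj π q) (t.γ q)) :=
  exists_frame D.proj D.subm D.split q

include he hy

theorem contDiffAt_G (i : Fin 2) (a : Fin 3) : ContDiffAt ℝ ∞ (locG e t.γ i a) y :=
  he.contDiffAt_locG D.smooth_γ hy i a

theorem contDiffAt_B (a : Fin 3) : ContDiffAt ℝ ∞ (locB e t.β a) y :=
  he.contDiffAt_locOne D.smooth_β isOpen_univ hy (Set.mem_univ _) _

theorem contDiffAt_M (i : Fin 2) : ContDiffAt ℝ ∞ (locM e μ i) y :=
  he.contDiffAt_locOne D.smooth_μ isOpen_univ hy (Set.mem_univ _) _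

theorem contDiffAt_U : ContDiffAt ℝ ∞ (locU π Ω ω₀ b₀ e) y :=
  he.contDiffAt_locU D.proj D.split D.smooth_Ω D.Ω_ne D.smooth_base D.base_ne hy

theorem contDiffAt_W : ContDiffAt ℝ ∞ (locW π ω₀ b₀ e) y := he.contDiffAt_locW D.smooth_base hy

theorem W_ne : locW π ω₀ b₀ e y ≠ 0 := he.locW_ne_zero D.proj D.split D.base_ne hy

theorem frame_volume (F : AdaptedFrame (dProj π (e.symm y)) (t.γ (e.symm y)))
    (hF : F = he.frame D.proj D.split hy) : (F.vol Ω ω₀)⁻¹ = locU π Ω ω₀ b₀ e y := by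
  rw [hF, he.frame_vol D.proj D.split hy]
  rfl

theorem mu_apply (x : E 5) :
    toCov (μ (e.symm y)) (chartInvD e y x) = ∑ i, locM e μ i y * x (hidx i) := by
  conv_lhs => rw [sum_idx x]
  simp only [map_add, map_sum, map_smul, D.horizontal_μ _ _ (he.dProj_vidx D.proj hy _)]
  simp only [smul_eq_mul, mul_zero, Finset.sum_const_zero, add_zero]
  exact Finset.sum_congr rfl fun i _ => mul_comm _ _

theorem formIn_mu (x : E 5) : formIn e μ y ![x] = ∑ i, locM e μ i y * x (hidx i) := by
  rw [← D.mu_apply he hy, toCov_apply]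
  change μ (e.symm y) _ = _
  congr 1
  funext i
  fin_cases i
  rfl

theorem extD_mu (x₀ x₁ : E 5) : extD μ (e.symm y) ![chartInvD e y x₀, chartInvD e y x₁] =
    fderiv ℝ (fun z => ∑ i, locM e μ i z * x₁ (hidx i)) y x₀ -
      fderiv ℝ (fun z => ∑ i, locM e μ i z * x₀ (hidx i)) y x₁ := by
  have h1 : ContDiffAt ℝ ∞ (formIn e μ) y :=
    D.smooth_μ.contDiffAt isOpen_univ he.chart hy (Set.mem_univ _)
  have h2 : ∀ x : E 5, (fun z => formIn e μ z ![x]) =ᶠ[𝓝 y]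
      fun z => ∑ i, locM e μ i z * x (hidx i) := by
    intro x
    filter_upwards [e.open_target.mem_nhds hy] with z hz
    exact D.formIn_mu he hz x
  rw [he.extD_two h1 hy, extDeriv_one_form h1, (h2 x₀).fderiv_eq, (h2 x₁).fderiv_eq]

theorem extD_mu_HH (i j : Fin 2) : extD μ (e.symm y) ![(he.frame D.proj D.split hy).H i,
    (he.frame D.proj D.split hy).H j] =
      hd (locG e t.γ) i (locM e μ j) y - hd (locG e t.γ) j (locM e μ i) y := by
  refine (D.extD_mu he hy _ _).trans ?_
  rw [fderiv_horDir, fderiv_horDir]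
  simp only [horDir_hidx, mul_ite, mul_one, mul_zero, Finset.sum_ite_eq', Finset.mem_univ, if_true]

theorem extD_mu_VH (a : Fin 3) (j : Fin 2) : extD μ (e.symm y) ![(he.frame D.proj D.split hy).V a,
    (he.frame D.proj D.split hy).H j] = vd a (locM e μ j) y := by
  refine (D.extD_mu he hy _ _).trans ?_
  rw [fderiv_horDir, fderiv_vidx]
  simp [horDir_hidx, basisVec_apply, hidx_vidx, hd, vd, pd]

theorem d01_mu (v : Fin 2 → E 5) :
    d01 t.γ μ (e.symm y) v = bideg (t.γ (e.symm y)) 1 (extD μ (e.symm y)) v :=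
  congrArg (fun α : Alt 5 2 => α v) (dPart_mu D.frames D.horizontal_μ 0 (e.symm y))

theorem d10_mu (v : Fin 2 → E 5) :
    d10 t.γ μ (e.symm y) v = bideg (t.γ (e.symm y)) 2 (extD μ (e.symm y)) v :=
  congrArg (fun α : Alt 5 2 => α v) (dPart_mu D.frames D.horizontal_μ 1 (e.symm y))

theorem d01_mu_HH (i j : Fin 2) : d01 t.γ μ (e.symm y) ![(he.frame D.proj D.split hy).H i,
    (he.frame D.proj D.split hy).H j] = 0 := by
  rw [D.d01_mu he hy, split_mem {0, 1} _
    (by intro i; fin_cases i <;> simp [(he.frame D.proj D.split hy).g_H]), if_neg (by simp)]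

theorem d01_mu_VV (a c : Fin 3) : d01 t.γ μ (e.symm y) ![(he.frame D.proj D.split hy).V a,
    (he.frame D.proj D.split hy).V c] = 0 := by
  rw [D.d01_mu he hy, split_mem ∅ _
    (by intro i; fin_cases i <;> simp [(he.frame D.proj D.split hy).g_V]), if_neg (by simp)]

theorem d01_mu_VH (a : Fin 3) (j : Fin 2) : d01 t.γ μ (e.symm y)
    ![(he.frame D.proj D.split hy).V a, (he.frame D.proj D.split hy).H j] =
      vd a (locM e μ j) y := by
  rw [D.d01_mu he hy, split_mem {1} _ (by
    intro i
    fin_cases i <;> simp [(he.frame D.proj D.split hy).g_H, (he.frame D.proj D.split hy).g_V]),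
    if_pos (by simp), D.extD_mu_VH he hy]

theorem shift_V (a : Fin 3) :
    connShift π Ω ω₀ μ t (e.symm y) (chartInvD e y (basisVec (vidx a))) = 0 :=
  AdaptedFrame.shift_V (he.frame D.proj D.split hy) (D.base_ne _) (D.Ω_ne _) μ
    (D.d01_mu_HH he hy) (D.d01_mu_VV he hy) a

/-- On a horizontal frame vector the 4 × 4 determinant reduces to u det(β, dm_i, ·) along the fibre
with a minus sign, that is, to minus the Hamiltonian field of m_i. -/
theorem shift_H (i : Fin 2) :
    connShift π Ω ω₀ μ t (e.symm y) (chartInvD e y (horDir (locG e t.γ) i y)) =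
      -∑ a, ham (locU π Ω ω₀ b₀ e) (locB e t.β) (locM e μ i) a y •
        chartInvD e y (basisVec (vidx a)) := by
  set F := he.frame D.proj D.split hy with hF
  have h1 : ∀ a : Cov 5, a (connShift π Ω ω₀ μ t (e.symm y) (F.H i)) =
      a (-∑ c, ham (locU π Ω ω₀ b₀ e) (locB e t.β) (locM e μ i) c y • F.V c) := by
    intro a
    rw [AdaptedFrame.shift_H F (D.base_ne _) (D.Ω_ne _) (D.vertical_β _) μ
      (D.d01_mu_HH he hy) (D.d01_mu_VV he hy), D.frame_volume he hy F hF, F.covWedge_evalAt]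
    have h2 : ∀ c, (∑ d, d01 t.γ μ (e.symm y) ![F.V d, F.H i] • F.η d) (F.V c) =
        vd c (locM e μ i) y := by
      intro c
      rw [sum_apply]
      simp only [smul_apply, F.η_V, smul_eq_mul, mul_ite, mul_one, mul_zero, Finset.sum_ite_eq',
        Finset.mem_univ, if_true]
      exact D.d01_mu_VH he hy c i
    have h3 : ∀ c, toCov (t.β (e.symm y)) (F.V c) = locB e t.β c y := fun _ => rfl
    rw [h2, h2, h2, h3, h3, h3, map_neg, map_sum, Fin.sum_univ_three, ham_zero, ham_one, ham_two]
    simp only [map_smul, smul_eq_mul]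
    ring
  change connShift π Ω ω₀ μ t (e.symm y) (F.H i) = -∑ c, _ • F.V c
  rw [vec_eq_sum (connShift π Ω ω₀ μ t (e.symm y) (F.H i))]
  simp only [h1]
  rw [← vec_eq_sum]

theorem shift_apply (x : E 5) :
    connShift π Ω ω₀ μ t (e.symm y) (chartInvD e y x) =
      -∑ i, x (hidx i) • ∑ a, ham (locU π Ω ω₀ b₀ e) (locB e t.β) (locM e μ i) a y •
        chartInvD e y (basisVec (vidx a)) := by
  have h1 : ∀ i, connShift π Ω ω₀ μ t (e.symm y) (chartInvD e y (basisVec (hidx i))) =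
      -∑ a, ham (locU π Ω ω₀ b₀ e) (locB e t.β) (locM e μ i) a y •
        chartInvD e y (basisVec (vidx a)) := by
    intro i
    rw [← D.shift_H he hy, horDir]
    simp [D.shift_V he hy]
  conv_lhs => rw [sum_idx x]
  simp only [map_add, map_sum, map_smul, D.shift_V he hy, h1, smul_zero, Finset.sum_const_zero,
    add_zero, smul_neg, Finset.sum_neg_distrib]

theorem shift_eq (v : E 5) : connShift π Ω ω₀ μ t (e.symm y) v =
      -∑ i, chartD e (e.symm y) v (hidx i) •
        ∑ a, ham (locU π Ω ω₀ b₀ e) (locB e t.β) (locM e μ i) a y •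
          chartInvD e y (basisVec (vidx a)) := by
  rw [← D.shift_apply he hy, he.chart.chartInvD_chartD hy]

end GaugeData

namespace GaugeData

variable {π : M → B} {b₀ : B} {e : OpenPartialHomeomorph M (E 5)}
  {Ω : M → Alt 5 5} {ω₀ : B → Alt 2 2} {t : Triple M} {μ : M → Alt 5 1}
  (D : GaugeData π Ω ω₀ t μ) (ε : ℝ)

include D

/-- The shift has vertical values and kills vertical vectors, so adding any multiple of it to a
projector onto the vertical bundle gives another one. -/
theorem split_famConn : IsSplitting π (famConn π Ω ω₀ μ t ε) := by
  intro p
  obtain ⟨e, he, hp⟩ := exists_adapted_chart D.proj D.subm p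
  obtain ⟨y, hy, rfl⟩ : ∃ y ∈ e.target, p = e.symm y :=
    ⟨e p, e.map_source hp, (e.left_inv hp).symm⟩
  have h1 := D.shift_eq he hy
  refine ⟨fun v => ?_, fun v hv => ?_⟩
  · change dProj π (e.symm y) (t.γ (e.symm y) v + ε • connShift π Ω ω₀ μ t (e.symm y) v) = 0
    rw [h1, map_add, map_smul, (D.split _).1]
    simp [he.dProj_vidx D.proj hy]
  · change t.γ (e.symm y) v + ε • connShift π Ω ω₀ μ t (e.symm y) v = v
    rw [h1, (D.split _).2 _ hv]
    simp [he.coord_eq_zero D.proj hy hv]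

theorem locG_famConn (he : IsAdaptedChart π b₀ e) {y : E 5} (hy : y ∈ e.target) (i : Fin 2)
    (a : Fin 3) : locG e (famConn π Ω ω₀ μ t ε) i a y = locGauge π Ω ω₀ b₀ e t μ ε i a y := by
  have h1 : endoIn e (famConn π Ω ω₀ μ t ε) y (basisVec (hidx i)) =
      endoIn e t.γ y (basisVec (hidx i)) + ε • chartD e (e.symm y)
        (connShift π Ω ω₀ μ t (e.symm y) (chartInvD e y (basisVec (hidx i)))) := by
    simp [endoIn, famConn]
  have h2 : chartD e (e.symm y)
      (connShift π Ω ω₀ μ t (e.symm y) (chartInvD e y (basisVec (hidx i)))) (vidx a) =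
      -ham (locU π Ω ω₀ b₀ e) (locB e t.β) (locM e μ i) a y := by
    rw [D.shift_apply he hy]
    simp [he.chart.chartD_chartInvD hy, basisVec_apply, hidx_inj, vidx_inj]
  rw [locGauge, gaugeG, locG, h1, PiLp.add_apply, PiLp.smul_apply, h2, locG, smul_eq_mul]
  ring

theorem smooth_famConn : IsSmoothEndoOn Set.univ (famConn π Ω ω₀ μ t ε) := by
  refine isSmoothEndoOn_of_charts fun q _ => ?_
  obtain ⟨e, he, hq⟩ := exists_adapted_chart D.proj D.subm q
  refine ⟨e, he.chart, hq, he.contDiffAt_endoIn D.proj (D.split_famConn ε) (e.map_source hq) ?_⟩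
  intro i a
  have h : locG e (famConn π Ω ω₀ μ t ε) i a =ᶠ[𝓝 (e q)]
      locGauge π Ω ω₀ (π q) e t μ ε i a := by
    filter_upwards [e.open_target.mem_nhds (e.map_source hq)] with z hz
    exact D.locG_famConn ε he hz i a
  have hy := e.map_source hq
  exact (contDiffAt_gaugeG (D.contDiffAt_U he hy) (D.contDiffAt_B he hy) (D.contDiffAt_G he hy)
    (D.contDiffAt_M he hy) i a).congr_of_eventuallyEq h

/-- The form `β` annihilates the kernels of the connections of the family. -/
theorem vertical_beta_famConn (q : M) (v : E 5) (hv : famConn π Ω ω₀ μ t ε q v = 0) :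
    toCov (t.β q) v = 0 := by
  obtain ⟨e, he, hp⟩ := exists_adapted_chart D.proj D.subm q
  obtain ⟨y, hy, rfl⟩ : ∃ y ∈ e.target, q = e.symm y :=
    ⟨e q, e.map_source hp, (e.left_inv hp).symm⟩
  have h1 : toCov (t.β (e.symm y)) (t.γ (e.symm y) v) = toCov (t.β (e.symm y)) v := by
    have h2 : t.γ (e.symm y) (v - t.γ (e.symm y) v) = 0 := by
      rw [map_sub, (D.split _).2 _ ((D.split _).1 _), sub_self]
    have h3 := D.vertical_β _ _ h2
    rw [map_sub, sub_eq_zero] at h3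
    exact h3.symm
  have h4 : t.γ (e.symm y) v + ε • connShift π Ω ω₀ μ t (e.symm y) v = 0 := hv
  -- The form β annihilates Hamiltonian fields, as det(b, dm, b) = 0. Hence β(γ_ε v) = β(v).
  have h5 : toCov (t.β (e.symm y)) (connShift π Ω ω₀ μ t (e.symm y) v) = 0 := by
    rw [D.shift_eq he hy]
    have h6 : ∀ a, toCov (t.β (e.symm y)) (chartInvD e y (basisVec (vidx a))) =
      locB e t.β a y := fun _ => rfl
    simp only [map_neg, map_sum, map_add, map_smul, h6, Fin.sum_univ_three, ham_zero, ham_one, ham_two,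
      smul_eq_mul]
    rw [Finset.sum_eq_zero fun i _ => by ring, neg_zero]
  have h7 := congrArg (toCov (t.β (e.symm y))) h4
  rwa [map_add, map_smul, h5, h1, map_zero, smul_zero, add_zero] at h7

/-- Makes every chart computation available for the transformed connection. The function κ is
arbitrary, since the regularity data do not mention it. -/
theorem gauged (κ : M → ℝ) :
    GaugeData π Ω ω₀ ⟨famConn π Ω ω₀ μ t ε, κ, t.β⟩ μ :=
  ⟨D.proj, D.subm, D.smooth_Ω, D.Ω_ne, D.smooth_base, D.base_ne, D.split_famConn ε,
    D.smooth_famConn ε, D.vertical_beta_famConn ε, D.smooth_β, D.horizontal_μ, D.smooth_μ⟩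

end GaugeData

end GaugeGeometry

/-! ### The function ϰ in an adapted chart -/

section Curvature

variable {M B : Type*} [TopologicalSpace M] [ChartedSpace (E 5) M] [TopologicalSpace B]
  [ChartedSpace (E 2) B]

/-- The components of the coordinate fields of the preferred chart at `b` with respect to those of
the preferred chart at `b₀`, as functions of the coordinates of the latter chart. -/
def baseTrans (b₀ b : B) (i j : Fin 2) (x : E 2) : ℝ :=
  basisCov j (fderiv ℝ (chartAt (E 2) b₀ ∘ (chartAt (E 2) b).symm)
    ((chartAt (E 2) b ∘ (chartAt (E 2) b₀).symm) x) (basisVec i))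

variable [IsManifold 𝓘(ℝ, E 5) ∞ M] [IsManifold 𝓘(ℝ, E 2) ∞ B]

theorem contDiffAt_baseTrans {b₀ b : B} {x : E 2} (hx : x ∈ (chartAt (E 2) b₀).target)
    (hq : (chartAt (E 2) b₀).symm x ∈ (chartAt (E 2) b).source) (i j : Fin 2) :
    ContDiffAt ℝ ∞ (baseTrans b₀ b i j) x := by
  have h1 := (isSmoothChart_chartAt (n := 2) b).contDiffAt_transition (isSmoothChart_chartAt b₀) hx hq
  have h2 := (isSmoothChart_chartAt (n := 2) b₀).contDiffAt_transition (isSmoothChart_chartAt b)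
    (y := chartAt (E 2) b ((chartAt (E 2) b₀).symm x)) ((chartAt (E 2) b).map_source hq)
    (by rw [(chartAt (E 2) b).left_inv hq]; exact (chartAt (E 2) b₀).map_target hx)
  refine (basisCov j).contDiff.contDiffAt.comp x (ContDiffAt.clm_apply ?_ contDiffAt_const)
  exact ContDiffAt.comp x (g := fderiv ℝ (chartAt (E 2) b₀ ∘ (chartAt (E 2) b).symm))
    (h2.fderiv_right (m := ∞) (by simp)) h1

namespace GaugeData

variable {π : M → B} {b₀ : B} {e : OpenPartialHomeomorph M (E 5)}
  {Ω : M → Alt 5 5} {ω₀ : B → Alt 2 2} {t : Triple M} {μ : M → Alt 5 1}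
  (D : GaugeData π Ω ω₀ t μ) (he : IsAdaptedChart π b₀ e) {y : E 5} (hy : y ∈ e.target)

include D he hy

/-- `braceForm` uses the preferred chart at π p, the adapted chart that at b₀; the Jacobian between
the two base charts mediates. -/
theorem coordField_eq {b : B} (hb : π (e.symm y) ∈ (chartAt (E 2) b).source) (i : Fin 2) :
    coordField b i (π (e.symm y)) =
      ∑ j, baseTrans b₀ b i j (baseProj y) • coordField b₀ j (π (e.symm y)) := by
  have h0 := he.mapsTo _ (e.map_target hy)
  have hC := isSmoothChart_chartAt (n := 2) b
  have hC₀ := isSmoothChart_chartAt (n := 2) b₀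
  have h1 := he.base_decomp hy (coordField b i (π (e.symm y)))
  have h2 : ∀ j, basisCov j (chartD (chartAt (E 2) b₀) (π (e.symm y))
      (coordField b i (π (e.symm y)))) = baseTrans b₀ b i j (baseProj y) := by
    intro j
    have h3 := hC₀.chartD_transition hC ((chartAt (E 2) b).map_source hb)
      (by rwa [(chartAt (E 2) b).left_inv hb])
    have h4 := hC.chartD_chartInvD ((chartAt (E 2) b).map_source hb) (basisVec i)
    rw [(chartAt (E 2) b).left_inv hb] at h3 h4
    change basisCov j (chartD (chartAt (E 2) b₀) (π (e.symm y))
      (chartInvD (chartAt (E 2) b) (chartAt (E 2) b (π (e.symm y))) (basisVec i))) = _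
    rw [h3, ContinuousLinearMap.comp_apply, h4, baseTrans, ← he.base_chart hy, Function.comp_apply,
      (chartAt (E 2) b₀).left_inv h0]
  simp only [h2] at h1
  exact h1

theorem mu_horLift {b : B} (hb : π (e.symm y) ∈ (chartAt (E 2) b).source) (i : Fin 2) :
    toCov (μ (e.symm y)) (horLift π t.γ (e.symm y) (coordField b i (π (e.symm y)))) =
      baseTrans b₀ b i 0 (baseProj y) * locM e μ 0 y +
        baseTrans b₀ b i 1 (baseProj y) * locM e μ 1 y := by
  set F := he.frame D.proj D.split hy with hF
  have h1 : ∀ j, toCov (μ (e.symm y)) (F.H j) = locM e μ j y := by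
    intro j
    refine (D.mu_apply he hy _).trans ?_
    simp [horDir_hidx]
  have h2 : ∀ j, horLift π t.γ (e.symm y) (coordField b₀ j (π (e.symm y))) = F.H j := F.horLift_C
  rw [D.coordField_eq he hy hb, Fin.sum_univ_two, map_add, map_smul, map_smul, h2, h2, map_add,
    map_smul, map_smul, h1, h1, smul_eq_mul, smul_eq_mul]

theorem betaBracket_eq {f g : M → ℝ} (hf : ContDiffAt ℝ ∞ (f ∘ e.symm) y)
    (hg : ContDiffAt ℝ ∞ (g ∘ e.symm) y) : betaBracket π Ω ω₀ t f g (e.symm y) =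
      pb (locU π Ω ω₀ b₀ e) (locB e t.β) (f ∘ e.symm) (g ∘ e.symm) y := by
  set F := he.frame D.proj D.split hy with hF
  have h1 : ∀ c, toCov (t.β (e.symm y)) (F.V c) = locB e t.β c y := fun _ => rfl
  have h2 : ∀ c, dFun f (e.symm y) (F.V c) = vd c (f ∘ e.symm) y := fun c =>
    dFun_apply_chart he.chart hy hf _
  have h3 : ∀ c, dFun g (e.symm y) (F.V c) = vd c (g ∘ e.symm) y := fun c =>
    dFun_apply_chart he.chart hy hg _
  rw [betaBracket, F.QV_eq (D.base_ne _) (D.Ω_ne _), ContinuousAlternatingMap.smul_apply,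
    F.covWedge_evalAt, D.frame_volume he hy F hF]
  simp only [h1, h2, h3, pb, smul_eq_mul]
  ring

/-- The value of `{μ ∧ μ}_β` on the horizontal lifts of the coordinate fields. -/
theorem braceForm_HH : braceForm π Ω ω₀ t μ μ (e.symm y) ![(he.frame D.proj D.split hy).H 0,
    (he.frame D.proj D.split hy).H 1] =
      2 * pb (locU π Ω ω₀ b₀ e) (locB e t.β) (locM e μ 0) (locM e μ 1) y := by
  set F := he.frame D.proj D.split hy with hF
  set b := π (e.symm y) with hb
  have hbs : b ∈ (chartAt (E 2) b).source := mem_chart_source _ b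
  have hbx : (chartAt (E 2) b₀).symm (baseProj y) = b := by
    rw [← he.base_chart hy, (chartAt (E 2) b₀).left_inv (he.mapsTo _ (e.map_target hy))]
  have hJ : ∀ i j, ContDiffAt ℝ ∞ (baseTrans b₀ b i j) (baseProj y) := fun i j =>
    contDiffAt_baseTrans (he.base_mem hy) (by rwa [hbx]) i j
  have hJ' : ∀ i j, ContDiffAt ℝ ∞ (fun z => baseTrans b₀ b i j (baseProj z)) y := fun i j =>
    (hJ i j).comp y baseProj.contDiff.contDiffAt
  have hm := D.contDiffAt_M he hy
  have hf : ∀ i, (fun q => toCov (μ q) (horLift π t.γ q (coordField b i (π q)))) ∘ e.symm =ᶠ[𝓝 y]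
      fun z => baseTrans b₀ b i 0 (baseProj z) * locM e μ 0 z +
        baseTrans b₀ b i 1 (baseProj z) * locM e μ 1 z := by
    intro i
    have hev : ∀ᶠ z in 𝓝 y, π (e.symm z) ∈ (chartAt (E 2) b).source :=
      (D.proj.continuous.continuousAt.comp (e.continuousAt_symm hy)).eventually
        ((chartAt (E 2) b).open_source.mem_nhds hbs)
    filter_upwards [e.open_target.mem_nhds hy, hev] with z hz hz'
    exact D.mu_horLift he hz hz' i
  have hfs : ∀ i, ContDiffAt ℝ ∞ (fun z => baseTrans b₀ b i 0 (baseProj z) * locM e μ 0 z +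
        baseTrans b₀ b i 1 (baseProj z) * locM e μ 1 z) y := fun i =>
    ((hJ' i 0).mul (hm 0)).add ((hJ' i 1).mul (hm 1))
  -- The Jacobian entries are functions on the base, so fibre derivatives see only the components of
  -- μ.
  have hvd : ∀ i a, vd a ((fun q => toCov (μ q) (horLift π t.γ q (coordField b i (π q)))) ∘ e.symm) y =
      baseTrans b₀ b i 0 (baseProj y) * vd a (locM e μ 0) y +
        baseTrans b₀ b i 1 (baseProj y) * vd a (locM e μ 1) y := by
    intro i a
    rw [vd_congr (hf i), vd_add ((hJ' i 0).mul (hm 0)) ((hJ' i 1).mul (hm 1)),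
      vd_mul (hJ' i 0) (hm 0), vd_mul (hJ' i 1) (hm 1), he.vd_comp_baseProj (hJ i 0),
      he.vd_comp_baseProj (hJ i 1)]
    ring
  have hbr : ∀ i j, betaBracket π Ω ω₀ t
      (fun q => toCov (μ q) (horLift π t.γ q (coordField b i (π q))))
      (fun q => toCov (μ q) (horLift π t.γ q (coordField b j (π q)))) (e.symm y) =
      (baseTrans b₀ b i 0 (baseProj y) * baseTrans b₀ b j 1 (baseProj y) -
        baseTrans b₀ b i 1 (baseProj y) * baseTrans b₀ b j 0 (baseProj y)) *
        pb (locU π Ω ω₀ b₀ e) (locB e t.β) (locM e μ 0) (locM e μ 1) y := by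
    intro i j
    rw [D.betaBracket_eq he hy ((hfs i).congr_of_eventuallyEq (hf i))
      ((hfs j).congr_of_eventuallyEq (hf j)), pb, pb]
    simp only [hvd]
    ring
  have hL : ∀ i k, toCov (coordForm π (e.symm y) i) (F.H k) =
      basisCov i (chartD (chartAt (E 2) b) b (coordField b₀ k b)) := by
    intro i k
    change basisCov i (chartD (chartAt (E 2) b) b (dProj π (e.symm y) (F.H k))) = _
    rw [F.P_H]
    rfl
  have hJL : ∀ i l, baseTrans b₀ b i 0 (baseProj y) *
      basisCov l (chartD (chartAt (E 2) b) b (coordField b₀ 0 b)) +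
      baseTrans b₀ b i 1 (baseProj y) *
      basisCov l (chartD (chartAt (E 2) b) b (coordField b₀ 1 b)) = if l = i then 1 else 0 := by
    intro i l
    have h1 := (isSmoothChart_chartAt (n := 2) b).chartD_chartInvD
      ((chartAt (E 2) b).map_source hbs) (basisVec i)
    rw [(chartAt (E 2) b).left_inv hbs] at h1
    have h2 : chartD (chartAt (E 2) b) b (coordField b i b) = basisVec i := h1
    rw [D.coordField_eq he hy hbs, Fin.sum_univ_two, map_add, map_smul, map_smul] at h2
    have h3 := congrArg (basisCov l) h2
    rw [map_add, map_smul, map_smul, smul_eq_mul, smul_eq_mul, basisCov_apply l (basisVec i),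
      basisVec_apply] at h3
    exact h3
  have h00 := hJL 0 0
  have h01 := hJL 0 1
  have h10 := hJL 1 0
  have h11 := hJL 1 1
  simp only [if_true, one_ne_zero, zero_ne_one, if_false] at h00 h01 h10 h11
  change (∑ i : Fin 2, ∑ j : Fin 2, betaBracket π Ω ω₀ t _ _ (e.symm y) •
    wedge (coordForm π (e.symm y) i) (coordForm π (e.symm y) j) : Alt 5 2) _ = _
  simp only [Fin.sum_univ_two, ContinuousAlternatingMap.add_apply,
    ContinuousAlternatingMap.smul_apply, wedge_one_one, ← hb, hbr]
  simp only [Matrix.cons_val_zero, Matrix.cons_val_one, hL, smul_eq_mul]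
  generalize basisCov 0 (chartD (chartAt (E 2) b) b (coordField b₀ 0 b)) = l00 at *
  generalize basisCov 0 (chartD (chartAt (E 2) b) b (coordField b₀ 1 b)) = l01 at *
  generalize basisCov 1 (chartD (chartAt (E 2) b) b (coordField b₀ 0 b)) = l10 at *
  generalize basisCov 1 (chartD (chartAt (E 2) b) b (coordField b₀ 1 b)) = l11 at *
  generalize baseTrans b₀ b 0 0 (baseProj y) = j00 at *
  generalize baseTrans b₀ b 0 1 (baseProj y) = j01 at *
  generalize baseTrans b₀ b 1 0 (baseProj y) = j10 at *
  generalize baseTrans b₀ b 1 1 (baseProj y) = j11 at *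
  -- The bracket contributes the determinant of one Jacobian and the coordinate forms that of its
  -- inverse, so the choice of base chart cancels. The factor 2 comes from the two orders of the
  -- index pair, and is offset by ε/2 in ϰ.
  have hdet : (j00 * j11 - j01 * j10) * (l00 * l11 - l01 * l10) = 1 := by
    have h : (j00 * j11 - j01 * j10) * (l00 * l11 - l01 * l10) =
        (j00 * l00 + j01 * l01) * (j10 * l10 + j11 * l11) -
          (j00 * l10 + j01 * l11) * (j10 * l00 + j11 * l01) := by ring
    rw [h, h00, h11, h01, h10]
    ring
  linear_combination 2 * pb (locU π Ω ω₀ b₀ e) (locB e t.β) (locM e μ 0) (locM e μ 1) y * hdet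

theorem braceForm_V (x : E 5) (a : Fin 3) : braceForm π Ω ω₀ t μ μ (e.symm y)
    ![x, (he.frame D.proj D.split hy).V a] = 0 := by
  have h1 : ∀ i, toCov (coordForm π (e.symm y) i) ((he.frame D.proj D.split hy).V a) = 0 := by
    intro i
    change basisCov i (chartD _ _ (dProj π (e.symm y) ((he.frame D.proj D.split hy).V a))) = 0
    rw [(he.frame D.proj D.split hy).P_V, map_zero, map_zero]
  change (∑ i : Fin 2, ∑ j : Fin 2, betaBracket π Ω ω₀ t _ _ (e.symm y) •
    wedge (coordForm π (e.symm y) i) (coordForm π (e.symm y) j) : Alt 5 2) _ = _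
  simp only [Fin.sum_univ_two, ContinuousAlternatingMap.add_apply,
    ContinuousAlternatingMap.smul_apply, wedge_one_one]
  simp [h1]

/-- The function `ϰ_{μ,ε}` in an adapted chart. -/
theorem varkappa_eq (ε : ℝ) : varkappa π Ω ω₀ μ ε t (e.symm y) = (locW π ω₀ b₀ e y)⁻¹ *
    gaugeF (locU π Ω ω₀ b₀ e) (locG e t.γ) (locB e t.β) (locM e μ) ε y := by
  set F := he.frame D.proj D.split hy with hF
  set N : Alt 5 2 := d10 t.γ μ (e.symm y) + (ε / 2) • braceForm π Ω ω₀ t μ μ (e.symm y) with hN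
  have hw : locW π ω₀ b₀ e y ≠ 0 := D.W_ne he hy
  have hwF : ω₀ (π (e.symm y)) F.C = locW π ω₀ b₀ e y := rfl
  have hval : ∀ x z, N ![x, z] = d10 t.γ μ (e.symm y) ![x, z] +
      ε / 2 * braceForm π Ω ω₀ t μ μ (e.symm y) ![x, z] := fun _ _ => rfl
  have h10 : N ![F.H 0, F.H 1] =
      gaugeF (locU π Ω ω₀ b₀ e) (locG e t.γ) (locB e t.β) (locM e μ) ε y := by
    rw [hval, D.braceForm_HH he hy, D.d10_mu he hy, split_mem {0, 1} _
      (by intro i; fin_cases i <;> simp [F.g_H]), if_pos (by simp), D.extD_mu_HH he hy, gaugeF]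
    ring
  have hV : ∀ x a, t.γ (e.symm y) x = 0 ∨ t.γ (e.symm y) x = x → N ![x, F.V a] = 0 := by
    intro x a hx
    rw [hval, D.braceForm_V he hy, D.d10_mu he hy, mul_zero, add_zero]
    rcases hx with hx | hx
    · rw [split_mem {0} _ (by intro i; fin_cases i <;> simp [F.g_V, hx]), if_neg (by simp)]
    · rw [split_mem ∅ _ (by intro i; fin_cases i <;> simp [F.g_V, hx]), if_neg (by simp)]
  -- The numerator has no component with a vertical argument, so it is a multiple of Ω^H; this
  -- existence gives the chosen quotient its meaning, and Ω^H ≠ 0 makes it unique.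
  have hex : N = ((locW π ω₀ b₀ e y)⁻¹ *
      gaugeF (locU π Ω ω₀ b₀ e) (locG e t.γ) (locB e t.β) (locM e μ) ε y) •
        omegaH π ω₀ (e.symm y) := by
    rw [F.omegaH_eq, smul_smul, hwF, mul_right_comm, inv_mul_cancel₀ hw, one_mul, ← h10]
    refine F.two_form_ext (fun i j => ?_) (fun i a => ?_) (fun a c => ?_)
    · rw [ContinuousAlternatingMap.smul_apply, covWedge_two]
      have hz : ∀ x, N ![x, x] = 0 := fun x => N.map_eq_zero_of_eq _ (i := 0) (j := 1) rfl (by decide)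
      fin_cases i <;> fin_cases j <;> simp [F.h_H, hz]
      exact AdaptedFrame.alt_two_swap _ _ _
    · rw [hV _ _ (Or.inl (F.g_H i)), ContinuousAlternatingMap.smul_apply, covWedge_two]
      simp [F.h_V]
    · rw [hV _ _ (Or.inr (F.g_V a)), ContinuousAlternatingMap.smul_apply, covWedge_two]
      simp [F.h_V]
  have hspec := Classical.epsilon_spec (p := fun r : ℝ => N = r • omegaH π ω₀ (e.symm y)) ⟨_, hex⟩
  have huniq := hspec.symm.trans hex
  have h2 := congrArg (fun α : Alt 5 2 => α F.H) huniq
  have hne : omegaH π ω₀ (e.symm y) F.H ≠ 0 := by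
    rw [F.omegaH_eq, ContinuousAlternatingMap.smul_apply, F.covWedge_h_H, smul_eq_mul, mul_one]
    exact hw
  simp only [ContinuousAlternatingMap.smul_apply, smul_eq_mul] at h2
  exact mul_right_cancel₀ hne h2

theorem famDenom_eq (c : M → ℝ) (ε : ℝ) : famDenom π Ω ω₀ μ c t ε (e.symm y) =
    gaugeS (locU π Ω ω₀ b₀ e) (locW π ω₀ b₀ e) (locG e t.γ) (t.κ ∘ e.symm) (locB e t.β)
      (locM e μ) (c ∘ e.symm) ε y := by
  rw [famDenom, D.varkappa_eq he hy]
  rfl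

end GaugeData

end Curvature

/-! ### Dependence on germs only -/

section Coordinates

variable {y : E 5} {k k' u w f g f' g' α : E 5 → ℝ} {G G' : Fin 2 → Fin 3 → E 5 → ℝ}
  {b : Fin 3 → E 5 → ℝ}

/-- The coordinate formulas for the transformed triple hold only on the chart's target, so its local
equations are transferred along equality near y. -/
theorem LocalTriple.congr (ht : LocalTriple u w G k b y) (hG : ∀ i a, G' i a =ᶠ[𝓝 y] G i a)
    (hk : k' =ᶠ[𝓝 y] k) : LocalTriple u w G' k' b y := by
  have h1 : ∀ i a, G' i a y = G i a y := fun i a => (hG i a).eq_of_nhds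
  have h2 : ∀ i f, hd G' i f y = hd G i f y := fun i f => by simp only [hd, h1]
  have h3 : ∀ c i a, vd c (G' i a) y = vd c (G i a) y := fun c i a => vd_congr (hG i a) c
  have h4 : ∀ j i a, hd G j (G' i a) y = hd G j (G i a) y := fun j i a => hd_congr (hG i a) j
  refine ⟨ht.int, fun i a => ?_, fun a => ?_⟩
  · have := ht.par i a
    rw [parCoeff] at this ⊢
    simpa only [h1, h2, h3, hk.eq_of_nhds] using this
  · have := ht.cur a
    rw [curv, ham] at this ⊢
    simp only [h2, h4, hk.eq_of_nhds]
    rwa [pb_congr hk EventuallyEq.rfl]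

theorem triBracket_congr (hf : f =ᶠ[𝓝 y] f') (hg : g =ᶠ[𝓝 y] g') :
    triBracket u G α b f g y = triBracket u G α b f' g' y := by
  simp only [triBracket, hd_congr hf, hd_congr hg, pb_congr hf hg]

end Coordinates

/-! ### Conjugation by the rescalings -/

section Rescaling

variable {M B : Type*} [TopologicalSpace M] [ChartedSpace (E 5) M] [TopologicalSpace B]
  [ChartedSpace (E 2) B] (π : M → B) (Ω : M → Alt 5 5) (ω₀ : B → Alt 2 2) (μ : M → Alt 5 1)
  (t : Triple M) (ε : ℝ)

theorem betaBracket_rescale (f g : M → ℝ) (p : M) :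
    betaBracket π Ω ω₀ (rescale ε t) f g p = ε * betaBracket π Ω ω₀ t f g p := by
  have h := (QV π Ω ω₀ t.γ p).map_update_smul ![toCov (t.β p), dFun f p, dFun g p] 0 ε
    (toCov (t.β p))
  have h1 : ∀ x, Function.update ![toCov (t.β p), dFun f p, dFun g p] 0 x =
      ![x, dFun f p, dFun g p] := by
    intro x
    funext i
    fin_cases i <;> rfl
  rw [h1, h1, smul_eq_mul] at h
  change -QV π Ω ω₀ t.γ p ![ε • toCov (t.β p), dFun f p, dFun g p] = _
  rw [h, betaBracket, mul_neg]

/-- The bracket is linear in β and d_{1,0} μ does not involve β, so replacing β by ε β turns the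
coefficient 1/2 into ε/2. -/
theorem varkappa_rescale (p : M) :
    varkappa π Ω ω₀ μ 1 (rescale ε t) p = varkappa π Ω ω₀ μ ε t p := by
  have h : ∀ q, braceForm π Ω ω₀ (rescale ε t) μ μ q = ε • braceForm π Ω ω₀ t μ μ q := by
    intro q
    simp only [braceForm, betaBracket_rescale, Finset.smul_sum, smul_smul]
    rfl
  simp only [varkappa, ratio, h, smul_smul]
  rw [one_div_mul_eq_div]
  rfl

set_option maxRecDepth 20000 in
theorem connShift_apply (p : M) (X : E 5) : connShift π Ω ω₀ μ t p X =
    toVec (iotaForm (l := 1) (wedge (d01 t.γ μ p) (t.β p))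
      (wedge (QV π Ω ω₀ t.γ p) (ofVec X) : MV 5 (3 + 1))) := rfl

theorem connShift_rescale (p : M) :
    connShift π Ω ω₀ μ (rescale ε t) p = ε • connShift π Ω ω₀ μ t p := by
  ext1 X
  have hγ : (rescale ε t).γ = t.γ := rfl
  have hβ : (rescale ε t).β p = ε • t.β p := rfl
  have hV : ∀ Z : MV 5 1, toVec (ε • Z) = ε • toVec Z := fun Z => by
    simp only [toVec, ContinuousAlternatingMap.smul_apply, smul_assoc, ← Finset.smul_sum]
  rw [smul_apply, connShift_apply, connShift_apply, hγ, hβ, wedge_smul_right, iotaForm_smul_left,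
    hV]

/-- The family is conjugate to the gauge transformation by the rescalings. -/
theorem rescale_gaugeTransf (c : M → ℝ) (hε : ε ≠ 0) :
    rescale (1 / ε) (gaugeTransf π Ω ω₀ μ c (rescale ε t)) = famTriple π Ω ω₀ μ c t ε := by
  ext1
  · funext p
    change t.γ p + connShift π Ω ω₀ μ (rescale ε t) p = _
    rw [connShift_rescale]
    rfl
  · funext p
    change 1 / ε * (ε * t.κ p / (1 - ε * t.κ p * (varkappa π Ω ω₀ μ 1 (rescale ε t) p - c p))) =
      t.κ p / (1 - ε * t.κ p * (varkappa π Ω ω₀ μ ε t p - c p))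
    rw [varkappa_rescale]
    field_simp
  · funext p
    change (1 / ε) • ε • t.β p = t.β p
    rw [smul_smul, one_div_mul_cancel hε, one_smul]

end Rescaling

/-! ### The bivector field of a triple and its bracket -/

section TripleTensor

variable {M B : Type*} [TopologicalSpace M] [ChartedSpace (E 5) M] [TopologicalSpace B]
  [ChartedSpace (E 2) B]

/-- The bivector field of a triple in an adapted frame. -/
theorem AdaptedFrame.tripleTensor_apply {π : M → B} {Ω : M → Alt 5 5} {ω₀ : B → Alt 2 2}
    {t : Triple M} {p : M} (F : AdaptedFrame (dProj π p) (t.γ p)) (hω : ω₀ (π p) ≠ 0)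
    (hΩ : Ω p ≠ 0) (a c : Cov 5) : tripleTensor π Ω ω₀ t p ![a, c] =
      t.κ p * ((ω₀ (π p) F.C)⁻¹ * (a (F.H 0) * c (F.H 1) - a (F.H 1) * c (F.H 0))) +
      (F.vol Ω ω₀)⁻¹ * (toCov (t.β p) (F.V 0) * (a (F.V 1) * c (F.V 2) - a (F.V 2) * c (F.V 1)) +
        toCov (t.β p) (F.V 1) * (a (F.V 2) * c (F.V 0) - a (F.V 0) * c (F.V 2)) +
        toCov (t.β p) (F.V 2) * (a (F.V 0) * c (F.V 1) - a (F.V 1) * c (F.V 0))) := by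
  rw [tripleTensor, ContinuousAlternatingMap.sub_apply, ContinuousAlternatingMap.smul_apply,
    F.horMV_apply hω, F.iotaForm_QV_apply hω hΩ, F.covWedge_evalAt, smul_eq_mul]
  ring

variable [IsManifold 𝓘(ℝ, E 5) ∞ M] [IsManifold 𝓘(ℝ, E 2) ∞ B]

namespace GaugeData

variable {π : M → B} {b₀ : B} {e : OpenPartialHomeomorph M (E 5)}
  {Ω : M → Alt 5 5} {ω₀ : B → Alt 2 2} {t : Triple M} {μ : M → Alt 5 1}
  (D : GaugeData π Ω ω₀ t μ)

include D

theorem isAlmostCouplingOn (U : Set M) :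
    IsAlmostCouplingOn π U t.γ (tripleTensor π Ω ω₀ t) := by
  intro p _ a c ha hc
  obtain ⟨F⟩ := D.frames p
  rw [F.tripleTensor_apply (D.base_ne _) (D.Ω_ne _), ha _ (F.P_V 0), ha _ (F.P_V 1),
    ha _ (F.P_V 2), hc _ (F.g_H 0), hc _ (F.g_H 1)]
  ring

variable (he : IsAdaptedChart π b₀ e) {y : E 5} (hy : y ∈ e.target)

include he hy

theorem tripleTensor_apply (a c : Cov 5) : tripleTensor π Ω ω₀ t (e.symm y) ![a, c] =
    t.κ (e.symm y) * ((locW π ω₀ b₀ e y)⁻¹ *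
      (a (chartInvD e y (horDir (locG e t.γ) 0 y)) * c (chartInvD e y (horDir (locG e t.γ) 1 y)) -
        a (chartInvD e y (horDir (locG e t.γ) 1 y)) *
          c (chartInvD e y (horDir (locG e t.γ) 0 y)))) +
      locU π Ω ω₀ b₀ e y *
        (locB e t.β 0 y * (a (chartInvD e y (basisVec (vidx 1))) *
          c (chartInvD e y (basisVec (vidx 2))) - a (chartInvD e y (basisVec (vidx 2))) *
          c (chartInvD e y (basisVec (vidx 1)))) +
        locB e t.β 1 y * (a (chartInvD e y (basisVec (vidx 2))) *
          c (chartInvD e y (basisVec (vidx 0))) - a (chartInvD e y (basisVec (vidx 0))) *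
          c (chartInvD e y (basisVec (vidx 2)))) +
        locB e t.β 2 y * (a (chartInvD e y (basisVec (vidx 0))) *
          c (chartInvD e y (basisVec (vidx 1))) - a (chartInvD e y (basisVec (vidx 1))) *
          c (chartInvD e y (basisVec (vidx 0))))) := by
  rw [(he.frame D.proj D.split hy).tripleTensor_apply (D.base_ne _) (D.Ω_ne _),
    D.frame_volume he hy _ rfl]
  rfl

/-- The bracket of a triple in an adapted chart. -/
theorem bracket_tripleTensor {f g : M → ℝ} (hf : ContDiffAt ℝ ∞ (f ∘ e.symm) y)
    (hg : ContDiffAt ℝ ∞ (g ∘ e.symm) y) : bracket (tripleTensor π Ω ω₀ t) f g (e.symm y) =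
      triBracket (locU π Ω ω₀ b₀ e) (locG e t.γ)
        (fun z => t.κ (e.symm z) * (locW π ω₀ b₀ e z)⁻¹) (locB e t.β) (f ∘ e.symm)
        (g ∘ e.symm) y := by
  rw [bracket, D.tripleTensor_apply he hy]
  simp only [dFun_apply_chart he.chart hy hf, dFun_apply_chart he.chart hy hg, fderiv_horDir]
  simp only [triBracket, pb, vd, pd]
  ring

/-- The Jacobi identity for the tensor of a triple at a point of a chart. -/
theorem jacobi_tripleTensor {U : Set M} (hU : IsOpen U) (hyU : e.symm y ∈ U)
    (hκ : ContMDiffOn 𝓘(ℝ, E 5) 𝓘(ℝ, ℝ) ∞ t.κ U) (ht : IsLocalTriple π Ω ω₀ b₀ e t y)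
    {f g h : M → ℝ} (hf : ContMDiffOn 𝓘(ℝ, E 5) 𝓘(ℝ, ℝ) ∞ f U)
    (hg : ContMDiffOn 𝓘(ℝ, E 5) 𝓘(ℝ, ℝ) ∞ g U) (hh : ContMDiffOn 𝓘(ℝ, E 5) 𝓘(ℝ, ℝ) ∞ h U) :
    bracket (tripleTensor π Ω ω₀ t) f (bracket (tripleTensor π Ω ω₀ t) g h) (e.symm y) +
      bracket (tripleTensor π Ω ω₀ t) g (bracket (tripleTensor π Ω ω₀ t) h f) (e.symm y) +
      bracket (tripleTensor π Ω ω₀ t) h (bracket (tripleTensor π Ω ω₀ t) f g) (e.symm y) = 0 := by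
  have hs : ∀ {φ : M → ℝ}, ContMDiffOn 𝓘(ℝ, E 5) 𝓘(ℝ, ℝ) ∞ φ U → ∀ z ∈ e.target, e.symm z ∈ U →
      ContDiffAt ℝ ∞ (φ ∘ e.symm) z := fun hφ z hz hzU =>
    contDiffAt_comp_symm he.chart hz (hφ.contMDiffAt (hU.mem_nhds hzU))
  have hev : ∀ᶠ z in 𝓝 y, z ∈ e.target ∧ e.symm z ∈ U :=
    Filter.Eventually.and (e.open_target.mem_nhds hy)
      ((e.continuousAt_symm hy).eventually (hU.mem_nhds hyU))
  set α : E 5 → ℝ := fun z => t.κ (e.symm z) * (locW π ω₀ b₀ e z)⁻¹ with hα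
  have hαs : ContDiffAt ℝ ∞ α y :=
    (hs hκ y hy hyU).mul ((D.contDiffAt_W he hy).inv (D.W_ne he hy))
  have hk : t.κ ∘ e.symm =ᶠ[𝓝 y] fun z => locW π ω₀ b₀ e z * α z := by
    filter_upwards [hev] with z hz
    have := D.W_ne he hz.1
    simp only [hα, Function.comp_apply]
    field_simp
  have hG := D.contDiffAt_G he hy
  have hu := D.contDiffAt_U he hy
  have hb := D.contDiffAt_B he hy
  -- The outer bracket differentiates the inner one, so the coordinate expression of the inner
  -- bracket is needed on a neighbourhood of y.
  have key : ∀ {φ χ ψ : M → ℝ}, ContMDiffOn 𝓘(ℝ, E 5) 𝓘(ℝ, ℝ) ∞ φ U →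
      ContMDiffOn 𝓘(ℝ, E 5) 𝓘(ℝ, ℝ) ∞ χ U → ContMDiffOn 𝓘(ℝ, E 5) 𝓘(ℝ, ℝ) ∞ ψ U →
      bracket (tripleTensor π Ω ω₀ t) φ (bracket (tripleTensor π Ω ω₀ t) χ ψ) (e.symm y) =
        triBracket (locU π Ω ω₀ b₀ e) (locG e t.γ) α (locB e t.β) (φ ∘ e.symm)
          (triBracket (locU π Ω ω₀ b₀ e) (locG e t.γ) α (locB e t.β) (χ ∘ e.symm)
            (ψ ∘ e.symm)) y := by
    intro φ χ ψ hφ hχ hψ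
    have h1 : bracket (tripleTensor π Ω ω₀ t) χ ψ ∘ e.symm =ᶠ[𝓝 y]
        triBracket (locU π Ω ω₀ b₀ e) (locG e t.γ) α (locB e t.β) (χ ∘ e.symm) (ψ ∘ e.symm) := by
      filter_upwards [hev] with z hz
      exact D.bracket_tripleTensor he hz.1 (hs hχ z hz.1 hz.2) (hs hψ z hz.1 hz.2)
    rw [D.bracket_tripleTensor he hy (hs hφ y hy hyU) ((contDiffAt_triBracket hG hu hb hαs
      (hs hχ y hy hyU) (hs hψ y hy hyU)).congr_of_eventuallyEq h1)]
    exact triBracket_congr EventuallyEq.rfl h1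
  rw [key hf hg hh, key hg hh hf, key hh hf hg]
  exact LocalTriple.jacobi ht hG hu hb hαs (D.contDiffAt_W he hy) (D.W_ne he hy)
    (fun a => he.vd_locW D.smooth_base hy a) hk (hs hf y hy hyU) (hs hg y hy hyU) (hs hh y hy hyU)

end GaugeData

namespace GaugeData

variable {π : M → B} {b₀ : B} {e : OpenPartialHomeomorph M (E 5)}
  {Ω : M → Alt 5 5} {ω₀ : B → Alt 2 2} {t : Triple M} {μ : M → Alt 5 1}
  (D : GaugeData π Ω ω₀ t μ)

include D

/-- Neither the vertical coordinate frame nor the volume coefficient of an adapted chart involves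
the connection. -/
theorem QV_famConn (ε : ℝ) (p : M) :
    QV π Ω ω₀ (famConn π Ω ω₀ μ t ε) p = QV π Ω ω₀ t.γ p := by
  obtain ⟨e, he, hp⟩ := exists_adapted_chart D.proj D.subm p
  obtain ⟨y, hy, rfl⟩ : ∃ y ∈ e.target, p = e.symm y :=
    ⟨e p, e.map_source hp, (e.left_inv hp).symm⟩
  rw [(he.frame D.proj D.split hy).QV_eq (D.base_ne _) (D.Ω_ne _),
    (he.frame D.proj (D.split_famConn ε) hy).QV_eq (D.base_ne _) (D.Ω_ne _),
    he.frame_vol D.proj, he.frame_vol D.proj]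
  rfl

theorem tripleTensor_famTriple (c : M → ℝ) (ε : ℝ) :
    tripleTensor π Ω ω₀ (famTriple π Ω ω₀ μ c t ε) = famTensor π Ω ω₀ μ c t ε := by
  funext p
  have h := D.QV_famConn ε p
  change (t.κ p / famDenom π Ω ω₀ μ c t ε p) • horMV π (famConn π Ω ω₀ μ t ε) (baseTensor ω₀) p -
    iotaForm (l := 2) (t.β p) (QV π Ω ω₀ (famConn π Ω ω₀ μ t ε) p) = _
  rw [h]
  rfl

end GaugeData

end TripleTensor

/-! ### Joint smoothness in the parameter and the point -/

section Coordinates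

variable {y : E 5} {k u w f g c : E 5 → ℝ} {G : Fin 2 → Fin 3 → E 5 → ℝ}
  {b : Fin 3 → E 5 → ℝ} {m : Fin 2 → E 5 → ℝ} {ε : ℝ}

theorem ContDiffAt.snd_real {f : E 5 → ℝ} (hf : ContDiffAt ℝ ∞ f y) :
    ContDiffAt ℝ ∞ (fun x : ℝ × E 5 => f x.2) (ε, y) :=
  ContDiffAt.comp (ε, y) (g := f) hf contDiffAt_snd

/-- The parameter enters polynomially, with coefficients smooth in y. -/
theorem contDiffAt_gaugeS_joint (hu : ContDiffAt ℝ ∞ u y) (hw : ContDiffAt ℝ ∞ w y) (hw0 : w y ≠ 0)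
    (hb : ∀ a, ContDiffAt ℝ ∞ (b a) y) (hG : ∀ i a, ContDiffAt ℝ ∞ (G i a) y)
    (hk : ContDiffAt ℝ ∞ k y) (hm : ∀ i, ContDiffAt ℝ ∞ (m i) y) (hc : ContDiffAt ℝ ∞ c y) :
    ContDiffAt ℝ ∞ (fun x : ℝ × E 5 => gaugeS u w G k b m c x.1 x.2) (ε, y) := by
  have h1 := ContDiffAt.snd_real (ε := ε) (contDiffAt_hd hG (hm 1) 0)
  have h2 := ContDiffAt.snd_real (ε := ε) (contDiffAt_hd hG (hm 0) 1)
  have h3 := ContDiffAt.snd_real (ε := ε) (contDiffAt_pb hu hb (hm 0) (hm 1))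
  have h4 : ContDiffAt ℝ ∞ (fun x : ℝ × E 5 => x.1) (ε, y) := contDiffAt_fst
  have h5 := ContDiffAt.snd_real (ε := ε) (hw.inv hw0)
  exact contDiffAt_const.sub ((h4.mul (ContDiffAt.snd_real hk)).mul
    ((h5.mul ((h1.sub h2).add (h4.mul h3))).sub (ContDiffAt.snd_real hc)))

theorem contDiffAt_horDir_gaugeG_joint (hu : ContDiffAt ℝ ∞ u y)
    (hb : ∀ a, ContDiffAt ℝ ∞ (b a) y) (hG : ∀ i a, ContDiffAt ℝ ∞ (G i a) y)
    (hm : ∀ i, ContDiffAt ℝ ∞ (m i) y) (i : Fin 2) (j : Fin 5) :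
    ContDiffAt ℝ ∞ (fun x : ℝ × E 5 => horDir (gaugeG u G b m x.1) i x.2 j) (ε, y) := by
  have h1 : ∀ a, ContDiffAt ℝ ∞ (fun x : ℝ × E 5 => gaugeG u G b m x.1 i a x.2) (ε, y) := fun a =>
    (ContDiffAt.snd_real (hG i a)).sub
      (contDiffAt_fst.mul (ContDiffAt.snd_real (contDiffAt_ham hu hb (hm i) a)))
  exact (basisCov j).contDiff.contDiffAt.comp (ε, y) (contDiffAt_const.sub
    (ContDiffAt.sum fun a _ => (h1 a).smul contDiffAt_const))

end Coordinates

/-! ### The family of Poisson tensors -/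

section Family

variable {M B : Type*} [TopologicalSpace M] [ChartedSpace (E 5) M] [TopologicalSpace B]
  [ChartedSpace (E 2) B]

/-- The coordinate expression of `1 - ε κ (ϰ_{μ,ε} - c)` for a triple in an adapted chart. -/
def locS (π : M → B) (Ω : M → Alt 5 5) (ω₀ : B → Alt 2 2) (b₀ : B)
    (e : OpenPartialHomeomorph M (E 5)) (t : Triple M) (μ : M → Alt 5 1) (c : M → ℝ) :
    ℝ → E 5 → ℝ :=
  gaugeS (locU π Ω ω₀ b₀ e) (locW π ω₀ b₀ e) (locG e t.γ) (t.κ ∘ e.symm) (locB e t.β)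
    (locM e μ) (c ∘ e.symm)

theorem IsSmoothMVFamilyOn.isSmoothMVOn {k : ℕ} {W : Set (ℝ × M)} {Q : ℝ → M → MV 5 k}
    (h : IsSmoothMVFamilyOn W Q) (ε : ℝ) : IsSmoothMVOn {p | (ε, p) ∈ W} (Q ε) := by
  intro p₀
  exact (h p₀).comp (f := fun y : E 5 => (ε, y)) (contDiff_const.prodMk contDiff_id).contDiffOn
    fun y hy => hy

variable [IsManifold 𝓘(ℝ, E 5) ∞ M] [IsManifold 𝓘(ℝ, E 2) ∞ B]

namespace GaugeData

variable {π : M → B} {b₀ : B} {e : OpenPartialHomeomorph M (E 5)}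
  {Ω : M → Alt 5 5} {ω₀ : B → Alt 2 2} {t : Triple M} {μ : M → Alt 5 1} {c : M → ℝ}
  (D : GaugeData π Ω ω₀ t μ) (hκ : ContMDiff 𝓘(ℝ, E 5) 𝓘(ℝ, ℝ) ∞ t.κ)
  (hc : ContMDiff 𝓘(ℝ, E 5) 𝓘(ℝ, ℝ) ∞ c)

include D hκ hc

theorem contDiffAt_locS (he : IsAdaptedChart π b₀ e) {y : E 5} (hy : y ∈ e.target) (ε : ℝ) :
    ContDiffAt ℝ ∞ (fun x : ℝ × E 5 => locS π Ω ω₀ b₀ e t μ c x.1 x.2) (ε, y) :=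
  contDiffAt_gaugeS_joint (D.contDiffAt_U he hy) (D.contDiffAt_W he hy) (D.W_ne he hy)
    (D.contDiffAt_B he hy) (D.contDiffAt_G he hy)
    (contDiffAt_comp_symm he.chart hy (hκ _)) (D.contDiffAt_M he hy)
    (contDiffAt_comp_symm he.chart hy (hc _))

/-- In an adapted chart the domain is the locus where a jointly continuous function of (ε, p) does
not vanish. -/
theorem isOpen_domain : IsOpen {z : ℝ × M | z.2 ∈ famDom π Ω ω₀ μ c t z.1} := by
  rw [isOpen_iff_mem_nhds]
  rintro ⟨ε, p⟩ hp
  obtain ⟨e, he, hpe⟩ := exists_adapted_chart D.proj D.subm p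
  have hy := e.map_source hpe
  have h1 : ContinuousAt (fun z : ℝ × M => (z.1, e z.2)) (ε, p) :=
    continuousAt_fst.prodMk ((e.continuousAt hpe).comp (f := Prod.snd) (x := (ε, p))
      continuousAt_snd)
  have h2 : ContinuousAt (fun z : ℝ × M => locS π Ω ω₀ (π p) e t μ c z.1 (e z.2)) (ε, p) :=
    ContinuousAt.comp (g := fun x : ℝ × E 5 => locS π Ω ω₀ (π p) e t μ c x.1 x.2)
      (f := fun z : ℝ × M => (z.1, e z.2)) (D.contDiffAt_locS hκ hc he hy ε).continuousAt h1
  have h3 : ∀ ε' q, q ∈ e.source → famDenom π Ω ω₀ μ c t ε' q =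
      locS π Ω ω₀ (π p) e t μ c ε' (e q) := by
    intro ε' q hq
    have := D.famDenom_eq he (e.map_source hq) c ε'
    rwa [e.left_inv hq] at this
  have h4 : locS π Ω ω₀ (π p) e t μ c ε (e p) ≠ 0 := by
    rw [← h3 ε p hpe]
    exact hp
  have h5 : ∀ᶠ z : ℝ × M in 𝓝 (ε, p), z.2 ∈ e.source :=
    continuousAt_snd.eventually (e.open_source.mem_nhds hpe)
  filter_upwards [h2.eventually_ne h4, h5] with z hz hz'
  change famDenom π Ω ω₀ μ c t z.1 z.2 ≠ 0
  rwa [h3 _ _ hz']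

theorem isOpen_famDom (ε : ℝ) : IsOpen (famDom π Ω ω₀ μ c t ε) :=
  (D.isOpen_domain hκ hc).preimage (f := fun p : M => (ε, p)) (by fun_prop)

/-- In an adapted chart the components are built from the lifts h_i + ε X_{m_i}, smooth functions of
y and the reciprocal of the denominator, which is nonzero on the domain. -/
theorem smooth_famTensor :
    IsSmoothMVFamilyOn {z : ℝ × M | z.2 ∈ famDom π Ω ω₀ μ c t z.1} (famTensor π Ω ω₀ μ c t) := by
  refine isSmoothMVFamilyOn_of_charts ?_
  rintro ⟨ε, p⟩ hp
  obtain ⟨e, he, hpe⟩ := exists_adapted_chart D.proj D.subm p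
  refine ⟨e, he.chart, hpe, fun g => ?_⟩
  set y := e p with hydef
  have hy : y ∈ e.target := e.map_source hpe
  have hu := D.contDiffAt_U he hy
  have hb := D.contDiffAt_B he hy
  have hG := D.contDiffAt_G he hy
  have hm := D.contDiffAt_M he hy
  have hS := D.contDiffAt_locS hκ hc he hy ε
  have hS0 : locS π Ω ω₀ (π p) e t μ c ε y ≠ 0 := by
    have h1 : famDenom π Ω ω₀ μ c t ε (e.symm y) = locS π Ω ω₀ (π p) e t μ c ε y :=
      D.famDenom_eq he hy c ε
    rw [hydef, e.left_inv hpe] at h1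
    rw [← h1]
    exact hp
  have hH := fun i j => contDiffAt_horDir_gaugeG_joint (ε := ε) hu hb hG hm i j
  have hk := ContDiffAt.snd_real (ε := ε) (contDiffAt_comp_symm he.chart hy (hκ _))
  have hw := ContDiffAt.snd_real (ε := ε) ((D.contDiffAt_W he hy).inv (D.W_ne he hy))
  have hus := ContDiffAt.snd_real (ε := ε) hu
  have hbs := fun a => ContDiffAt.snd_real (ε := ε) (hb a)
  have hev : ∀ᶠ x : ℝ × E 5 in 𝓝 (ε, y), x.2 ∈ e.target :=
    continuousAt_snd.eventually (e.open_target.mem_nhds hy)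
  refine ContDiffAt.congr_of_eventuallyEq (((hk.div hS hS0).mul (hw.mul
    (((hH 0 (g 0)).mul (hH 1 (g 1))).sub ((hH 1 (g 0)).mul (hH 0 (g 1)))))).add
    (hus.mul (((hbs 0).mul (contDiffAt_const (c := (basisVec (vidx 1) : E 5) (g 0) *
      (basisVec (vidx 2) : E 5) (g 1) - (basisVec (vidx 2) : E 5) (g 0) *
      (basisVec (vidx 1) : E 5) (g 1)))).add ((hbs 1).mul (contDiffAt_const
      (c := (basisVec (vidx 2) : E 5) (g 0) *
      (basisVec (vidx 0) : E 5) (g 1) - (basisVec (vidx 0) : E 5) (g 0) *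
      (basisVec (vidx 2) : E 5) (g 1)))) |>.add ((hbs 2).mul (contDiffAt_const
      (c := (basisVec (vidx 0) : E 5) (g 0) *
      (basisVec (vidx 1) : E 5) (g 1) - (basisVec (vidx 1) : E 5) (g 0) *
      (basisVec (vidx 0) : E 5) (g 1))))))) ?_
  filter_upwards [hev] with x hx
  have h2 : ∀ i, horDir (locG e (famConn π Ω ω₀ μ t x.1)) i x.2 =
      horDir (gaugeG (locU π Ω ω₀ (π p) e) (locG e t.γ) (locB e t.β) (locM e μ) x.1) i x.2 := by
    intro i
    have := fun a => D.locG_famConn x.1 he hx i a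
    simp only [horDir, this]
    rfl
  have h3 : ∀ i v, (basisCov (g i) ∘L chartD e (e.symm x.2)) (chartInvD e x.2 v) = v (g i) := by
    intro i v
    rw [ContinuousLinearMap.comp_apply, he.chart.chartD_chartInvD hx, basisCov_apply]
  have h4 : famDenom π Ω ω₀ μ c t x.1 (e.symm x.2) = locS π Ω ω₀ (π p) e t μ c x.1 x.2 :=
    D.famDenom_eq he hx c x.1
  rw [← D.tripleTensor_famTriple c x.1]
  refine (congrArg (tripleTensor π Ω ω₀ (famTriple π Ω ω₀ μ c t x.1) (e.symm x.2))
    (AdaptedFrame.vec_two _)).trans ?_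
  refine ((D.gauged x.1 (famTriple π Ω ω₀ μ c t x.1).κ).tripleTensor_apply he hx _ _).trans ?_
  have h5 : (famTriple π Ω ω₀ μ c t x.1).κ (e.symm x.2) =
      t.κ (e.symm x.2) / locS π Ω ω₀ (π p) e t μ c x.1 x.2 := by
    rw [← h4]
    rfl
  simp only [h2, h3, h5]
  rfl

theorem smooth_κ_famTriple (ε : ℝ) : ContMDiffOn 𝓘(ℝ, E 5) 𝓘(ℝ, ℝ) ∞
    (famTriple π Ω ω₀ μ c t ε).κ (famDom π Ω ω₀ μ c t ε) := by
  intro p hp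
  obtain ⟨e, he, hpe⟩ := exists_adapted_chart D.proj D.subm p
  obtain ⟨y, hy, rfl⟩ : ∃ y ∈ e.target, p = e.symm y :=
    ⟨e p, e.map_source hpe, (e.left_inv hpe).symm⟩
  refine (contMDiffAt_of_comp_symm he.chart hy ?_).contMDiffWithinAt
  have h1 : ContDiffAt ℝ ∞ (fun z => locS π Ω ω₀ (π (e.symm y)) e t μ c ε z) y :=
    ContDiffAt.comp y (g := fun x : ℝ × E 5 => locS π Ω ω₀ (π (e.symm y)) e t μ c x.1 x.2)
      (f := fun z => (ε, z)) (D.contDiffAt_locS hκ hc he hy ε)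
      (contDiffAt_const.prodMk contDiffAt_id)
  have h2 : locS π Ω ω₀ (π (e.symm y)) e t μ c ε y ≠ 0 := by
    have : famDenom π Ω ω₀ μ c t ε (e.symm y) = locS π Ω ω₀ (π (e.symm y)) e t μ c ε y :=
      D.famDenom_eq he hy c ε
    rw [← this]
    exact hp
  refine ((contDiffAt_comp_symm he.chart hy (hκ _)).div h1 h2).congr_of_eventuallyEq ?_
  filter_upwards [e.open_target.mem_nhds hy] with z hz
  change t.κ (e.symm z) / famDenom π Ω ω₀ μ c t ε (e.symm z) = _
  rw [D.famDenom_eq he hz]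
  rfl

variable (hcas : ∀ p, wedge (d01 t.γ (ofFun c) p) (t.β p) = 0)
  (ht : ∀ p, wedge (d01 t.γ t.β p) (t.β p) = 0 ∧
    t.κ p • (d10 t.γ t.β p - wedge (theta π Ω ω₀ t.γ p) (t.β p)) = 0 ∧
    wedge (d01 t.γ (ofFun t.κ) p) (t.β p) - (t.κ p) ^ 2 • rhoForm π Ω ω₀ t.γ p = 0)

include hcas ht

/-- The local equations hold for the members of the family. -/
theorem isLocalTriple_famTriple (he : IsAdaptedChart π b₀ e) {y : E 5} (hy : y ∈ e.target) (ε : ℝ)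
    (hs : e.symm y ∈ famDom π Ω ω₀ μ c t ε) :
    IsLocalTriple π Ω ω₀ b₀ e (famTriple π Ω ω₀ μ c t ε) y := by
  have hκy := contDiffAt_comp_symm he.chart hy (hκ (e.symm y))
  have hcy := contDiffAt_comp_symm he.chart hy (hc (e.symm y))
  have h1 : IsLocalTriple π Ω ω₀ b₀ e t y :=
    (he.localTriple_iff D.proj D.subm D.smooth_Ω D.Ω_ne D.smooth_base D.base_ne D.split D.smooth_γ
      D.vertical_β D.smooth_β hy hκy).1 (ht _)
  have h2 : ∀ a d, vd a (c ∘ e.symm) y * locB e t.β d y -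
      vd d (c ∘ e.symm) y * locB e t.β a y = 0 := by
    intro a d
    set F := he.frame D.proj D.split hy with hF
    have h3 : (wedge (d01 t.γ (ofFun c) (e.symm y)) (t.β (e.symm y)) : Alt 5 2) ![F.V a, F.V d] =
        _ := wedge_one_one _ _ _
    have h4 : ∀ a, toCov (d01 t.γ (ofFun c) (e.symm y)) (F.V a) = vd a (c ∘ e.symm) y := by
      intro a
      rw [d01_ofFun_V F]
      exact extD_ofFun_apply_chart he.chart hy hcy _
    rw [hcas] at h3
    simp only [Matrix.cons_val_zero, Matrix.cons_val_one, h4] at h3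
    exact h3.symm
  -- The Casimir condition dc ∧ β = 0 along the fibres says X_c = 0.
  have h5 : ∀ a, ham (locU π Ω ω₀ b₀ e) (locB e t.β) (c ∘ e.symm) a y = 0 := by
    intro a
    fin_cases a
    · simp only [Fin.zero_eta, ham_zero]
      linear_combination locU π Ω ω₀ b₀ e y * h2 2 1
    · simp only [Fin.mk_one, ham_one]
      linear_combination locU π Ω ω₀ b₀ e y * h2 0 2
    · simp only [Fin.reduceFinMk, ham_two]
      linear_combination locU π Ω ω₀ b₀ e y * h2 1 0
  have h6 := D.famDenom_eq he hy c ε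
  have h7 := LocalTriple.gauge h1 (D.contDiffAt_U he hy) (D.contDiffAt_W he hy) (D.W_ne he hy)
    (fun a => he.vd_locW D.smooth_base hy a) (D.contDiffAt_B he hy) (D.contDiffAt_G he hy) hκy
    (D.contDiffAt_M he hy) hcy h5 (ε := ε) (by
      change gaugeS _ _ _ _ (locB e t.β) _ _ _ _ ≠ 0
      rw [← h6]
      exact hs)
  refine h7.congr (fun i a => ?_) ?_
  · filter_upwards [e.open_target.mem_nhds hy] with z hz
    exact D.locG_famConn ε he hz i a
  · filter_upwards [e.open_target.mem_nhds hy] with z hz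
    change t.κ (e.symm z) / famDenom π Ω ω₀ μ c t ε (e.symm z) = _
    rw [D.famDenom_eq he hz]
    rfl

theorem isPoissonTripleOn_famTriple (ε : ℝ) : IsPoissonTripleOn π Ω ω₀ (famDom π Ω ω₀ μ c t ε)
    (famTriple π Ω ω₀ μ c t ε) := by
  have hU := D.isOpen_famDom hκ hc ε
  have hκε := D.smooth_κ_famTriple hκ hc ε
  set τ := famTriple π Ω ω₀ μ c t ε with hτ
  have key : ∀ p ∈ famDom π Ω ω₀ μ c t ε, wedge (d01 τ.γ τ.β p) (τ.β p) = 0 ∧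
      τ.κ p • (d10 τ.γ τ.β p - wedge (theta π Ω ω₀ τ.γ p) (τ.β p)) = 0 ∧
      wedge (d01 τ.γ (ofFun τ.κ) p) (τ.β p) - (τ.κ p) ^ 2 • rhoForm π Ω ω₀ τ.γ p = 0 := by
    intro p hp
    obtain ⟨e, he, hpe⟩ := exists_adapted_chart D.proj D.subm p
    obtain ⟨y, hy, rfl⟩ : ∃ y ∈ e.target, p = e.symm y :=
      ⟨e p, e.map_source hpe, (e.left_inv hpe).symm⟩
    -- The new κ is known to be smooth only on the domain; elsewhere it has the default value of
    -- division by zero. The regularity of the remaining data is global, and smoothness of κ is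
    -- supplied at the point.
    have D' := D.gauged ε τ.κ
    exact (he.localTriple_iff (t := τ) D'.proj D'.subm D'.smooth_Ω D'.Ω_ne
      D'.smooth_base D'.base_ne D'.split D'.smooth_γ D'.vertical_β D'.smooth_β hy
      (contDiffAt_comp_symm he.chart hy (hκε.contMDiffAt (hU.mem_nhds hp)))).2
      (D.isLocalTriple_famTriple hκ hc hcas ht he hy ε hp)
  refine ⟨⟨fun p₀ => (D.smooth_famConn ε p₀).mono fun y hy => ⟨hy.1, trivial⟩,
    fun p _ => D.split_famConn ε p⟩, hκε, fun p₀ => (D.smooth_β p₀).mono fun y hy =>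
      ⟨hy.1, trivial⟩, fun p _ => D.vertical_beta_famConn ε p, fun p hp => (key p hp).1,
      fun p hp => (key p hp).2.1, fun p hp => (key p hp).2.2⟩

theorem isPoissonOn_famTensor (ε : ℝ) :
    IsPoissonOn (famDom π Ω ω₀ μ c t ε) (famTensor π Ω ω₀ μ c t ε) := by
  refine ⟨(D.smooth_famTensor hκ hc).isSmoothMVOn ε, fun f g h hf hg hh p hp => ?_⟩
  obtain ⟨e, he, hpe⟩ := exists_adapted_chart D.proj D.subm p
  obtain ⟨y, hy, rfl⟩ : ∃ y ∈ e.target, p = e.symm y :=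
    ⟨e p, e.map_source hpe, (e.left_inv hpe).symm⟩
  rw [← D.tripleTensor_famTriple c ε]
  exact (D.gauged ε (famTriple π Ω ω₀ μ c t ε).κ).jacobi_tripleTensor he hy
    (D.isOpen_famDom hκ hc ε) hp (D.smooth_κ_famTriple hκ hc ε)
    (D.isLocalTriple_famTriple hκ hc hcas ht he hy ε hp) hf hg hh

end GaugeData

end Family

end FiberedPoisson

end

theorem mainTheorem10
    {M B : Type*}
    [TopologicalSpace M] [ChartedSpace (E 5) M] [IsManifold 𝓘(ℝ, E 5) ∞ M]
    [T2Space M] [SecondCountableTopology M]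
    [TopologicalSpace B] [ChartedSpace (E 2) B] [IsManifold 𝓘(ℝ, E 2) ∞ B]
    [T2Space B] [SecondCountableTopology B]
    (π : M → B) (hπ : ContMDiff 𝓘(ℝ, E 5) 𝓘(ℝ, E 2) ∞ π) (hπ_surj : Function.Surjective π)
    (hπ_subm : ∀ p : M, Function.Surjective (dProj π p))
    (Ω : M → Alt 5 5) (hΩ : IsSmoothFormOn Set.univ Ω) (hΩ_ne : ∀ p, Ω p ≠ 0)
    (ω₀ : B → Alt 2 2) (hω : IsSmoothFormOn Set.univ ω₀) (hω_ne : ∀ b, ω₀ b ≠ 0)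
    (t : Triple M) (ht : IsPoissonTripleOn π Ω ω₀ Set.univ t)
    (μ : M → Alt 5 1) (hμ : IsSmoothFormOn Set.univ μ)
    (hμ_hor : ∀ p v, dProj π p v = 0 → toCov (μ p) v = 0)
    (c : M → ℝ) (hc : ContMDiff 𝓘(ℝ, E 5) 𝓘(ℝ, ℝ) ∞ c)
    (hc_cas : ∀ p, wedge (d01 t.γ (ofFun c) p) (t.β p) = 0) :
    (∀ ε : ℝ, ε ≠ 0 →
      rescale (1 / ε) (gaugeTransf π Ω ω₀ μ c (rescale ε t)) = famTriple π Ω ω₀ μ c t ε) ∧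
    IsOpen {z : ℝ × M | z.2 ∈ famDom π Ω ω₀ μ c t z.1} ∧
    IsSmoothMVFamilyOn {z : ℝ × M | z.2 ∈ famDom π Ω ω₀ μ c t z.1} (famTensor π Ω ω₀ μ c t) ∧
    (∀ ε : ℝ,
      IsConnectionOn π Set.univ (famConn π Ω ω₀ μ t ε) ∧
      IsPoissonTripleOn π Ω ω₀ (famDom π Ω ω₀ μ c t ε) (famTriple π Ω ω₀ μ c t ε) ∧
      tripleTensor π Ω ω₀ (famTriple π Ω ω₀ μ c t ε) = famTensor π Ω ω₀ μ c t ε ∧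
      IsAlmostCouplingOn π (famDom π Ω ω₀ μ c t ε) (famConn π Ω ω₀ μ t ε)
        (famTensor π Ω ω₀ μ c t ε) ∧
      IsPoissonOn (famDom π Ω ω₀ μ c t ε) (famTensor π Ω ω₀ μ c t ε)) ∧
    famDom π Ω ω₀ μ c t 0 = Set.univ ∧
    famTensor π Ω ω₀ μ c t 0 = tripleTensor π Ω ω₀ t := by
  have hκ : ContMDiff 𝓘(ℝ, E 5) 𝓘(ℝ, ℝ) ∞ t.κ := contMDiffOn_univ.1 ht.smooth_κ
  have D : GaugeData π Ω ω₀ t μ := ⟨hπ, hπ_subm, hΩ, hΩ_ne, hω, hω_ne,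
    fun p => ht.connection.2 p trivial, ht.connection.1, fun p => ht.vertical_β p trivial,
    ht.smooth_β, hμ_hor, hμ⟩
  have hE := fun p => And.intro (ht.eq1 p trivial) (And.intro (ht.eq2 p trivial) (ht.eq3 p trivial))
  -- The parameter value 0 is not reached by the rescalings: here the denominator is 1 and the shift
  -- has coefficient 0.
  have h0 : ∀ p, famDenom π Ω ω₀ μ c t 0 p = 1 := fun p => by simp [famDenom]
  have hγ : famConn π Ω ω₀ μ t 0 = t.γ := by
    funext p
    ext1 v
    exact (congrArg (t.γ p v + ·) (zero_smul ℝ _)).trans (add_zero _)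
  refine ⟨fun ε hε => rescale_gaugeTransf π Ω ω₀ μ t ε c hε, D.isOpen_domain hκ hc,
    D.smooth_famTensor hκ hc, fun ε => ⟨⟨D.smooth_famConn ε, fun p _ => D.split_famConn ε p⟩,
      D.isPoissonTripleOn_famTriple hκ hc hc_cas hE ε, D.tripleTensor_famTriple c ε, ?_,
      D.isPoissonOn_famTensor hκ hc hc_cas hE ε⟩, ?_, ?_⟩
  · rw [← D.tripleTensor_famTriple c ε]
    exact (D.gauged ε (famTriple π Ω ω₀ μ c t ε).κ).isAlmostCouplingOn _
  · ext p
    simp [famDom, h0]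
  · funext p
    rw [famTensor, tripleTensor, h0, hγ, div_one]
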